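/- Let $N\ge 3$ be an integer, $\alpha\in(0,N)$, $p,q>1$ real, and let $K\in C^1(\mathbb R^N)$, $K\ge 0$. Let $I_\alpha(x)=A_\alpha|x|^{-(N-\alpha)}$ with $A_\alpha=\frac{\Gamma(\frac{N-\alpha}{2})}{\Gamma(\frac{\alpha}{2})\pi^{N/2}2^\alpha}$ be the Riesz potential. Let $u,\phi:\mathbb R^N\to\mathbb R$ form a weak (distributional) solution of $$-\Delta u+u+K(x)\phi|u|^{q-2}u=(I_\alpha*|u|^p)|u|^{p-2}u,\qquad -\Delta\phi=K(x)|u|^q\qquad\text{in }\mathbb R^N,$$ such that $$u\in H^1(\mathbb R^N)\cap L^{\frac{2Np}{N+\alpha}}(\mathbb R^N),\quad \phi\in H^1(\mathbb R^N),$$ $$K|u|^q\in L^{\frac{2N}{N+2}}(\mathbb R^N),\quad \nabla u\in H^1_{loc}(\mathbb R^N)\cap L^{\frac{2Np}{N+\alpha}}_{loc}(\mathbb R^N).$$ Then $|\nabla u|^2$, $|u|^2$, $K\phi|u|^q$ and $(I_\alpha*|u|^p)|u|^p$ are integrable on $\mathbb R^N$. Moreover, whenever the integral $\int_{\mathbb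 R^N}\phi|u|^q\,x\cdot\nabla K$ exists in the extended Lebesgue sense (that is, the positive part or the negative part of its integrand is integrable), its integrand is integrable and $$\int_{\mathbb R^N}\Big(\frac{N-2}{2}|\nabla u|^2+\frac N2|u|^2\Big)+\frac{N+2}{2q}\int_{\mathbb R^N}K\phi|u|^q+\frac1q\int_{\mathbb R^N}\phi|u|^q\,x\cdot\nabla K=\frac{N+\alpha}{2p}\int_{\mathbb R^N}(I_\alpha*|u|^p)|u|^p.$$ -/

import Mathlib

open MeasureTheory
open scoped ContDiff

noncomputable section

/-- Euclidean space `ℝ^N`. -/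
abbrev RN (N : ℕ) : Type := EuclideanSpace ℝ (Fin N)

/-- Smooth compactly supported test functions on `ℝ^N`. -/
def IsTestFunction {N : ℕ} (ψ : RN N → ℝ) : Prop :=
  ContDiff ℝ ∞ ψ ∧ HasCompactSupport ψ

/-- `g` is a weak (distributional) gradient of `f` on `ℝ^N`. It is unique up to null sets. -/
structure IsWeakGradient {N : ℕ} (f : RN N → ℝ) (g : RN N → RN N) : Prop where
  locallyIntegrable_fun : LocallyIntegrable f volume
  locallyIntegrable_grad : LocallyIntegrable g volume
  integral_eq : ∀ ψ : RN N → ℝ, IsTestFunction ψ →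
    ∫ x, f x • gradient ψ x = - ∫ x, ψ x • g x

/-- `f ∈ L^s_loc(ℝ^N)`. -/
def MemLpLoc {N : ℕ} {F : Type*} [NormedAddCommGroup F] (f : RN N → F) (s : ENNReal) : Prop :=
  ∀ S : Set (RN N), IsCompact S → MemLp f s (volume.restrict S)

/-- `f ∈ H^1_loc(ℝ^N)`. -/
def MemH1Loc {N : ℕ} (f : RN N → ℝ) : Prop :=
  MemLpLoc f 2 ∧ ∃ g : RN N → RN N, IsWeakGradient f g ∧ MemLpLoc g 2

/-- The constant `A_α` normalising the Riesz potential on `ℝ^N`. -/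
def rieszConst (N : ℕ) (α : ℝ) : ℝ :=
  Real.Gamma (((N : ℝ) - α) / 2) /
    (Real.Gamma (α / 2) * Real.pi ^ ((N : ℝ) / 2) * (2 : ℝ) ^ α)

/-- The Riesz kernel `I_α(x) = A_α / |x|^(N-α)`. -/
def rieszKernel {N : ℕ} (α : ℝ) (x : RN N) : ℝ :=
  rieszConst N α / ‖x‖ ^ ((N : ℝ) - α)

/-- The convolution `I_α * f`. -/
def rieszPotential {N : ℕ} (α : ℝ) (f : RN N → ℝ) (x : RN N) : ℝ :=
  ∫ y, rieszKernel α (x - y) * f y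

/-- `(u, φ)`, with weak gradients `Du` and `Dφ`, is a weak solution on `ℝ^N` of
`-Δu + u + K φ |u|^(q-2) u = (I_α * |u|^p) |u|^(p-2) u`, `-Δφ = K |u|^q`. -/
structure IsWeakSolution {N : ℕ} (α p q : ℝ) (K u φ : RN N → ℝ) (Du Dφ : RN N → RN N) :
    Prop where
  grad_u : IsWeakGradient u Du
  grad_φ : IsWeakGradient φ Dφ
  eq_u : ∀ ψ : RN N → ℝ, IsTestFunction ψ →
    (∫ x, inner ℝ (Du x) (gradient ψ x)) + (∫ x, u x * ψ x)
        + (∫ x, K x * φ x * (|u x| ^ (q - 2) * u x) * ψ x)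
      = ∫ x, rieszPotential α (fun y => |u y| ^ p) x * (|u x| ^ (p - 2) * u x) * ψ x
  eq_φ : ∀ ψ : RN N → ℝ, IsTestFunction ψ →
    (∫ x, inner ℝ (Dφ x) (gradient ψ x)) = ∫ x, K x * |u x| ^ q * ψ x

/-- The regularity class:
`u ∈ H^1 ∩ L^(2Np/(N+α))`, `φ ∈ H^1`, `K |u|^q ∈ L^(2N/(N+2))`,
`∇u ∈ H^1_loc ∩ L^(2Np/(N+α))_loc`, where `Du`, `Dφ` are the weak gradients of `u`, `φ`. -/
structure HasSolutionRegularity {N : ℕ} (α p q : ℝ) (K u φ : RN N → ℝ)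
    (Du Dφ : RN N → RN N) : Prop where
  u_L2 : MemLp u 2 volume
  Du_L2 : MemLp Du 2 volume
  u_Ls : MemLp u (ENNReal.ofReal (2 * N * p / (N + α))) volume
  φ_L2 : MemLp φ 2 volume
  Dφ_L2 : MemLp Dφ 2 volume
  source_Lr : MemLp (fun x => K x * |u x| ^ q) (ENNReal.ofReal (2 * N / (N + 2))) volume
  Du_H1loc : ∀ i : Fin N, MemH1Loc (fun x => Du x i)
  Du_Lsloc : MemLpLoc Du (ENNReal.ofReal (2 * N * p / (N + α)))

/-- The integrand `φ |u|^q x·∇K`. -/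
def virialDensity {N : ℕ} (q : ℝ) (K u φ : RN N → ℝ) (x : RN N) : ℝ :=
  φ x * |u x| ^ q * inner ℝ x (gradient K x)

end

open Filter Topology Set

/-!
Test both equations with a compactly supported vector field `X`. Testing `-Δu = f` with `⟨∇u, X⟩`
turns the left side into the stress form `∫ ⟨∇u, DX ∇u⟩ - ½ div X |∇u|²`, and the Choquard term
into a double integral of `|u(x)|^p |u(y)|^p |x - y|^(α-N)` against the symmetrised divergence
of `X` along the kernel. The coupling term `∫ K φ |u|^(q-2) u ⟨∇u, X⟩` is `1/q` times the derivative
of `|u|^q` along `X` against `K φ`; integrating by parts produces `⟨∇φ, X⟩` against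
`K |u|^q = -Δφ`, which is again a stress form, now of `φ`, plus the integral of `φ |u|^q ⟨X, ∇K⟩`.
Take for `X` the position field cut off at distance `1/l` and let `l → 0`: every term converges by
dominated convergence except the last, whose limit is then forced; since its integrand has a sign up
to an integrable error, Fatou's lemma makes it integrable. The energy identity
`∫ K φ |u|^q = ∫ |∇φ|²` eliminates `φ` from the result.
-/

/-! ### Divergence of vector fields -/

section Divergence

variable {N : ℕ}

/-- The `i`-th vector of the standard basis of `ℝ^N`. -/
noncomputable abbrev stdVec (i : Fin N) : RN N := EuclideanSpace.single i (1 : ℝ)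

/-- The divergence `∑ i, ∂ᵢYᵢ` of a vector field on `ℝ^N`. -/
noncomputable def divergence (Y : RN N → RN N) (x : RN N) : ℝ :=
  ∑ i, fderiv ℝ Y x (stdVec i) i

lemma sum_smul_stdVec (v : RN N) : ∑ i, v i • stdVec i = v := by
  ext j
  simp [Pi.single_apply, Finset.sum_apply]

lemma clm_apply_eq_sum_stdVec {F : Type*} [NormedAddCommGroup F] [NormedSpace ℝ F]
    (L : RN N →L[ℝ] F) (v : RN N) : L v = ∑ i, v i • L (stdVec i) := by
  conv_lhs => rw [← sum_smul_stdVec v]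
  simp only [map_sum, map_smul]

lemma inner_eq_sum_coord (v w : RN N) : inner ℝ v w = ∑ i, v i * w i := by
  simp [PiLp.inner_apply, mul_comm]

lemma fderiv_coord {Y : RN N → RN N} {x : RN N} (h : DifferentiableAt ℝ Y x) (i : Fin N)
    (v : RN N) : fderiv ℝ (fun y => Y y i) x v = fderiv ℝ Y x v i :=
  congrArg (· v) ((EuclideanSpace.proj (𝕜 := ℝ) i).hasFDerivAt.comp x h.hasFDerivAt).fderiv

lemma contDiff_coord {n : WithTop ℕ∞} {Y : RN N → RN N} (h : ContDiff ℝ n Y) (i : Fin N) :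
    ContDiff ℝ n (fun y => Y y i) :=
  (EuclideanSpace.proj (𝕜 := ℝ) i : RN N →L[ℝ] ℝ).contDiff.comp h

lemma hasCompactSupport_coord {Y : RN N → RN N} (h : HasCompactSupport Y) (i : Fin N) :
    HasCompactSupport (fun y => Y y i) :=
  h.comp_left (g := fun v : RN N => v i) rfl

lemma hasCompactSupport_fderiv_apply {E F : Type*} [NormedAddCommGroup E] [NormedSpace ℝ E]
    [NormedAddCommGroup F] [NormedSpace ℝ F] {f : E → F} (hf : HasCompactSupport f) (v : E) :
    HasCompactSupport fun x => fderiv ℝ f x v :=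
  (hf.fderiv ℝ).comp_left (g := fun L : E →L[ℝ] F => L v) rfl

lemma continuous_fderiv_apply {E F : Type*} [NormedAddCommGroup E] [NormedSpace ℝ E]
    [NormedAddCommGroup F] [NormedSpace ℝ F] {f : E → F} (hf : ContDiff ℝ 1 f) {X : E → E}
    (hX : Continuous X) : Continuous fun x => fderiv ℝ f x (X x) :=
  (hf.continuous_fderiv one_ne_zero).clm_apply hX

lemma continuous_divergence {Y : RN N → RN N} (h : ContDiff ℝ 1 Y) : Continuous (divergence Y) :=
  continuous_finsetSum _ fun i _ => (EuclideanSpace.proj (𝕜 := ℝ) i).continuous.comp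
    (continuous_fderiv_apply h continuous_const)

lemma hasCompactSupport_divergence {Y : RN N → RN N} (h : HasCompactSupport Y) :
    HasCompactSupport (divergence Y) :=
  (h.fderiv ℝ).comp_left (g := fun L : RN N →L[ℝ] RN N => ∑ i, L (stdVec i) i) (by simp)

lemma exists_forall_norm_le_of_hasCompactSupport {E F : Type*} [TopologicalSpace E]
    [NormedAddCommGroup F] {f : E → F} (hf : Continuous f) (hc : HasCompactSupport f) :
    ∃ C, 0 ≤ C ∧ ∀ x, ‖f x‖ ≤ C := by
  obtain ⟨C, hC⟩ := hf.bounded_above_of_compact_support hc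
  exact ⟨max C 0, le_max_right _ _, fun x => (hC x).trans (le_max_left _ _)⟩

lemma fderiv_comp_const_sub {E F : Type*} [NormedAddCommGroup E] [NormedSpace ℝ E]
    [NormedAddCommGroup F] [NormedSpace ℝ F] (f : E → F) (x y : E) :
    fderiv ℝ (fun y => f (x - y)) y = -fderiv ℝ f (x - y) := by
  simpa [← sub_eq_add_neg, fderiv_comp_add_left] using
    fderiv_comp_smul (f := fun z => f (x + z)) (x := y) (-1 : ℝ)

lemma fderiv_neg_of_even {E F : Type*} [NormedAddCommGroup E] [NormedSpace ℝ E]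
    [NormedAddCommGroup F] [NormedSpace ℝ F] {f : E → F} (h : ∀ x, f (-x) = f x) (x : E) :
    fderiv ℝ f (-x) = -fderiv ℝ f x := by
  simpa [h] using (neg_eq_iff_eq_neg.2 (fderiv_comp_const_sub f 0 x)).symm

lemma integral_fderiv_eq_zero {E : Type*} [NormedAddCommGroup E] [NormedSpace ℝ E]
    [FiniteDimensional ℝ E] [MeasurableSpace E] [BorelSpace E] (μ : Measure E)
    [μ.IsAddHaarMeasure] {g : E → ℝ} (hg : ContDiff ℝ 1 g) (hc : HasCompactSupport g) (v : E) :
    ∫ x, fderiv ℝ g x v ∂μ = 0 := by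
  have hg' : Integrable (fun x => fderiv ℝ g x v) μ :=
    (continuous_fderiv_apply hg continuous_const).integrable_of_hasCompactSupport
      (hasCompactSupport_fderiv_apply hc v)
  simpa using integral_mul_fderiv_eq_neg_fderiv_mul_of_integrable (μ := μ)
    (f := g) (g := fun _ => (1 : ℝ)) (v := v) (by simpa using hg') (by simp)
    (by simpa using hg.continuous.integrable_of_hasCompactSupport hc)
    (fun x _ => hg.differentiable one_ne_zero x) (fun x _ => by fun_prop)

lemma integral_divergence_eq_zero {Y : RN N → RN N} (hY : ContDiff ℝ 1 Y)
    (hc : HasCompactSupport Y) : ∫ x, divergence Y x = 0 := by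
  simp_rw [divergence, ← fderiv_coord (hY.differentiable one_ne_zero _)]
  rw [integral_finsetSum _ fun i _ =>
    (continuous_fderiv_apply (contDiff_coord hY i)
      continuous_const).integrable_of_hasCompactSupport
      (hasCompactSupport_fderiv_apply (hasCompactSupport_coord hc i) _)]
  exact Finset.sum_eq_zero fun i _ =>
    integral_fderiv_eq_zero volume (contDiff_coord hY i) (hasCompactSupport_coord hc i) _

lemma divergence_smul {a : RN N → ℝ} {Y : RN N → RN N} {x : RN N}
    (ha : DifferentiableAt ℝ a x) (hY : DifferentiableAt ℝ Y x) :
    divergence (fun y => a y • Y y) x = fderiv ℝ a x (Y x) + a x * divergence Y x := by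
  simp only [divergence]
  rw [fderiv_fun_smul ha hY, clm_apply_eq_sum_stdVec (fderiv ℝ a x) (Y x), Finset.mul_sum,
    ← Finset.sum_add_distrib]
  refine Finset.sum_congr rfl fun i _ => ?_
  simp only [add_apply, smul_apply, ContinuousLinearMap.smulRight_apply, PiLp.add_apply,
    PiLp.smul_apply, smul_eq_mul]
  ring

end Divergence

/-! ### Mollifiers -/

section Mollifier

variable {N : ℕ}

/-- Smooth even mollification kernels supported in the unit ball of `ℝ^N`. -/
structure IsMollifier (η : RN N → ℝ) : Prop where
  contDiff : ContDiff ℝ ∞ η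
  nonneg : ∀ x, 0 ≤ η x
  eq_zero : ∀ x, 1 ≤ ‖x‖ → η x = 0
  even : ∀ x, η (-x) = η x
  integral_eq_one : ∫ x, η x = 1

/-- `ζ` is a nonnegative potential, supported in the unit ball, of the vector field `-η(x) x`.
It exists for radial `η` and turns the scale derivative of a mollification into a Laplacian. -/
structure IsRadialPotential (ζ η : RN N → ℝ) : Prop where
  contDiff : ContDiff ℝ ∞ ζ
  nonneg : ∀ x, 0 ≤ ζ x
  eq_zero : ∀ x, 1 ≤ ‖x‖ → ζ x = 0
  fderiv_eq : ∀ x v, fderiv ℝ ζ x v = -η x * inner ℝ x v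

lemma deriv_expNegInvGlue_of_nonpos {s : ℝ} (hs : s ≤ 0) : deriv expNegInvGlue s = 0 := by
  have h := expNegInvGlue.hasDerivAt_polynomial_eval_inv_mul 1 s
  simp only [Polynomial.eval_one, one_mul, expNegInvGlue.zero_of_nonpos hs, mul_zero] at h
  exact h.deriv

lemma deriv_expNegInvGlue_one_pos : 0 < deriv expNegInvGlue 1 := by
  have h := expNegInvGlue.hasDerivAt_polynomial_eval_inv_mul 1 1
  simp only [Polynomial.eval_one, one_mul] at h
  have h' : deriv expNegInvGlue 1 = _ := h.deriv
  rw [h']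
  simpa using expNegInvGlue.pos_of_pos one_pos

lemma hasCompactSupport_of_norm_ge {E F : Type*} [SeminormedAddCommGroup E] [ProperSpace E]
    [Zero F] {f : E → F} {R : ℝ} (h : ∀ x, R ≤ ‖x‖ → f x = 0) : HasCompactSupport f :=
  HasCompactSupport.intro (isCompact_closedBall (0 : E) R) fun x hx =>
    h x (by simpa using hx : R < ‖x‖).le

lemma exists_mul_isMollifier {η : RN N → ℝ} (hη : ContDiff ℝ ∞ η) (h0 : ∀ x, 0 ≤ η x)
    (hz : ∀ x, 1 ≤ ‖x‖ → η x = 0) (he : ∀ x, η (-x) = η x) (h : η 0 ≠ 0) :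
    ∃ c > 0, IsMollifier fun x => c * η x := by
  have hpos : 0 < ∫ x, η x :=
    hη.continuous.integral_pos_of_hasCompactSupport_nonneg_nonzero
      (hasCompactSupport_of_norm_ge hz) h0 h
  exact ⟨(∫ x, η x)⁻¹, inv_pos.2 hpos, contDiff_const.mul hη,
    fun x => mul_nonneg (inv_pos.2 hpos).le (h0 x), fun x hx => by simp [hz x hx],
    fun x => by simp [he], by rw [integral_const_mul, inv_mul_cancel₀ hpos.ne']⟩

lemma exists_isMollifier_isRadialPotential (N : ℕ) :
    ∃ η ζ : RN N → ℝ, IsMollifier η ∧ IsRadialPotential ζ η := by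
  have hE : ContDiff ℝ ∞ expNegInvGlue := expNegInvGlue.contDiff
  have hsq : ContDiff ℝ ∞ (fun x : RN N => 1 - ‖x‖ ^ 2) :=
    contDiff_const.sub (contDiff_norm_sq ℝ)
  have hball : ∀ x : RN N, 1 ≤ ‖x‖ → 1 - ‖x‖ ^ 2 ≤ 0 := fun x hx =>
    sub_nonpos.2 (one_le_pow₀ hx)
  obtain ⟨c, hc, hη⟩ := exists_mul_isMollifier (N := N)
    (η := fun x => 2 * deriv expNegInvGlue (1 - ‖x‖ ^ 2))
    (contDiff_const.mul ((contDiff_infty_iff_deriv.1 hE).2.comp hsq))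
    (fun x => mul_nonneg zero_le_two expNegInvGlue.monotone.deriv_nonneg)
    (fun x hx => by simp [deriv_expNegInvGlue_of_nonpos (hball x hx)]) (fun x => by simp)
    (by simp [deriv_expNegInvGlue_one_pos.ne'])
  refine ⟨_, fun x => c * expNegInvGlue (1 - ‖x‖ ^ 2), hη, contDiff_const.mul (hE.comp hsq),
    fun x => mul_nonneg hc.le (expNegInvGlue.nonneg _),
    fun x hx => by simp [expNegInvGlue.zero_of_nonpos (hball x hx)], fun x v => ?_⟩
  have hd : HasFDerivAt (fun x : RN N => 1 - ‖x‖ ^ 2) (-(2 • innerSL ℝ x)) x := by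
    simpa using (hasStrictFDerivAt_norm_sq x).hasFDerivAt.const_sub 1
  have hd' :=
    (((hE.differentiable (by simp) _).hasDerivAt.comp_hasFDerivAt x hd).const_mul c).fderiv
  simp only [Function.comp_def] at hd'
  rw [hd']
  simp only [smul_apply, neg_apply, innerSL_apply_apply, nsmul_eq_mul, smul_eq_mul, Nat.cast_ofNat]
  ring

/-- The rescaled kernel `t^{-N} η(x/t)`. -/
noncomputable def rescale (η : RN N → ℝ) (t : ℝ) (x : RN N) : ℝ :=
  (t ^ N)⁻¹ * η (t⁻¹ • x)

lemma contDiff_rescale {n : WithTop ℕ∞} {η : RN N → ℝ} (h : ContDiff ℝ n η) (t : ℝ) :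
    ContDiff ℝ n (rescale η t) :=
  contDiff_const.mul (h.comp (contDiff_const_smul _))

lemma rescale_eq_zero {η : RN N → ℝ} (h : ∀ x, 1 ≤ ‖x‖ → η x = 0) {t : ℝ} (ht : 0 < t)
    {x : RN N} (hx : t ≤ ‖x‖) : rescale η t x = 0 := by
  rw [rescale, h, mul_zero]
  rwa [norm_smul, norm_inv, Real.norm_of_nonneg ht.le, inv_mul_eq_div, one_le_div ht]

lemma rescale_neg {η : RN N → ℝ} (h : ∀ x, η (-x) = η x) (t : ℝ) (x : RN N) :
    rescale η t (-x) = rescale η t x := by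
  rw [rescale, smul_neg, h, rescale]

lemma integral_rescale (η : RN N → ℝ) {t : ℝ} (ht : 0 < t) :
    ∫ x, rescale η t x = ∫ x, η x := by
  simp only [rescale]
  rw [integral_const_mul, Measure.integral_comp_inv_smul, finrank_euclideanSpace_fin, smul_eq_mul,
    abs_of_nonneg (by positivity), ← mul_assoc, inv_mul_cancel₀ (by positivity), one_mul]

lemma fderiv_rescale (η : RN N → ℝ) (t : ℝ) (x : RN N) :
    fderiv ℝ (rescale η t) x = ((t ^ N)⁻¹ * t⁻¹) • fderiv ℝ η (t⁻¹ • x) := by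
  change fderiv ℝ ((t ^ N)⁻¹ • fun y => η (t⁻¹ • y)) x = _
  rw [fderiv_const_smul_field, Pi.smul_apply, fderiv_comp_smul, smul_smul]

namespace IsMollifier

variable {η : RN N → ℝ} (hη : IsMollifier η) {t : ℝ} (ht : 0 < t)

include hη ht

lemma hasCompactSupport_rescale : HasCompactSupport (rescale η t) :=
  hasCompactSupport_of_norm_ge fun _ => rescale_eq_zero hη.eq_zero ht

lemma isTestFunction_rescale : IsTestFunction (rescale η t) :=
  ⟨contDiff_rescale hη.contDiff t, hη.hasCompactSupport_rescale ht⟩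

lemma integrable_rescale : Integrable (rescale η t) :=
  (contDiff_rescale hη.contDiff t).continuous.integrable_of_hasCompactSupport
    (hη.hasCompactSupport_rescale ht)

lemma rescale_nonneg (x : RN N) : 0 ≤ rescale η t x :=
  mul_nonneg (by positivity) (hη.nonneg _)

lemma integral_rescale_eq_one : ∫ x, rescale η t x = 1 := by
  rw [integral_rescale η ht, hη.integral_eq_one]

end IsMollifier

/-- The mollification of `g` by the kernel `η`, that is the convolution `g ⋆ η`. -/
noncomputable def mollify (η g : RN N → ℝ) (x : RN N) : ℝ := ∫ y, g y * η (x - y)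

variable {η g : RN N → ℝ}

open scoped Convolution in
lemma mollify_eq_convolution (η g : RN N → ℝ) :
    mollify η g = g ⋆[ContinuousLinearMap.mul ℝ ℝ, volume] η := rfl

lemma contDiff_mollify {n : ℕ∞} (hη : ContDiff ℝ n η) (hc : HasCompactSupport η)
    (hg : LocallyIntegrable g) : ContDiff ℝ n (mollify η g) := by
  rw [mollify_eq_convolution]
  exact hc.contDiff_convolution_right _ hg hη

lemma fderiv_mollify (hη : ContDiff ℝ 1 η) (hc : HasCompactSupport η) (hg : LocallyIntegrable g)
    (x v : RN N) : fderiv ℝ (mollify η g) x v = mollify (fun z => fderiv ℝ η z v) g x := by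
  rw [mollify_eq_convolution, (hc.hasFDerivAt_convolution_right _ hg hη x).fderiv,
    convolution_precompR_apply _ hg (hc.fderiv ℝ) (hη.continuous_fderiv one_ne_zero)]
  rfl

lemma integrable_mul_comp_sub (hη : Continuous η) (hc : HasCompactSupport η)
    (hg : LocallyIntegrable g) (x : RN N) : Integrable fun y => g y * η (x - y) :=
  hc.convolutionExists_right (ContinuousLinearMap.mul ℝ ℝ) hg hη x

lemma IsMollifier.contDiff_mollify (hη : IsMollifier η) (hg : LocallyIntegrable g) {t : ℝ}
    (ht : 0 < t) : ContDiff ℝ ∞ (mollify (rescale η t) g) :=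
  _root_.contDiff_mollify (contDiff_rescale hη.contDiff t) (hη.hasCompactSupport_rescale ht) hg

end Mollifier

/-! ### Convergence of mollifications in `L²` -/

section Translation

variable {E : Type*} [NormedAddCommGroup E] [NormedSpace ℝ E] [FiniteDimensional ℝ E]
  [MeasurableSpace E] [BorelSpace E] {μ : Measure E} [μ.IsAddHaarMeasure] {g κ : E → ℝ}

lemma integral_sq_eq_norm_toLp_sq {X : Type*} [MeasurableSpace X] {μ : Measure X} {f : X → ℝ}
    (hf : MemLp f 2 μ) : ∫ x, f x ^ 2 ∂μ = ‖hf.toLp f‖ ^ 2 := by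
  rw [← real_inner_self_eq_norm_sq, L2.inner_def]
  refine integral_congr_ae ?_
  filter_upwards [hf.coeFn_toLp] with x hx
  simp [hx, sq]

lemma memLp_comp_add_right {G F : Type*} [AddGroup G] [MeasurableSpace G] [MeasurableAdd G]
    {μ : Measure G} [μ.IsAddRightInvariant] [NormedAddCommGroup F] {p : ENNReal} {g : G → F}
    (hg : MemLp g p μ) (z : G) : MemLp (fun x => g (x + z)) p μ :=
  hg.comp_measurePreserving (measurePreserving_add_right μ z)

lemma tendsto_integral_sq_translate_sub (hg : MemLp g 2 μ) :
    Tendsto (fun z => ∫ x, (g (x + z) - g x) ^ 2 ∂μ) (𝓝 0) (𝓝 0) := by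
  let T : E → C(E, E) := fun z => ⟨fun x => x + z, by fun_prop⟩
  have hT : Continuous T :=
    ContinuousMap.continuous_of_continuous_uncurry _ (continuous_snd.add continuous_fst)
  have hm : ∀ z, MeasurePreserving (T z) μ μ := fun z => measurePreserving_add_right μ z
  have hc : Continuous fun z => Lp.compMeasurePreserving (T z) (hm z) (hg.toLp g) :=
    continuous_const.compMeasurePreservingLp hT hm (by simp)
  have hlim := ((hc.tendsto 0).sub_const
    (Lp.compMeasurePreserving (T 0) (hm 0) (hg.toLp g))).norm.pow 2
  simp only [sub_self, norm_zero, ne_eq, OfNat.ofNat_ne_zero, not_false_eq_true, zero_pow] at hlim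
  refine hlim.congr fun z => ?_
  change _ = ∫ x, ((fun x => g (x + z)) - g) x ^ 2 ∂μ
  rw [integral_sq_eq_norm_toLp_sq ((memLp_comp_add_right hg z).sub hg),
    Lp.toLp_compMeasurePreserving hg (hm z), Lp.toLp_compMeasurePreserving hg (hm 0),
    ← MemLp.toLp_sub]
  congr 3
  ext x
  simp [T]

lemma exists_integral_sq_translate_sub_le (hg : MemLp g 2 μ) {ε : ℝ} (hε : 0 < ε) :
    ∃ δ > 0, ∀ z, ‖z‖ ≤ δ → ∫ x, (g (x + z) - g x) ^ 2 ∂μ ≤ ε := by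
  obtain ⟨δ, hδ, h⟩ := Metric.nhds_basis_closedBall.eventually_iff.1
    ((tendsto_integral_sq_translate_sub hg).eventually (gt_mem_nhds hε))
  exact ⟨δ, hδ, fun z hz => (h (mem_closedBall_zero_iff.2 hz)).le⟩

lemma sq_sub_le_two_mul (a b : ℝ) : (a - b) ^ 2 ≤ 2 * a ^ 2 + 2 * b ^ 2 := by
  linarith [sq_nonneg (a + b), add_sq a b, sub_sq a b]

lemma integrable_mul_kernel_snd {a : E → ℝ} (ha : Integrable a μ) (hκ : Integrable κ μ) :
    Integrable (fun p : E × E => a p.2 * κ (p.1 - p.2)) (μ.prod μ) :=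
  ha.convolution_integrand (ContinuousLinearMap.mul ℝ ℝ) hκ

lemma integrable_mul_kernel_fst {a : E → ℝ} (ha : Integrable a μ) (hκ : Integrable κ μ) :
    Integrable (fun p : E × E => a p.1 * κ (p.1 - p.2)) (μ.prod μ) :=
  (integrable_mul_kernel_snd ha hκ.comp_neg).swap.congr (.of_forall fun p => by simp)

lemma integrable_of_abs_le_sq_kernel (hg : MemLp g 2 μ) (hκ : Integrable κ μ) {F : E × E → ℝ}
    (hF : AEStronglyMeasurable F (μ.prod μ))
    (h : ∀ p, |F p| ≤ (g p.1 ^ 2 + g p.2 ^ 2) * κ (p.1 - p.2)) : Integrable F (μ.prod μ) :=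
  ((integrable_mul_kernel_fst hg.integrable_sq hκ).add
    (integrable_mul_kernel_snd hg.integrable_sq hκ)).mono' hF
    (.of_forall fun p => (h p).trans_eq (add_mul _ _ _))

lemma integrable_sq_sub_mul_kernel (hg : MemLp g 2 μ) (hκ : Integrable κ μ) (h0 : ∀ z, 0 ≤ κ z) :
    Integrable (fun p : E × E => (g p.1 - g p.2) ^ 2 * κ (p.1 - p.2)) (μ.prod μ) := by
  refine integrable_of_abs_le_sq_kernel hg (hκ.const_mul 2) (((hg.aestronglyMeasurable.comp_fst.sub
    hg.aestronglyMeasurable.comp_snd).pow 2).mul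
      (hκ.aestronglyMeasurable.comp_quasiMeasurePreserving
        (quasiMeasurePreserving_sub_of_right_invariant μ μ))) fun p => ?_
  rw [abs_of_nonneg (mul_nonneg (sq_nonneg _) (h0 _)), ← mul_assoc]
  exact mul_le_mul_of_nonneg_right
    ((sq_sub_le_two_mul _ _).trans_eq (by ring)) (h0 _)

lemma integral_prod_kernel_eq {F : E → E → ℝ}
    (hF : Integrable (fun p : E × E => F p.1 p.2 * κ (p.1 - p.2)) (μ.prod μ)) :
    Integrable (fun z => (∫ x, F x (x + z) ∂μ) * κ (-z)) μ ∧
      ∫ p : E × E, F p.1 p.2 * κ (p.1 - p.2) ∂μ.prod μ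
        = ∫ z, (∫ x, F x (x + z) ∂μ) * κ (-z) ∂μ := by
  have hshear : MeasurePreserving (MeasurableEquiv.shearAddRight E) (μ.prod μ) (μ.prod μ) :=
    measurePreserving_prod_add μ μ
  have happ : ∀ p : E × E, MeasurableEquiv.shearAddRight E p = (p.1, p.1 + p.2) := fun _ => rfl
  have hF' : Integrable (fun p : E × E => F p.1 (p.1 + p.2) * κ (-p.2)) (μ.prod μ) := by
    simpa only [Function.comp_def, happ, sub_add_cancel_left] using
      (hshear.integrable_comp_emb (MeasurableEquiv.measurableEmbedding _)).2 hF
  refine ⟨by simpa only [integral_mul_const] using hF'.integral_prod_right, ?_⟩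
  simp_rw [← integral_mul_const]
  rw [← hshear.integral_comp', ← integral_prod_symm (fun p : E × E => _) hF']
  simp only [happ, sub_add_cancel_left]

lemma integral_sq_sub_mul_kernel_le (hg : MemLp g 2 μ) (hκ : Integrable κ μ)
    (h0 : ∀ z, 0 ≤ κ z) {t ε : ℝ} (hs : ∀ z, t < ‖z‖ → κ z = 0)
    (hε : ∀ z, ‖z‖ ≤ t → ∫ x, (g (x + z) - g x) ^ 2 ∂μ ≤ ε) :
    ∫ p : E × E, (g p.1 - g p.2) ^ 2 * κ (p.1 - p.2) ∂μ.prod μ ≤ ε * ∫ z, κ z ∂μ := by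
  obtain ⟨hint, heq⟩ := integral_prod_kernel_eq (F := fun x y => (g x - g y) ^ 2)
    (integrable_sq_sub_mul_kernel hg hκ h0)
  rw [heq, ← integral_neg_eq_self κ, ← integral_const_mul]
  refine integral_mono hint (hκ.comp_neg.const_mul ε) fun z => ?_
  rcases le_or_gt ‖z‖ t with hz | hz
  · refine mul_le_mul_of_nonneg_right (le_of_eq_of_le ?_ (hε z hz)) (h0 _)
    exact integral_congr_ae (.of_forall fun x => sub_sq_comm _ _)
  · simp [hs (-z) (by simpa using hz)]

lemma sq_integral_mul_le {X : Type*} [MeasurableSpace X] {μ : Measure X} {a w : X → ℝ}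
    (hw0 : ∀ x, 0 ≤ w x) (hw : Integrable w μ) (hw1 : ∫ x, w x ∂μ = 1)
    (h1 : Integrable (fun x => a x * w x) μ) (h2 : Integrable (fun x => a x ^ 2 * w x) μ) :
    (∫ x, a x * w x ∂μ) ^ 2 ≤ ∫ x, a x ^ 2 * w x ∂μ := by
  set m := ∫ x, a x * w x ∂μ with hm
  have hvar : 0 ≤ ∫ x, (a x - m) ^ 2 * w x ∂μ :=
    integral_nonneg fun x => mul_nonneg (sq_nonneg _) (hw0 x)
  have hlin : Integrable (fun x => a x ^ 2 * w x - (2 * m) * (a x * w x)) μ :=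
    h2.sub (h1.const_mul _)
  have hexp : ∀ x, (a x - m) ^ 2 * w x
      = a x ^ 2 * w x - (2 * m) * (a x * w x) + m ^ 2 * w x := fun x => by ring
  simp_rw [hexp] at hvar
  rw [integral_add hlin (hw.const_mul _),
    integral_sub h2 (h1.const_mul _), integral_const_mul, integral_const_mul, hw1, ← hm] at hvar
  linarith [sq m]

end Translation

section MollifyLp

variable {N : ℕ} {η g : RN N → ℝ}

lemma locallyIntegrable_of_memLp_two {X F : Type*} [TopologicalSpace X] [MeasurableSpace X]
    {μ : Measure X} [IsLocallyFiniteMeasure μ] [NormedAddCommGroup F] {f : X → F}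
    (hf : MemLp f 2 μ) : LocallyIntegrable f μ :=
  hf.locallyIntegrable one_le_two

namespace IsMollifier

variable (hη : IsMollifier η) {t : ℝ} (ht : 0 < t)

include hη

include ht

lemma integrable_mul_rescale (hg : LocallyIntegrable g) (x : RN N) :
    Integrable fun y => g y * rescale η t (x - y) :=
  integrable_mul_comp_sub (contDiff_rescale hη.contDiff t).continuous
    (hη.hasCompactSupport_rescale ht) hg x

lemma integral_rescale_sub_eq_one (x : RN N) : ∫ y, rescale η t (x - y) = 1 := by
  rw [integral_sub_left_eq_self (fun y => rescale η t y), hη.integral_rescale_eq_one ht]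

lemma integral_sub_mul_rescale (hg : LocallyIntegrable g) (c : ℝ) (x : RN N) :
    Integrable (fun y => (c - g y) * rescale η t (x - y)) ∧
      ∫ y, (c - g y) * rescale η t (x - y) = c - mollify (rescale η t) g x := by
  have hker : Integrable fun y => c * rescale η t (x - y) :=
    ((hη.integrable_rescale ht).comp_sub_left x).const_mul c
  have hgker := hη.integrable_mul_rescale ht hg x
  simp_rw [sub_mul]
  refine ⟨hker.sub hgker, ?_⟩
  rw [integral_sub hker hgker, integral_const_mul, hη.integral_rescale_sub_eq_one ht, mul_one,
    mollify]

lemma sq_mollify_sub_le (hg : MemLp g 2 volume) :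
    ∀ᵐ x, (mollify (rescale η t) g x - g x) ^ 2
      ≤ ∫ y, (g x - g y) ^ 2 * rescale η t (x - y) := by
  filter_upwards [(integrable_sq_sub_mul_kernel hg (hη.integrable_rescale ht)
    (hη.rescale_nonneg ht)).prod_right_ae] with x hx
  obtain ⟨hint, heq⟩ :=
    hη.integral_sub_mul_rescale ht (locallyIntegrable_of_memLp_two hg) (g x) x
  rw [sub_sq_comm, ← heq]
  exact sq_integral_mul_le (fun y => hη.rescale_nonneg ht (x - y))
    ((hη.integrable_rescale ht).comp_sub_left x) (hη.integral_rescale_sub_eq_one ht x) hint hx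

lemma memLp_mollify_sub (hg : MemLp g 2 volume) :
    MemLp (fun x => mollify (rescale η t) g x - g x) 2 volume := by
  have hmeas : AEStronglyMeasurable (fun x => mollify (rescale η t) g x - g x) volume :=
    (hη.contDiff_mollify (locallyIntegrable_of_memLp_two hg) ht).continuous.aestronglyMeasurable.sub
      hg.aestronglyMeasurable
  refine (memLp_two_iff_integrable_sq hmeas).2 ((integrable_sq_sub_mul_kernel hg
    (hη.integrable_rescale ht) (hη.rescale_nonneg ht)).integral_prod_left.mono' (hmeas.pow 2) ?_)
  filter_upwards [hη.sq_mollify_sub_le ht hg] with x hx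
  rwa [Real.norm_of_nonneg (sq_nonneg _)]

lemma memLp_mollify (hg : MemLp g 2 volume) : MemLp (mollify (rescale η t) g) 2 volume := by
  simpa [Pi.add_def] using (hη.memLp_mollify_sub ht hg).add hg

lemma integral_sq_mollify_sub_le (hg : MemLp g 2 volume) {ε : ℝ}
    (hε : ∀ z : RN N, ‖z‖ ≤ t → ∫ x, (g (x + z) - g x) ^ 2 ≤ ε) :
    ∫ x, (mollify (rescale η t) g x - g x) ^ 2 ≤ ε := by
  have hint := integrable_sq_sub_mul_kernel hg (hη.integrable_rescale ht) (hη.rescale_nonneg ht)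
  calc _ ≤ ∫ x, ∫ y, (g x - g y) ^ 2 * rescale η t (x - y) :=
        integral_mono_ae (hη.memLp_mollify_sub ht hg).integrable_sq hint.integral_prod_left
          (hη.sq_mollify_sub_le ht hg)
    _ = ∫ p : RN N × RN N, (g p.1 - g p.2) ^ 2 * rescale η t (p.1 - p.2) := by
        rw [Measure.volume_eq_prod, integral_prod _ hint]
    _ ≤ ε * ∫ z, rescale η t z :=
        integral_sq_sub_mul_kernel_le hg (hη.integrable_rescale ht) (hη.rescale_nonneg ht)
          (fun z hz => rescale_eq_zero hη.eq_zero ht hz.le) hε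
    _ = ε := by rw [hη.integral_rescale_eq_one ht, mul_one]

omit ht in
lemma tendsto_integral_sq_mollify_sub (hg : MemLp g 2 volume) :
    Tendsto (fun t => ∫ x, (mollify (rescale η t) g x - g x) ^ 2) (𝓝[>] 0) (𝓝 0) := by
  refine tendsto_order.2 ⟨fun a ha => .of_forall fun t =>
    ha.trans_le (integral_nonneg fun x => sq_nonneg _), fun ε hε => ?_⟩
  obtain ⟨δ, hδ, h⟩ := exists_integral_sq_translate_sub_le hg (half_pos hε)
  filter_upwards [Ioc_mem_nhdsGT hδ] with t ht
  exact (hη.integral_sq_mollify_sub_le ht.1 hg fun z hz => h z (hz.trans ht.2)).trans_lt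
    (half_lt_self hε)

end IsMollifier

end MollifyLp

/-! ### The commutator of a mollification with a first-order operator -/

section Commutator

variable {N : ℕ} {η g : RN N → ℝ}

lemma integral_mul_mul_eq_of_symmetrization {X : Type*} [MeasurableSpace X] {μ : Measure X}
    [SFinite μ] {g : X → ℝ} {a b : X × X → ℝ} (hab : ∀ p, b p = a p + a p.swap)
    (ha : Integrable (fun p => g p.1 * g p.2 * a p) (μ.prod μ))
    (hb : Integrable (fun p => g p.1 ^ 2 * b p) (μ.prod μ)) :
    ∫ p, g p.1 * g p.2 * a p ∂μ.prod μ
      = 1 / 2 * (∫ p, g p.1 ^ 2 * b p ∂μ.prod μ)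
        - 1 / 4 * ∫ p, (g p.1 - g p.2) ^ 2 * b p ∂μ.prod μ := by
  have hsymm : ∀ p, b p.swap = b p := fun p => by rw [hab, hab, Prod.swap_swap, add_comm]
  have ha' : Integrable (fun p => g p.1 * g p.2 * a p.swap) (μ.prod μ) :=
    ha.swap.congr (.of_forall fun p => by simp [mul_comm])
  have hb' : Integrable (fun p => g p.2 ^ 2 * b p) (μ.prod μ) :=
    hb.swap.congr (.of_forall fun p => by simp [hsymm])
  have hswap_a : ∫ p, g p.1 * g p.2 * a p.swap ∂μ.prod μ = ∫ p, g p.1 * g p.2 * a p ∂μ.prod μ := by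
    rw [← integral_prod_swap]
    simp [mul_comm (g (Prod.fst _))]
  have hswap_b : ∫ p, g p.2 ^ 2 * b p ∂μ.prod μ = ∫ p, g p.1 ^ 2 * b p ∂μ.prod μ := by
    rw [← integral_prod_swap]
    simp [hsymm]
  have hexp : ∀ p : X × X, (g p.1 - g p.2) ^ 2 * b p = (g p.1 ^ 2 * b p + g p.2 ^ 2 * b p)
      - 2 * (g p.1 * g p.2 * a p + g p.1 * g p.2 * a p.swap) := fun p => by rw [hab]; ring
  have hsq : Integrable (fun p => g p.1 ^ 2 * b p + g p.2 ^ 2 * b p) (μ.prod μ) := hb.add hb'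
  have hmul : Integrable (fun p => g p.1 * g p.2 * a p + g p.1 * g p.2 * a p.swap) (μ.prod μ) :=
    ha.add ha'
  simp_rw [hexp]
  rw [integral_sub hsq (hmul.const_mul 2), integral_const_mul, integral_add ha ha',
    integral_add hb hb', hswap_a, hswap_b]
  ring

lemma exists_forall_norm_sub_le {X : RN N → RN N} (hX : ContDiff ℝ 1 X)
    (hc : HasCompactSupport X) : ∃ L : ℝ, 0 ≤ L ∧ ∀ x y, ‖X x - X y‖ ≤ L * ‖x - y‖ := by
  obtain ⟨L, hL⟩ := hX.lipschitzWith_of_hasCompactSupport hc one_ne_zero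
  exact ⟨L, L.2, fun x y => by simpa [dist_eq_norm] using hL.dist_le_mul x y⟩

lemma divergence_const_sub (v : RN N) (X : RN N → RN N) (x : RN N) :
    divergence (fun y => v - X y) x = -divergence X x := by
  simp [divergence, fderiv_const_sub]

lemma integral_fderiv_kernel_sub {κ : RN N → ℝ} {X : RN N → RN N} (hκ : ContDiff ℝ 1 κ)
    (hκc : HasCompactSupport κ) (hX : ContDiff ℝ 1 X) (x : RN N) :
    ∫ y, fderiv ℝ κ (x - y) (X x - X y) = -mollify κ (divergence X) x := by
  have hκx : ContDiff ℝ 1 fun y => κ (x - y) := hκ.comp (contDiff_const.sub contDiff_id)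
  have hXx : ContDiff ℝ 1 fun y => X x - X y := contDiff_const.sub hX
  have hc : HasCompactSupport fun y => κ (x - y) := hκc.comp_homeomorph (Homeomorph.subLeft x)
  have hdiv : ∀ y, divergence (fun y => κ (x - y) • (X x - X y)) y
      = -fderiv ℝ κ (x - y) (X x - X y) - divergence X y * κ (x - y) := fun y => by
    rw [divergence_smul (hκx.differentiable one_ne_zero y) (hXx.differentiable one_ne_zero y),
      fderiv_comp_const_sub, divergence_const_sub, neg_apply]
    ring
  have hdiv_int : Integrable fun y => divergence X y * κ (x - y) :=
    integrable_mul_comp_sub hκ.continuous hκc (continuous_divergence hX).locallyIntegrable x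
  have hsupp : HasCompactSupport fun y => -fderiv ℝ κ (x - y) (X x - X y) :=
    ((hκc.fderiv ℝ).comp_homeomorph (Homeomorph.subLeft x)).mono fun y hy hzero =>
      hy (by simp [show fderiv ℝ κ (x - y) = 0 from hzero])
  have hfderiv_int : Integrable fun y => -fderiv ℝ κ (x - y) (X x - X y) :=
    (((hκ.continuous_fderiv one_ne_zero).comp (continuous_const.sub continuous_id)).clm_apply
      (continuous_const.sub hX.continuous)).neg.integrable_of_hasCompactSupport hsupp
  have hzero : ∫ y, divergence (fun y => κ (x - y) • (X x - X y)) y = 0 :=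
    integral_divergence_eq_zero (hκx.smul hXx) hc.smul_right
  simp_rw [hdiv] at hzero
  rw [integral_sub hfderiv_int hdiv_int, integral_neg, sub_eq_zero] at hzero
  rw [mollify, ← hzero, neg_neg]

lemma integrable_mul_fderiv_kernel (hg : MemLp g 2 volume) {κ : RN N → ℝ} (hκ : ContDiff ℝ 1 κ)
    (hκc : HasCompactSupport κ) {a : RN N × RN N → ℝ} {V : RN N × RN N → RN N}
    (ha : AEStronglyMeasurable a (volume.prod volume)) (hV : Continuous V) {B : ℝ}
    (haB : ∀ p, |a p| ≤ g p.1 ^ 2 + g p.2 ^ 2) (hVB : ∀ p, ‖V p‖ ≤ B) :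
    Integrable (fun p => a p * fderiv ℝ κ (p.1 - p.2) (V p)) (volume.prod volume) := by
  have hκ' : Continuous (fderiv ℝ κ) := hκ.continuous_fderiv one_ne_zero
  refine integrable_of_abs_le_sq_kernel (κ := fun z => B * ‖fderiv ℝ κ z‖) hg
    ((hκ'.integrable_of_hasCompactSupport (hκc.fderiv ℝ)).norm.const_mul B)
    (ha.mul ((hκ'.comp (continuous_fst.sub continuous_snd)).clm_apply hV).aestronglyMeasurable)
    fun p => ?_
  rw [abs_mul]
  refine mul_le_mul (haB p) ?_ (abs_nonneg _) (by positivity)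
  rw [mul_comm B]
  exact (fderiv ℝ κ (p.1 - p.2)).le_opNorm_of_le (hVB p)

lemma integral_mul_fderiv_mollify_eq {κ : RN N → ℝ} (hκ : ContDiff ℝ 1 κ)
    (hκc : HasCompactSupport κ) (heven : ∀ x, κ (-x) = κ x) (hg : MemLp g 2 volume)
    {X : RN N → RN N} (hX : ContDiff ℝ 1 X) (hXc : HasCompactSupport X) :
    ∫ x, g x * fderiv ℝ (mollify κ g) x (X x)
      = -(1 / 2) * (∫ x, g x ^ 2 * mollify κ (divergence X) x)
        - 1 / 4 * ∫ p : RN N × RN N, (g p.1 - g p.2) ^ 2 *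
            fderiv ℝ κ (p.1 - p.2) (X p.1 - X p.2) ∂volume.prod volume := by
  obtain ⟨B, _, hB⟩ := exists_forall_norm_le_of_hasCompactSupport hX.continuous hXc
  have hg₁ : AEStronglyMeasurable (fun p : RN N × RN N => g p.1) (volume.prod volume) :=
    hg.aestronglyMeasurable.comp_fst
  have hg₂ : AEStronglyMeasurable (fun p : RN N × RN N => g p.2) (volume.prod volume) :=
    hg.aestronglyMeasurable.comp_snd
  have hX₁ : Continuous fun p : RN N × RN N => X p.1 := hX.continuous.comp continuous_fst
  have hX₂ : Continuous fun p : RN N × RN N => X p.2 := hX.continuous.comp continuous_snd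
  have hmul : Integrable (fun p : RN N × RN N => g p.1 * g p.2 * fderiv ℝ κ (p.1 - p.2) (X p.1))
      (volume.prod volume) :=
    integrable_mul_fderiv_kernel hg hκ hκc (hg₁.mul hg₂) hX₁ (fun p => by
      rw [abs_le]
      constructor <;> nlinarith [sq_nonneg (g p.1 + g p.2), sq_nonneg (g p.1 - g p.2)])
      fun p => hB p.1
  have hsq : Integrable (fun p : RN N × RN N =>
      g p.1 ^ 2 * fderiv ℝ κ (p.1 - p.2) (X p.1 - X p.2)) (volume.prod volume) :=
    integrable_mul_fderiv_kernel hg hκ hκc (hg₁.pow 2) (hX₁.sub hX₂) (fun p => by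
      rw [abs_of_nonneg (sq_nonneg _)]
      exact le_add_of_nonneg_right (sq_nonneg _))
      fun p => (norm_sub_le _ _).trans (add_le_add (hB p.1) (hB p.2))
  calc _ = ∫ p : RN N × RN N, g p.1 * g p.2 * fderiv ℝ κ (p.1 - p.2) (X p.1)
          ∂volume.prod volume := by
        rw [integral_prod _ hmul]
        refine integral_congr_ae (.of_forall fun x => ?_)
        simp_rw [fderiv_mollify hκ hκc (locallyIntegrable_of_memLp_two hg), mollify, mul_assoc,
          integral_const_mul]
    _ = 1 / 2 * (∫ p : RN N × RN N, g p.1 ^ 2 * fderiv ℝ κ (p.1 - p.2) (X p.1 - X p.2)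
            ∂volume.prod volume)
        - 1 / 4 * ∫ p : RN N × RN N, (g p.1 - g p.2) ^ 2 *
            fderiv ℝ κ (p.1 - p.2) (X p.1 - X p.2) ∂volume.prod volume := by
        refine integral_mul_mul_eq_of_symmetrization (fun p => ?_) hmul hsq
        rw [Prod.fst_swap, Prod.snd_swap, ← neg_sub p.1, fderiv_neg_of_even heven, neg_apply,
          map_sub, sub_eq_add_neg]
    _ = _ := by
        rw [integral_prod _ hsq]
        simp_rw [integral_const_mul, integral_fderiv_kernel_sub hκ hκc hX, mul_neg, integral_neg]
        ring

lemma norm_mul_norm_fderiv_rescale (η : RN N → ℝ) {t : ℝ} (ht : 0 < t) (x : RN N) :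
    ‖x‖ * ‖fderiv ℝ (rescale η t) x‖ = rescale (fun z => ‖z‖ * ‖fderiv ℝ η z‖) t x := by
  rw [fderiv_rescale, norm_smul, rescale, norm_smul, Real.norm_of_nonneg (by positivity),
    Real.norm_of_nonneg (by positivity)]
  ring

lemma fderiv_eq_zero_of_nonneg {E : Type*} [NormedAddCommGroup E] [NormedSpace ℝ E] {f : E → ℝ}
    (h0 : ∀ x, 0 ≤ f x) {x : E} (hx : f x = 0) : fderiv ℝ f x = 0 :=
  IsLocalMin.fderiv_eq_zero (.of_forall fun y => hx.trans_le (h0 y))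

namespace IsMollifier

variable (hη : IsMollifier η)

include hη

open scoped Convolution in
lemma dist_mollify_le {f : RN N → ℝ} (hf : AEStronglyMeasurable f volume) {x : RN N} {c ε t : ℝ}
    (ht : 0 < t) (hε : 0 ≤ ε) (h : ∀ y ∈ Metric.ball x t, dist (f y) c ≤ ε) :
    dist (mollify (rescale η t) f x) c ≤ ε := by
  have heq : mollify (rescale η t) f x
      = (rescale η t ⋆[ContinuousLinearMap.lsmul ℝ ℝ, volume] f) x := by
    rw [convolution_lsmul_swap, mollify]
    simp_rw [smul_eq_mul, mul_comm]
  rw [heq]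
  refine dist_convolution_le hε (fun y hy => ?_) (hη.rescale_nonneg ht)
    (hη.integral_rescale_eq_one ht) hf h
  rw [mem_ball_zero_iff]
  exact lt_of_not_ge fun hy' => hy (rescale_eq_zero hη.eq_zero ht hy')

lemma tendsto_mollify_of_continuous {f : RN N → ℝ} (hf : Continuous f) (x : RN N) :
    Tendsto (fun t => mollify (rescale η t) f x) (𝓝[>] 0) (𝓝 (f x)) := by
  refine (nhdsWithin_hasBasis Metric.nhds_basis_ball _).tendsto_iff Metric.nhds_basis_closedBall
    |>.2 fun ε hε => ?_
  obtain ⟨δ, hδ, h⟩ := Metric.continuous_iff.1 hf x ε hε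
  refine ⟨δ, hδ, fun t ht => hη.dist_mollify_le hf.aestronglyMeasurable ht.2 hε.le fun y hy => ?_⟩
  have htδ : t < δ := (le_abs_self t).trans_lt (by simpa using ht.1)
  exact (h y ((Metric.mem_ball.1 hy).trans htδ)).le

lemma abs_mollify_le {f : RN N → ℝ} (hf : AEStronglyMeasurable f volume) {C : ℝ}
    (hC : ∀ x, |f x| ≤ C) {t : ℝ} (ht : 0 < t) (x : RN N) : |mollify (rescale η t) f x| ≤ C := by
  simpa using hη.dist_mollify_le (c := 0) hf ht ((abs_nonneg _).trans (hC x))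
    fun y _ => by simpa using hC y

lemma tendsto_integral_mul_mollify_of_continuous {a f : RN N → ℝ} (ha : Integrable a)
    (hf : Continuous f) {C : ℝ} (hC : ∀ x, |f x| ≤ C) :
    Tendsto (fun t => ∫ x, a x * mollify (rescale η t) f x) (𝓝[>] 0) (𝓝 (∫ x, a x * f x)) := by
  refine tendsto_integral_filter_of_dominated_convergence (fun x => |a x| * C) ?_ ?_
    (ha.abs.mul_const C) (.of_forall fun x => (hη.tendsto_mollify_of_continuous hf x).const_mul _)
  · filter_upwards [self_mem_nhdsWithin] with t ht
    exact ha.aestronglyMeasurable.mul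
      (hη.contDiff_mollify hf.locallyIntegrable ht).continuous.aestronglyMeasurable
  · filter_upwards [self_mem_nhdsWithin] with t ht
    refine .of_forall fun x => ?_
    rw [norm_mul]
    exact mul_le_mul_of_nonneg_left (hη.abs_mollify_le hf.aestronglyMeasurable hC ht x)
      (abs_nonneg _)

lemma abs_integral_sq_sub_mul_fderiv_rescale_le (hg : MemLp g 2 volume) {X : RN N → RN N} {L : ℝ}
    (hL : ∀ x y, ‖X x - X y‖ ≤ L * ‖x - y‖) (hL0 : 0 ≤ L) {t ε : ℝ} (ht : 0 < t)
    (hε : ∀ z : RN N, ‖z‖ ≤ t → ∫ x, (g (x + z) - g x) ^ 2 ≤ ε) :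
    |∫ p : RN N × RN N, (g p.1 - g p.2) ^ 2 *
        fderiv ℝ (rescale η t) (p.1 - p.2) (X p.1 - X p.2) ∂volume.prod volume|
      ≤ ε * (L * ∫ z, ‖z‖ * ‖fderiv ℝ η z‖) := by
  have hκ : Continuous fun z => ‖z‖ * ‖fderiv ℝ (rescale η t) z‖ :=
    continuous_norm.mul ((contDiff_rescale hη.contDiff t).continuous_fderiv (by simp)).norm
  have hκ_zero : ∀ z, t ≤ ‖z‖ → L * (‖z‖ * ‖fderiv ℝ (rescale η t) z‖) = 0 := fun z hz => by
    simp [fderiv_eq_zero_of_nonneg (hη.rescale_nonneg ht) (rescale_eq_zero hη.eq_zero ht hz)]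
  have hκ_int : Integrable fun z => L * (‖z‖ * ‖fderiv ℝ (rescale η t) z‖) :=
    (hκ.const_mul L).integrable_of_hasCompactSupport (hasCompactSupport_of_norm_ge hκ_zero)
  have hκ_nonneg : ∀ z, 0 ≤ L * (‖z‖ * ‖fderiv ℝ (rescale η t) z‖) := fun z => by positivity
  rw [← Real.norm_eq_abs]
  calc _ ≤ ∫ p : RN N × RN N, (g p.1 - g p.2) ^ 2 *
          (L * (‖p.1 - p.2‖ * ‖fderiv ℝ (rescale η t) (p.1 - p.2)‖)) ∂volume.prod volume := by
        refine norm_integral_le_of_norm_le (integrable_sq_sub_mul_kernel hg hκ_int hκ_nonneg)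
          (.of_forall fun p => ?_)
        rw [norm_mul, Real.norm_of_nonneg (sq_nonneg _), ← mul_assoc L, mul_comm (L * _)]
        exact mul_le_mul_of_nonneg_left ((fderiv ℝ (rescale η t) (p.1 - p.2)).le_opNorm_of_le
          (hL p.1 p.2)) (sq_nonneg _)
    _ ≤ ε * ∫ z, L * (‖z‖ * ‖fderiv ℝ (rescale η t) z‖) :=
        integral_sq_sub_mul_kernel_le hg hκ_int hκ_nonneg (fun z hz => hκ_zero z hz.le) hε
    _ = ε * (L * ∫ z, ‖z‖ * ‖fderiv ℝ η z‖) := by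
        simp_rw [norm_mul_norm_fderiv_rescale η ht, integral_const_mul]
        rw [integral_rescale _ ht]

lemma tendsto_integral_sq_sub_mul_fderiv_rescale (hg : MemLp g 2 volume) {X : RN N → RN N} {L : ℝ}
    (hL : ∀ x y, ‖X x - X y‖ ≤ L * ‖x - y‖) (hL0 : 0 ≤ L) :
    Tendsto (fun t => ∫ p : RN N × RN N, (g p.1 - g p.2) ^ 2 *
        fderiv ℝ (rescale η t) (p.1 - p.2) (X p.1 - X p.2) ∂volume.prod volume)
      (𝓝[>] 0) (𝓝 0) := by
  set M := L * ∫ z, ‖z‖ * ‖fderiv ℝ η z‖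
  have hM : 0 ≤ M := mul_nonneg hL0 (integral_nonneg fun z => by positivity)
  refine (nhdsWithin_hasBasis Metric.nhds_basis_ball _).tendsto_iff Metric.nhds_basis_closedBall
    |>.2 fun ε hε => ?_
  obtain ⟨δ, hδ, h⟩ :=
    exists_integral_sq_translate_sub_le hg (div_pos hε (hM.trans_lt (lt_add_one M)))
  refine ⟨δ, hδ, fun t ht => ?_⟩
  have htδ : t < δ := (le_abs_self t).trans_lt (by simpa using ht.1)
  rw [mem_closedBall_zero_iff]
  refine (hη.abs_integral_sq_sub_mul_fderiv_rescale_le hg hL hL0 ht.2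
    fun z hz => h z (hz.trans htδ.le)).trans ?_
  rw [div_mul_eq_mul_div]
  exact div_le_of_le_mul₀ (by positivity) hε.le (by gcongr; linarith)

lemma tendsto_integral_mul_fderiv_mollify (hg : MemLp g 2 volume) {X : RN N → RN N}
    (hX : ContDiff ℝ 1 X) (hXc : HasCompactSupport X) :
    Tendsto (fun t => ∫ x, g x * fderiv ℝ (mollify (rescale η t) g) x (X x)) (𝓝[>] 0)
      (𝓝 (-(1 / 2) * ∫ x, g x ^ 2 * divergence X x)) := by
  have hdiv := continuous_divergence hX
  obtain ⟨D, _, hD⟩ :=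
    exists_forall_norm_le_of_hasCompactSupport hdiv (hasCompactSupport_divergence hXc)
  obtain ⟨L, hL0, hL⟩ := exists_forall_norm_sub_le hX hXc
  have hlim := ((hη.tendsto_integral_mul_mollify_of_continuous hg.integrable_sq hdiv hD).const_mul
    (-(1 / 2) : ℝ)).sub
      ((hη.tendsto_integral_sq_sub_mul_fderiv_rescale hg hL hL0).const_mul (1 / 4 : ℝ))
  rw [mul_zero, sub_zero] at hlim
  refine hlim.congr' ?_
  filter_upwards [self_mem_nhdsWithin] with t ht
  exact (integral_mul_fderiv_mollify_eq ((contDiff_rescale hη.contDiff t).of_le (by simp))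
    (hη.hasCompactSupport_rescale ht) (rescale_neg hη.even t) hg hX hXc).symm

end IsMollifier

end Commutator

/-! ### Limits of integrals of products -/

section Limits

variable {X : Type*} [MeasurableSpace X] {μ : Measure X} {a b : X → ℝ}

lemma abs_integral_mul_le_of_memLp_two (ha : MemLp a 2 μ) (hb : MemLp b 2 μ) :
    |∫ x, a x * b x ∂μ| ≤ √(∫ x, a x ^ 2 ∂μ) * √(∫ x, b x ^ 2 ∂μ) := by
  have hinner : ∫ x, a x * b x ∂μ = inner ℝ (ha.toLp a) (hb.toLp b) := by
    rw [L2.inner_def]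
    refine integral_congr_ae ?_
    filter_upwards [ha.coeFn_toLp, hb.coeFn_toLp] with x hax hbx
    simp [hax, hbx, mul_comm]
  rw [hinner, integral_sq_eq_norm_toLp_sq ha, integral_sq_eq_norm_toLp_sq hb,
    Real.sqrt_sq (norm_nonneg _), Real.sqrt_sq (norm_nonneg _)]
  exact abs_real_inner_le_norm _ _

lemma tendsto_integral_mul_sub_of_integral_sq {ι : Type*} {l : Filter ι} {g c : ι → X → ℝ} {M : ℝ}
    (hb : MemLp b 2 μ) (hg : ∀ᶠ i in l, MemLp (g i) 2 μ) (hc : ∀ i, MemLp (c i) 2 μ)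
    (hcM : ∀ i, ∫ x, c i x ^ 2 ∂μ ≤ M)
    (hlim : Tendsto (fun i => ∫ x, (g i x - b x) ^ 2 ∂μ) l (𝓝 0)) :
    Tendsto (fun i => ∫ x, c i x * (g i x - b x) ∂μ) l (𝓝 0) := by
  have hbound : Tendsto (fun i => √M * √(∫ x, (g i x - b x) ^ 2 ∂μ)) l (𝓝 0) := by
    simpa using hlim.sqrt.const_mul √M
  refine squeeze_zero_norm' ?_ hbound
  filter_upwards [hg] with i hi
  exact (abs_integral_mul_le_of_memLp_two (hc i) (hi.sub hb)).trans
    (mul_le_mul_of_nonneg_right (Real.sqrt_le_sqrt (hcM i)) (Real.sqrt_nonneg _))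

lemma tendsto_integral_mul_of_integral_sq {ι : Type*} {l : Filter ι} {g : ι → X → ℝ}
    (ha : MemLp a 2 μ) (hb : MemLp b 2 μ) (hg : ∀ᶠ i in l, MemLp (g i) 2 μ)
    (hlim : Tendsto (fun i => ∫ x, (g i x - b x) ^ 2 ∂μ) l (𝓝 0)) :
    Tendsto (fun i => ∫ x, a x * g i x ∂μ) l (𝓝 (∫ x, a x * b x ∂μ)) := by
  refine tendsto_sub_nhds_zero_iff.1 ((tendsto_integral_mul_sub_of_integral_sq hb hg
    (fun _ => ha) (fun _ => le_rfl) hlim).congr' ?_)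
  filter_upwards [hg] with i hi
  simp_rw [mul_sub]
  exact integral_sub (ha.integrable_mul hi) (ha.integrable_mul hb)

lemma tendsto_integral_mul_of_dominated {g c : ℕ → X → ℝ} {A d : X → ℝ}
    (hA : MemLp A 2 μ) (hb : MemLp b 2 μ) (hg : ∀ i, MemLp (g i) 2 μ)
    (hc : ∀ i, AEStronglyMeasurable (c i) μ) (hcA : ∀ i, ∀ᵐ x ∂μ, |c i x| ≤ A x)
    (hcd : ∀ᵐ x ∂μ, Tendsto (fun i => c i x) atTop (𝓝 (d x)))
    (hlim : Tendsto (fun i => ∫ x, (g i x - b x) ^ 2 ∂μ) atTop (𝓝 0)) :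
    Tendsto (fun i => ∫ x, c i x * g i x ∂μ) atTop (𝓝 (∫ x, d x * b x ∂μ)) := by
  have hc_memLp : ∀ i, MemLp (c i) 2 μ := fun i => hA.mono (hc i) <| by
    filter_upwards [hcA i] with x hx using hx.trans (le_abs_self _)
  have hc_lim : Tendsto (fun i => ∫ x, c i x * b x ∂μ) atTop (𝓝 (∫ x, d x * b x ∂μ)) := by
    refine tendsto_integral_of_dominated_convergence (fun x => A x * |b x|)
      (fun i => (hc i).mul hb.aestronglyMeasurable) (hA.integrable_mul hb.abs) (fun i => ?_) ?_
    · filter_upwards [hcA i] with x hx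
      rw [norm_mul]
      exact mul_le_mul_of_nonneg_right hx (abs_nonneg _)
    · filter_upwards [hcd] with x hx using hx.mul_const _
  have herr := tendsto_integral_mul_sub_of_integral_sq (M := ∫ x, A x ^ 2 ∂μ) hb
    (.of_forall hg) hc_memLp (fun i => by
      refine integral_mono_ae (hc_memLp i).integrable_sq hA.integrable_sq ?_
      filter_upwards [hcA i] with x hx using sq_le_sq.2 (hx.trans (le_abs_self _))) hlim
  rw [← add_zero (∫ x, d x * b x ∂μ)]
  refine (hc_lim.add herr).congr fun i => ?_
  refine (integral_add ((hc_memLp i).integrable_mul hb)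
    ((hc_memLp i).integrable_mul ((hg i).sub hb))).symm.trans ?_
  simp [← mul_add]

lemma exists_seq_tendsto_ae_of_integral_sq {g : ℕ → X → ℝ} (hg : ∀ i, MemLp (g i) 2 μ)
    (hb : MemLp b 2 μ) (hlim : Tendsto (fun i => ∫ x, (g i x - b x) ^ 2 ∂μ) atTop (𝓝 0)) :
    ∃ ns : ℕ → ℕ, StrictMono ns ∧
      ∀ᵐ x ∂μ, Tendsto (fun i => g (ns i) x) atTop (𝓝 (b x)) := by
  refine TendstoInMeasure.exists_seq_tendsto_ae (tendstoInMeasure_of_tendsto_eLpNorm (p := 2)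
    (by simp) (fun i => (hg i).aestronglyMeasurable) hb.aestronglyMeasurable ?_)
  have heLp : ∀ i, eLpNorm (g i - b) 2 μ = ENNReal.ofReal √(∫ x, (g i x - b x) ^ 2 ∂μ) := by
    intro i
    have hsq := integral_sq_eq_norm_toLp_sq ((hg i).sub hb)
    simp only [Pi.sub_apply] at hsq
    rw [hsq, Real.sqrt_sq (norm_nonneg _), Lp.norm_toLp,
      ENNReal.ofReal_toReal ((hg i).sub hb).eLpNorm_ne_top]
  simp_rw [heLp]
  simpa using ENNReal.tendsto_ofReal hlim.sqrt

/-- The integral of `f` exists in the extended sense: the positive or the negative part of `f` is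
integrable. -/
def IsQuasiIntegrable (f : X → ℝ) (μ : Measure X) : Prop :=
  Integrable (fun x => max (f x) 0) μ ∨ Integrable (fun x => max (-f x) 0) μ

lemma integrable_of_tendsto_ae_of_nonneg {v : ℕ → X → ℝ} {w : X → ℝ} {L : ℝ}
    (hv : ∀ n, Integrable (v n) μ) (h0 : ∀ n, 0 ≤ᵐ[μ] v n)
    (hlim : ∀ᵐ x ∂μ, Tendsto (fun n => v n x) atTop (𝓝 (w x)))
    (hL : Tendsto (fun n => ∫ x, v n x ∂μ) atTop (𝓝 L)) : Integrable w μ := by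
  have hw0 : 0 ≤ᵐ[μ] w := by
    filter_upwards [hlim, ae_all_iff.2 h0] with x hx hx0 using ge_of_tendsto' hx hx0
  have hw := aestronglyMeasurable_of_tendsto_ae atTop (fun n => (hv n).aestronglyMeasurable) hlim
  refine ⟨hw, (hasFiniteIntegral_iff_ofReal hw0).2 ?_⟩
  calc ∫⁻ x, ENNReal.ofReal (w x) ∂μ
      = ∫⁻ x, liminf (fun n => ENNReal.ofReal (v n x)) atTop ∂μ := by
        refine lintegral_congr_ae ?_
        filter_upwards [hlim] with x hx using (ENNReal.tendsto_ofReal hx).liminf_eq.symm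
    _ ≤ liminf (fun n => ∫⁻ x, ENNReal.ofReal (v n x) ∂μ) atTop :=
        lintegral_liminf_le' fun n => (hv n).aestronglyMeasurable.aemeasurable.ennreal_ofReal
    _ = ENNReal.ofReal L := by
        simp_rw [← fun n => ofReal_integral_eq_lintegral_ofReal (hv n) (h0 n)]
        exact (ENNReal.tendsto_ofReal hL).liminf_eq
    _ < ⊤ := ENNReal.ofReal_lt_top

lemma max_mul_zero_le {a b r : ℝ} (ha : 0 ≤ a) (hab : a ≤ b) : max (a * r) 0 ≤ max (b * r) 0 := by
  have h : ∀ c : ℝ, 0 ≤ c → max (c * r) 0 = c * max r 0 := fun c hc => by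
    rw [mul_max_of_nonneg _ _ hc, mul_zero]
  rw [h a ha, h b (ha.trans hab)]
  exact mul_le_mul_of_nonneg_right hab (le_max_right _ _)

lemma IsQuasiIntegrable.mul_of_le {A v s : X → ℝ} (h : IsQuasiIntegrable (fun x => A x * s x) μ)
    (hv : AEStronglyMeasurable (fun x => v x * s x) μ) (hv0 : ∀ᵐ x ∂μ, 0 ≤ v x)
    (hvA : ∀ᵐ x ∂μ, v x ≤ A x) : IsQuasiIntegrable (fun x => v x * s x) μ := by
  refine h.imp (fun hA => hA.mono' (hv.sup aestronglyMeasurable_const) ?_)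
    fun hA => hA.mono' (hv.neg.sup aestronglyMeasurable_const) ?_
  all_goals
    filter_upwards [hv0, hvA] with x h0 hle
    rw [Real.norm_of_nonneg (le_max_right _ _)]
  · exact max_mul_zero_le h0 hle
  · simpa only [mul_neg] using max_mul_zero_le (r := -s x) h0 hle

lemma integrable_mul_of_nonneg_of_le {A v s : X → ℝ} (h : Integrable (fun x => A x * s x) μ)
    (hv : AEStronglyMeasurable (fun x => v x * s x) μ) (hv0 : ∀ᵐ x ∂μ, 0 ≤ v x)
    (hvA : ∀ᵐ x ∂μ, v x ≤ A x) : Integrable (fun x => v x * s x) μ := by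
  refine h.mono hv ?_
  filter_upwards [hv0, hvA] with x h0 hle
  rw [norm_mul, norm_mul, Real.norm_of_nonneg h0, Real.norm_of_nonneg (h0.trans hle)]
  exact mul_le_mul_of_nonneg_right hle (norm_nonneg _)

lemma tendsto_integral_mul_of_nonneg_of_le {A s : X → ℝ} {v : ℕ → X → ℝ}
    (h : Integrable (fun x => A x * s x) μ)
    (hv : ∀ n, AEStronglyMeasurable (fun x => v n x * s x) μ) (hv0 : ∀ n, ∀ᵐ x ∂μ, 0 ≤ v n x)
    (hvA : ∀ n, ∀ᵐ x ∂μ, v n x ≤ A x)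
    (hlim : ∀ᵐ x ∂μ, Tendsto (fun n => v n x) atTop (𝓝 (A x))) :
    Tendsto (fun n => ∫ x, v n x * s x ∂μ) atTop (𝓝 (∫ x, A x * s x ∂μ)) := by
  refine tendsto_integral_of_dominated_convergence _ hv h.norm (fun n => ?_)
    (hlim.mono fun x hx => hx.mul_const _)
  filter_upwards [hv0 n, hvA n] with x h0 hle
  rw [norm_mul, norm_mul, Real.norm_of_nonneg h0, Real.norm_of_nonneg (h0.trans hle)]
  exact mul_le_mul_of_nonneg_right hle (norm_nonneg _)

lemma integrable_mul_of_tendsto_of_neg_part {s w A : X → ℝ} {v : ℕ → X → ℝ} {L : ℝ}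
    (hv0 : ∀ n, ∀ᵐ x ∂μ, 0 ≤ v n x) (hvw : ∀ n, ∀ᵐ x ∂μ, v n x ≤ w x) (hwA : ∀ᵐ x ∂μ, w x ≤ A x)
    (hv : ∀ n, Integrable (fun x => v n x * s x) μ)
    (hlim : ∀ᵐ x ∂μ, Tendsto (fun n => v n x) atTop (𝓝 (w x)))
    (hL : Tendsto (fun n => ∫ x, v n x * s x ∂μ) atTop (𝓝 L))
    (hneg : Integrable (fun x => max (-(A x * s x)) 0) μ) :
    Integrable (fun x => w x * s x) μ ∧ ∫ x, w x * s x ∂μ = L := by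
  have hlim' : ∀ᵐ x ∂μ, Tendsto (fun n => v n x * s x) atTop (𝓝 (w x * s x)) := by
    filter_upwards [hlim] with x hx using hx.mul_const _
  have hlim_neg : ∀ᵐ x ∂μ, Tendsto (fun n => max (-(v n x * s x)) 0) atTop
      (𝓝 (max (-(w x * s x)) 0)) := by
    filter_upwards [hlim'] with x hx using hx.neg.max tendsto_const_nhds
  have hv_neg : ∀ n, Integrable (fun x => max (-(v n x * s x)) 0) μ := fun n => (hv n).neg.pos_part
  have hbound : ∀ n, ∀ᵐ x ∂μ, ‖max (-(v n x * s x)) 0‖ ≤ max (-(A x * s x)) 0 := fun n => by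
    filter_upwards [hv0 n, hvw n, hwA] with x h0 hvw hwA
    rw [Real.norm_of_nonneg (le_max_right _ _), ← mul_neg, ← mul_neg]
    exact max_mul_zero_le h0 (hvw.trans hwA)
  have hw_neg : Integrable (fun x => max (-(w x * s x)) 0) μ :=
    hneg.mono' (aestronglyMeasurable_of_tendsto_ae atTop
      (fun n => (hv_neg n).aestronglyMeasurable) hlim_neg) (by
        filter_upwards [hlim_neg, ae_all_iff.2 hbound] with x hx hb
          using le_of_tendsto' hx.norm hb)
  have htend_neg := tendsto_integral_of_dominated_convergence _
    (fun n => (hv_neg n).aestronglyMeasurable) hneg hbound hlim_neg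
  have hw_pos : Integrable (fun x => max (w x * s x) 0) μ := by
    refine integrable_of_tendsto_ae_of_nonneg (fun n => (hv n).pos_part)
      (fun n => .of_forall fun x => le_max_right _ _)
      (by filter_upwards [hlim'] with x hx using hx.max tendsto_const_nhds)
      ((hL.add htend_neg).congr fun n => ?_)
    rw [← integral_add (hv n) (hv_neg n)]
    simp_rw [← sub_eq_iff_eq_add.1 (max_zero_sub_max_neg_zero_eq_self (_ : ℝ))]
  have hw : Integrable (fun x => w x * s x) μ :=
    (hw_pos.sub hw_neg).congr (.of_forall fun x => max_zero_sub_max_neg_zero_eq_self _)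
  refine ⟨hw, tendsto_nhds_unique (tendsto_integral_of_dominated_convergence _
    (fun n => (hv n).aestronglyMeasurable) hw.norm (fun n => ?_) hlim') hL⟩
  filter_upwards [hv0 n, hvw n] with x h0 hvw
  rw [norm_mul, norm_mul, Real.norm_of_nonneg h0, Real.norm_of_nonneg (h0.trans hvw)]
  exact mul_le_mul_of_nonneg_right hvw (norm_nonneg _)

lemma integrable_mul_of_tendsto_of_isQuasiIntegrable {s w A : X → ℝ} {v : ℕ → X → ℝ} {L : ℝ}
    (hv0 : ∀ n, ∀ᵐ x ∂μ, 0 ≤ v n x) (hvw : ∀ n, ∀ᵐ x ∂μ, v n x ≤ w x) (hwA : ∀ᵐ x ∂μ, w x ≤ A x)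
    (hv : ∀ n, Integrable (fun x => v n x * s x) μ)
    (hlim : ∀ᵐ x ∂μ, Tendsto (fun n => v n x) atTop (𝓝 (w x)))
    (hL : Tendsto (fun n => ∫ x, v n x * s x ∂μ) atTop (𝓝 L))
    (hquasi : IsQuasiIntegrable (fun x => A x * s x) μ) :
    Integrable (fun x => w x * s x) μ ∧ ∫ x, w x * s x ∂μ = L := by
  rcases hquasi with hpos | hneg
  · have hreflect := integrable_mul_of_tendsto_of_neg_part (s := fun x => -s x) (L := -L)
      hv0 hvw hwA (fun n => by simpa using (hv n).neg) hlim
      (by simpa [integral_neg] using hL.neg) (by simpa using hpos)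
    simpa [integral_neg] using hreflect
  · exact integrable_mul_of_tendsto_of_neg_part hv0 hvw hwA hv hlim hL hneg

end Limits

/-! ### Weak gradients and the stress form -/

section WeakGradient

variable {N : ℕ} {η u : RN N → ℝ} {D X : RN N → RN N}

lemma gradient_apply (ψ : RN N → ℝ) (x : RN N) (i : Fin N) :
    gradient ψ x i = fderiv ℝ ψ x (stdVec i) := by
  rw [← inner_gradient_left, EuclideanSpace.inner_single_right]
  simp

lemma inner_gradient_right_real (ψ : RN N → ℝ) (x v : RN N) :
    inner ℝ v (gradient ψ x) = fderiv ℝ ψ x v := by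
  rw [real_inner_comm, inner_gradient_left]

lemma continuous_gradient {ψ : RN N → ℝ} (h : ContDiff ℝ 1 ψ) : Continuous (gradient ψ) :=
  (InnerProductSpace.toDual ℝ (RN N)).symm.continuous.comp (h.continuous_fderiv one_ne_zero)

lemma hasCompactSupport_gradient {ψ : RN N → ℝ} (h : HasCompactSupport ψ) :
    HasCompactSupport (gradient ψ) :=
  (h.fderiv ℝ).comp_left (g := (InnerProductSpace.toDual ℝ (RN N)).symm) (by simp)

lemma norm_sq_eq_sum_coord (v : RN N) : ‖v‖ ^ 2 = ∑ i, v i ^ 2 := by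
  simp [EuclideanSpace.norm_sq_eq]

lemma locallyIntegrable_coord {F : RN N → RN N} (hF : LocallyIntegrable F) (i : Fin N) :
    LocallyIntegrable fun x => F x i := fun x => by
  obtain ⟨S, hS, h⟩ := hF x
  exact ⟨S, hS, h.eval_piLp i⟩

namespace IsTestFunction

lemma contDiff_one {ψ : RN N → ℝ} (h : IsTestFunction ψ) : ContDiff ℝ 1 ψ :=
  h.1.of_le (by simp)

lemma comp_const_sub {κ : RN N → ℝ} (hκ : IsTestFunction κ) (x : RN N) :
    IsTestFunction fun y => κ (x - y) :=
  ⟨hκ.1.comp (contDiff_const.sub contDiff_id), hκ.2.comp_homeomorph (Homeomorph.subLeft x)⟩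

lemma coord {V : RN N → RN N} (hV : ContDiff ℝ ∞ V) (hc : HasCompactSupport V) (i : Fin N) :
    IsTestFunction fun x => V x i :=
  ⟨contDiff_coord hV i, hasCompactSupport_coord hc i⟩

lemma fderiv_apply {w : RN N → ℝ} (hw : ContDiff ℝ ∞ w) (hX : ContDiff ℝ ∞ X)
    (hc : HasCompactSupport X) : IsTestFunction fun x => fderiv ℝ w x (X x) := by
  refine ⟨(hw.fderiv_right (m := ∞) (by simp)).clm_apply hX, hc.mono fun x hx hX0 => hx ?_⟩
  simp [hX0]

end IsTestFunction

namespace IsWeakGradient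

variable (h : IsWeakGradient u D)

include h

lemma integral_mul_fderiv {ψ : RN N → ℝ} (hψ : IsTestFunction ψ) (i : Fin N) :
    ∫ x, u x * fderiv ℝ ψ x (stdVec i) = - ∫ x, ψ x * D x i := by
  have hu : Integrable fun x => u x • gradient ψ x :=
    h.locallyIntegrable_fun.integrable_smul_right_of_hasCompactSupport
      (continuous_gradient hψ.contDiff_one) (hasCompactSupport_gradient hψ.2)
  have hD : Integrable fun x => ψ x • D x :=
    h.locallyIntegrable_grad.integrable_smul_left_of_hasCompactSupport hψ.1.continuous hψ.2
  have hcoord := congrArg (fun v : RN N => v i) (h.integral_eq ψ hψ)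
  simp only [PiLp.neg_apply] at hcoord
  rw [eval_integral_piLp hu.eval_piLp, eval_integral_piLp hD.eval_piLp] at hcoord
  simpa [gradient_apply] using hcoord

lemma integral_mul_divergence {V : RN N → RN N} (hV : ContDiff ℝ ∞ V)
    (hc : HasCompactSupport V) :
    ∫ x, u x * divergence V x = - ∫ x, inner ℝ (D x) (V x) := by
  have hVi := IsTestFunction.coord hV hc
  have hcoord : ∀ i x, fderiv ℝ V x (stdVec i) i = fderiv ℝ (fun y => V y i) x (stdVec i) :=
    fun i x => (fderiv_coord (hV.differentiable (by simp) x) i _).symm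
  simp_rw [divergence, inner_eq_sum_coord, Finset.mul_sum, hcoord]
  rw [integral_finsetSum, integral_finsetSum, ← Finset.sum_neg_distrib]
  · refine Finset.sum_congr rfl fun i _ => ?_
    rw [h.integral_mul_fderiv (hVi i)]
    simp_rw [mul_comm (V _ _)]
  · exact fun i _ => (locallyIntegrable_coord h.locallyIntegrable_grad i)
      |>.integrable_smul_right_of_hasCompactSupport (hVi i).1.continuous (hVi i).2
  · exact fun i _ => h.locallyIntegrable_fun.integrable_smul_right_of_hasCompactSupport
      (continuous_fderiv_apply (hVi i).contDiff_one continuous_const)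
      (hasCompactSupport_fderiv_apply (hVi i).2 _)

variable {κ : RN N → ℝ} (hκ : IsTestFunction κ)

include hκ

lemma fderiv_mollify_stdVec (x : RN N) (i : Fin N) :
    fderiv ℝ (mollify κ u) x (stdVec i) = mollify κ (fun y => D y i) x := by
  have hweak := h.integral_mul_fderiv (hκ.comp_const_sub x) i
  simp_rw [fderiv_comp_const_sub, neg_apply, mul_neg, integral_neg, neg_inj] at hweak
  rw [fderiv_mollify hκ.contDiff_one hκ.2 h.locallyIntegrable_fun, mollify, hweak]
  simp_rw [mollify, mul_comm]

lemma fderiv_mollify_apply (x v : RN N) :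
    fderiv ℝ (mollify κ u) x v = ∑ i, v i * mollify κ (fun y => D y i) x := by
  rw [clm_apply_eq_sum_stdVec]
  simp [h.fderiv_mollify_stdVec hκ]

lemma fderiv_mollify_coord (x v : RN N) (i : Fin N) :
    fderiv ℝ (mollify κ fun y => D y i) x v
      = fderiv ℝ (fderiv ℝ (mollify κ u)) x v (stdVec i) := by
  have hu := contDiff_mollify hκ.1 hκ.2 h.locallyIntegrable_fun
  have heq : (mollify κ fun y => D y i) = fun z => fderiv ℝ (mollify κ u) z (stdVec i) :=
    funext fun z => (h.fderiv_mollify_stdVec hκ z i).symm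
  rw [heq, fderiv_clm_apply ((hu.fderiv_right (m := ∞) (by simp)).differentiable (by simp) x)
    (differentiableAt_const _)]
  simp

lemma fderiv_fderiv_mollify (hX : ContDiff ℝ ∞ X) (x v : RN N) :
    fderiv ℝ (fun y => fderiv ℝ (mollify κ u) y (X y)) x v
      = ∑ i, v i * fderiv ℝ (mollify κ fun y => D y i) x (X x)
        + ∑ i, fderiv ℝ X x v i * mollify κ (fun y => D y i) x := by
  have hu := contDiff_mollify hκ.1 hκ.2 h.locallyIntegrable_fun
  have hsymm : fderiv ℝ (fderiv ℝ (mollify κ u)) x v (X x)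
      = fderiv ℝ (fderiv ℝ (mollify κ u)) x (X x) v :=
    hu.contDiffAt.isSymmSndFDerivAt
      (minSmoothness_of_isRCLikeNormedField.trans_le
        (WithTop.coe_le_coe.2 (le_top : (2 : ℕ∞) ≤ ⊤))) v (X x)
  rw [fderiv_clm_apply ((hu.fderiv_right (m := ∞) (by simp)).differentiable (by simp) x)
    (hX.differentiable (by simp) x)]
  simp only [add_apply, ContinuousLinearMap.comp_apply, ContinuousLinearMap.flip_apply]
  rw [hsymm, clm_apply_eq_sum_stdVec (fderiv ℝ (fderiv ℝ (mollify κ u)) x (X x)) v,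
    h.fderiv_mollify_apply hκ, add_comm]
  simp_rw [h.fderiv_mollify_coord hκ, smul_eq_mul]

end IsWeakGradient

/-- The integral `∫ ⟨D, DX D⟩ - ½ div X |D|²` of the stress tensor `D ⊗ D - ½ |D|² Id` of the
Dirichlet energy against the derivative of the vector field `X`. -/
noncomputable def stressForm (X D : RN N → RN N) : ℝ :=
  ∫ x, (inner ℝ (D x) (fderiv ℝ X x (D x)) - 1 / 2 * (divergence X x * ‖D x‖ ^ 2))

section StressForm

variable (hX : ContDiff ℝ ∞ X) (hXc : HasCompactSupport X) (hD : MemLp D 2 volume)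

include hX hXc

lemma integrable_mul_divergence_of_hasCompactSupport {w : RN N → ℝ} (hw : Integrable w) :
    Integrable fun x => w x * divergence X x := by
  have hdiv := continuous_divergence (hX.of_le (by simp : 1 ≤ (∞ : WithTop ℕ∞)))
  obtain ⟨B, _, hB⟩ :=
    exists_forall_norm_le_of_hasCompactSupport hdiv (hasCompactSupport_divergence hXc)
  exact hw.mul_bdd hdiv.aestronglyMeasurable (.of_forall hB)

include hD

lemma memLp_fderiv_apply_of_hasCompactSupport : MemLp (fun x => fderiv ℝ X x (D x)) 2 volume := by
  have hcont : Continuous (fderiv ℝ X) := hX.continuous_fderiv (by simp)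
  obtain ⟨B, _, hB⟩ := exists_forall_norm_le_of_hasCompactSupport hcont (hXc.fderiv ℝ)
  exact hD.of_le_mul (c := B)
    ((isBoundedBilinearMap_apply (𝕜 := ℝ)).continuous.comp_aestronglyMeasurable
      (hcont.aestronglyMeasurable.prodMk hD.aestronglyMeasurable))
    (.of_forall fun x => (fderiv ℝ X x).le_of_opNorm_le (hB x) _)

lemma integrable_fderiv_apply_mul_coord (i : Fin N) :
    Integrable fun x => fderiv ℝ X x (D x) i * D x i :=
  ((memLp_fderiv_apply_of_hasCompactSupport hX hXc hD).eval_piLp i).integrable_mul (hD.eval_piLp i)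

lemma stressForm_eq_sub :
    stressForm X D = (∫ x, inner ℝ (D x) (fderiv ℝ X x (D x)))
      - 1 / 2 * ∫ x, ‖D x‖ ^ 2 * divergence X x := by
  have hinner : Integrable fun x => inner ℝ (D x) (fderiv ℝ X x (D x)) := by
    simp_rw [inner_eq_sum_coord, mul_comm (D _ _)]
    exact integrable_finsetSum _ fun i _ => integrable_fderiv_apply_mul_coord hX hXc hD i
  have hdiv := integrable_mul_divergence_of_hasCompactSupport hX hXc
    (hD.integrable_norm_pow two_ne_zero)
  simp_rw [stressForm, mul_comm (divergence X _)]
  rw [integral_sub hinner (hdiv.const_mul _), integral_const_mul]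

lemma stressForm_eq_sum :
    stressForm X D = ∑ i, (-(1 / 2) * ∫ x, D x i ^ 2 * divergence X x)
      + ∑ i, ∫ x, fderiv ℝ X x (D x) i * D x i := by
  rw [stressForm_eq_sub hX hXc hD]
  simp_rw [inner_eq_sum_coord, mul_comm (D _ _), norm_sq_eq_sum_coord, Finset.sum_mul]
  rw [integral_finsetSum _ fun i _ => integrable_fderiv_apply_mul_coord hX hXc hD i,
    integral_finsetSum _ fun i _ => integrable_mul_divergence_of_hasCompactSupport hX hXc
      (hD.eval_piLp i).integrable_sq, ← Finset.mul_sum]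
  ring

variable (h : IsWeakGradient u D) (hη : IsMollifier η)

include h hη

lemma integral_inner_gradient_mollify {t : ℝ} (ht : 0 < t) :
    ∫ x, inner ℝ (D x) (gradient (fun y => fderiv ℝ (mollify (rescale η t) u) y (X y)) x)
      = (∑ i, ∫ x, D x i * fderiv ℝ (mollify (rescale η t) fun y => D y i) x (X x))
        + ∑ i, ∫ x, fderiv ℝ X x (D x) i * mollify (rescale η t) (fun y => D y i) x := by
  have hDi := fun i => locallyIntegrable_of_memLp_two (hD.eval_piLp i)
  have htest := fun i => IsTestFunction.fderiv_apply (hη.contDiff_mollify (hDi i) ht) hX hXc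
  have hfst : ∀ i, Integrable fun x =>
      D x i * fderiv ℝ (mollify (rescale η t) fun y => D y i) x (X x) := fun i =>
    (hDi i).integrable_smul_right_of_hasCompactSupport (htest i).1.continuous (htest i).2
  have hsnd : ∀ i, Integrable fun x =>
      fderiv ℝ X x (D x) i * mollify (rescale η t) (fun y => D y i) x := fun i =>
    ((memLp_fderiv_apply_of_hasCompactSupport hX hXc hD).eval_piLp i).integrable_mul
      (hη.memLp_mollify ht (hD.eval_piLp i))
  simp_rw [inner_gradient_right_real,
    h.fderiv_fderiv_mollify (hη.isTestFunction_rescale ht) hX]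
  rw [integral_add (integrable_finsetSum _ fun i _ => hfst i)
    (integrable_finsetSum _ fun i _ => hsnd i), integral_finsetSum _ fun i _ => hfst i,
    integral_finsetSum _ fun i _ => hsnd i]

lemma tendsto_integral_inner_gradient_mollify :
    Tendsto (fun t => ∫ x, inner ℝ (D x)
        (gradient (fun y => fderiv ℝ (mollify (rescale η t) u) y (X y)) x)) (𝓝[>] 0)
      (𝓝 (stressForm X D)) := by
  have hDi := fun i => hD.eval_piLp i
  have hDX := (memLp_fderiv_apply_of_hasCompactSupport hX hXc hD).eval_piLp
  rw [stressForm_eq_sum hX hXc hD]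
  refine ((tendsto_finsetSum _ fun i _ =>
    hη.tendsto_integral_mul_fderiv_mollify (hDi i) (hX.of_le (by simp)) hXc).add
    (tendsto_finsetSum _ fun i _ => tendsto_integral_mul_of_integral_sq (hDX i) (hDi i) ?_
      (hη.tendsto_integral_sq_mollify_sub (hDi i)))).congr' ?_
  · filter_upwards [self_mem_nhdsWithin] with t ht using hη.memLp_mollify ht (hDi i)
  · filter_upwards [self_mem_nhdsWithin] with t ht
      using (integral_inner_gradient_mollify hX hXc hD h hη ht).symm

end StressForm

end WeakGradient

/-! ### Cutoffs and the chain rule -/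

/-- A smooth compactly supported cutoff with values in `[0, 1]`, equal to one on the unit ball. -/
structure IsCutoff {N : ℕ} (θ : RN N → ℝ) : Prop where
  contDiff : ContDiff ℝ ∞ θ
  hasCompactSupport : HasCompactSupport θ
  nonneg : ∀ x, 0 ≤ θ x
  le_one : ∀ x, θ x ≤ 1
  eq_one : ∀ x, ‖x‖ ≤ 1 → θ x = 1

lemma exists_isCutoff (N : ℕ) : ∃ θ : RN N → ℝ, IsCutoff θ := by
  let b : ContDiffBump (0 : RN N) := ⟨1, 2, one_pos, one_lt_two⟩
  exact ⟨b, b.contDiff, b.hasCompactSupport, fun _ => b.nonneg, fun _ => b.le_one,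
    fun x hx => b.one_of_mem_closedBall (by simpa [b] using hx)⟩

lemma hasCompactSupport_comp_smul {E F : Type*} [AddCommGroup E] [Module ℝ E] [TopologicalSpace E]
    [ContinuousConstSMul ℝ E] [Zero F] {f : E → F} (hf : HasCompactSupport f) {l : ℝ}
    (hl : l ≠ 0) : HasCompactSupport fun x => f (l • x) :=
  hf.comp_homeomorph (Homeomorph.smulOfNeZero l hl)

namespace IsCutoff

variable {N : ℕ} {θ : RN N → ℝ} (hθ : IsCutoff θ)

include hθ

lemma tendsto_comp_smul {ι : Type*} {L : Filter ι} {l : ι → ℝ} (hl : Tendsto l L (𝓝 0))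
    (x : RN N) : Tendsto (fun i => θ (l i • x)) L (𝓝 1) := by
  have hsmul : Tendsto (fun i => l i • x) L (𝓝 0) := by simpa using hl.smul_const x
  simpa [hθ.eq_one 0 (by simp), Function.comp_def]
    using (hθ.contDiff.continuous.tendsto 0).comp hsmul

lemma isTestFunction_comp_smul_mul {l : ℝ} (hl : l ≠ 0) {f : RN N → ℝ} (hf : ContDiff ℝ ∞ f) :
    IsTestFunction fun x => θ (l • x) * f x :=
  ⟨(hθ.contDiff.comp (contDiff_const_smul l)).mul hf,
    (hasCompactSupport_comp_smul hθ.hasCompactSupport hl).mul_right⟩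

lemma exists_abs_fderiv_comp_smul_le :
    ∃ C, 0 ≤ C ∧ ∀ l, 0 ≤ l → ∀ x v, |fderiv ℝ (fun y => θ (l • y)) x v| ≤ l * (C * ‖v‖) := by
  obtain ⟨C, hC0, hC⟩ := exists_forall_norm_le_of_hasCompactSupport
    (hθ.contDiff.continuous_fderiv (by simp)) (hθ.hasCompactSupport.fderiv ℝ)
  refine ⟨C, hC0, fun l hl x v => ?_⟩
  rw [fderiv_comp_smul, smul_apply, smul_eq_mul, abs_mul, abs_of_nonneg hl]
  exact mul_le_mul_of_nonneg_left ((fderiv ℝ θ (l • x)).le_of_opNorm_le (hC _) v) hl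

end IsCutoff

section ChainRule

variable {N : ℕ} {η u : RN N → ℝ} {D : RN N → RN N}

lemma integral_deriv_comp_mul_fderiv {w : RN N → ℝ} (hw : ContDiff ℝ 1 w) {G : ℝ → ℝ}
    (hG : ContDiff ℝ 1 G) {Y : RN N → RN N} (hY : ContDiff ℝ 1 Y) (hc : HasCompactSupport Y) :
    ∫ x, deriv G (w x) * fderiv ℝ w x (Y x) = -∫ x, G (w x) * divergence Y x := by
  have hGw : ContDiff ℝ 1 fun x => G (w x) := hG.comp hw
  have hdiv : ∀ x, divergence (fun y => G (w y) • Y y) x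
      = deriv G (w x) * fderiv ℝ w x (Y x) + G (w x) * divergence Y x := fun x => by
    have hchain : HasFDerivAt (fun y => G (w y)) (deriv G (w x) • fderiv ℝ w x) x :=
      (hG.differentiable one_ne_zero (w x)).hasDerivAt.comp_hasFDerivAt x
        (hw.differentiable one_ne_zero x).hasFDerivAt
    rw [divergence_smul hchain.differentiableAt (hY.differentiable one_ne_zero x), hchain.fderiv,
      smul_apply, smul_eq_mul]
  have hzero : ∫ x, divergence (fun y => G (w y) • Y y) x = 0 :=
    integral_divergence_eq_zero (hGw.smul hY) (hc.mono fun x hx hx0 => hx (by simp [hx0]))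
  simp_rw [hdiv] at hzero
  rw [integral_add] at hzero
  · exact eq_neg_of_add_eq_zero_left hzero
  · refine (((hG.continuous_deriv le_rfl).comp hw.continuous).mul
      (continuous_fderiv_apply hw hY.continuous)).integrable_of_hasCompactSupport ?_
    exact HasCompactSupport.mul_left (hc.mono fun x hx hx0 => hx (by simp [hx0]))
  · exact (hGw.continuous.mul (continuous_divergence hY)).integrable_of_hasCompactSupport
      (hasCompactSupport_divergence hc).mul_left

lemma tendsto_one_div_add_atTop_nhdsGT_zero :
    Tendsto (fun n : ℕ => 1 / ((n : ℝ) + 1)) atTop (𝓝[>] 0) :=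
  tendsto_nhdsWithin_iff.2 ⟨tendsto_one_div_add_atTop_nhds_zero_nat,
    .of_forall fun n => mem_Ioi.2 (by positivity)⟩

lemma IsMollifier.exists_seq_tendsto_ae (hη : IsMollifier η) (hu : MemLp u 2 volume) :
    ∃ t : ℕ → ℝ, (∀ n, 0 < t n) ∧ Tendsto t atTop (𝓝[>] 0) ∧
      ∀ᵐ x, Tendsto (fun n => mollify (rescale η (t n)) u x) atTop (𝓝 (u x)) := by
  obtain ⟨ns, hns, hae⟩ := exists_seq_tendsto_ae_of_integral_sq
    (fun n : ℕ => hη.memLp_mollify (t := 1 / ((n : ℝ) + 1)) (by positivity) hu) hu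
    ((hη.tendsto_integral_sq_mollify_sub hu).comp tendsto_one_div_add_atTop_nhdsGT_zero)
  exact ⟨fun n => 1 / ((ns n : ℝ) + 1), fun n => by positivity,
    tendsto_one_div_add_atTop_nhdsGT_zero.comp hns.tendsto_atTop, hae⟩

namespace IsWeakGradient

variable (h : IsWeakGradient u D) (hD : MemLp D 2 volume)

include h hD

lemma integral_fderiv_mollify_apply (hη : IsMollifier η) {t : ℝ} (ht : 0 < t) {V : RN N → RN N}
    (hV : MemLp V 2 volume) :
    Integrable (fun x => fderiv ℝ (mollify (rescale η t) u) x (V x)) ∧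
      ∫ x, fderiv ℝ (mollify (rescale η t) u) x (V x)
        = ∑ i, ∫ x, V x i * mollify (rescale η t) (fun y => D y i) x := by
  have hint : ∀ i, Integrable fun x => V x i * mollify (rescale η t) (fun y => D y i) x :=
    fun i => (hV.eval_piLp i).integrable_mul (hη.memLp_mollify ht (hD.eval_piLp i))
  simp_rw [h.fderiv_mollify_apply (hη.isTestFunction_rescale ht)]
  exact ⟨integrable_finsetSum _ fun i _ => hint i, integral_finsetSum _ fun i _ => hint i⟩

lemma tendsto_integral_fderiv_mollify_apply (hη : IsMollifier η) {t : ℕ → ℝ} (ht0 : ∀ n, 0 < t n)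
    (ht : Tendsto t atTop (𝓝[>] 0)) {V : ℕ → RN N → RN N} {W : RN N → RN N} {A : RN N → ℝ}
    (hA : MemLp A 2 volume) (hV : ∀ n, AEStronglyMeasurable (V n) volume)
    (hVA : ∀ n x, ‖V n x‖ ≤ A x)
    (hlim : ∀ᵐ x, Tendsto (fun n => V n x) atTop (𝓝 (W x))) :
    Tendsto (fun n => ∫ x, fderiv ℝ (mollify (rescale η (t n)) u) x (V n x)) atTop
      (𝓝 (∫ x, inner ℝ (D x) (W x))) := by
  have hW : MemLp W 2 volume := hA.mono (aestronglyMeasurable_of_tendsto_ae atTop hV hlim) <| by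
    filter_upwards [hlim] with x hx
    exact (le_of_tendsto' hx.norm fun n => hVA n x).trans (le_abs_self _)
  have hV2 : ∀ n, MemLp (V n) 2 volume := fun n =>
    hA.mono (hV n) (.of_forall fun x => (hVA n x).trans (le_abs_self _))
  have hsum : ∫ x, inner ℝ (D x) (W x) = ∑ i, ∫ x, W x i * D x i := by
    simp_rw [inner_eq_sum_coord, mul_comm (D _ _)]
    exact integral_finsetSum _ fun i _ => (hW.eval_piLp i).integrable_mul (hD.eval_piLp i)
  rw [hsum]
  refine (tendsto_finsetSum _ fun i _ => ?_).congr fun n =>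
    (h.integral_fderiv_mollify_apply hD hη (ht0 n) (hV2 n)).2.symm
  refine tendsto_integral_mul_of_dominated hA (hD.eval_piLp i)
    (fun n => hη.memLp_mollify (ht0 n) (hD.eval_piLp i))
    (fun n => ((hV2 n).eval_piLp i).aestronglyMeasurable)
    (fun n => .of_forall fun x => (PiLp.norm_apply_le _ i).trans (hVA n x)) ?_
    ((hη.tendsto_integral_sq_mollify_sub (hD.eval_piLp i)).comp ht)
  filter_upwards [hlim] with x hx
  exact ((EuclideanSpace.proj (𝕜 := ℝ) i).continuous.tendsto _).comp hx

lemma integral_deriv_comp_mul_inner (hu : MemLp u 2 volume) {G : ℝ → ℝ} (hG : ContDiff ℝ 1 G)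
    {C : ℝ} (hGC : ∀ s, |G s| ≤ C) (hGC' : ∀ s, |deriv G s| ≤ C) {Y : RN N → RN N}
    (hY : ContDiff ℝ 1 Y) (hc : HasCompactSupport Y) :
    ∫ x, deriv G (u x) * inner ℝ (D x) (Y x) = -∫ x, G (u x) * divergence Y x := by
  obtain ⟨η, _, hη, _⟩ := exists_isMollifier_isRadialPotential N
  obtain ⟨t, ht0, ht, hae⟩ := hη.exists_seq_tendsto_ae hu
  have hG' : Continuous (deriv G) := hG.continuous_deriv le_rfl
  have hdiv := continuous_divergence hY
  have hsmooth : ∀ n, ContDiff ℝ 1 (mollify (rescale η (t n)) u) := fun n =>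
    (hη.contDiff_mollify h.locallyIntegrable_fun (ht0 n)).of_le (by simp)
  have hleft : Tendsto (fun n => ∫ x, fderiv ℝ (mollify (rescale η (t n)) u) x
      (deriv G (mollify (rescale η (t n)) u x) • Y x)) atTop
      (𝓝 (∫ x, inner ℝ (D x) (deriv G (u x) • Y x))) := by
    refine h.tendsto_integral_fderiv_mollify_apply hD hη ht0 ht (A := fun x => C * ‖Y x‖)
      ((hY.continuous.memLp_of_hasCompactSupport hc).norm.const_mul C) (fun n => ?_)
      (fun n x => ?_) ?_
    · exact ((hG'.comp (hsmooth n).continuous).smul hY.continuous).aestronglyMeasurable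
    · rw [norm_smul]
      exact mul_le_mul_of_nonneg_right (hGC' _) (norm_nonneg _)
    · filter_upwards [hae] with x hx using ((hG'.tendsto _).comp hx).smul_const _
  have hright : Tendsto (fun n => -∫ x, G (mollify (rescale η (t n)) u x) * divergence Y x) atTop
      (𝓝 (-∫ x, G (u x) * divergence Y x)) := by
    refine (tendsto_integral_of_dominated_convergence (fun x => C * |divergence Y x|) (fun n => ?_)
      ?_ (fun n => .of_forall fun x => ?_) ?_).neg
    · exact ((hG.continuous.comp (hsmooth n).continuous).mul hdiv).aestronglyMeasurable
    · exact (hdiv.integrable_of_hasCompactSupport (hasCompactSupport_divergence hc)).abs.const_mul C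
    · rw [norm_mul]
      exact mul_le_mul_of_nonneg_right (hGC _) (abs_nonneg _)
    · filter_upwards [hae] with x hx using ((hG.continuous.tendsto _).comp hx).mul_const _
  simp_rw [map_smul, smul_eq_mul, real_inner_smul_right] at hleft
  exact tendsto_nhds_unique hleft
    (hright.congr fun n => (integral_deriv_comp_mul_fderiv (hsmooth n) hG hY hc).symm)

end IsWeakGradient

end ChainRule

/-! ### Superharmonic functions -/

section Superharmonic

variable {N : ℕ} {η ζ φ : RN N → ℝ} {D : RN N → RN N}

/-- The equation `-div D = f` in the sense of distributions. -/
def HasWeakNegDivergence (D : RN N → RN N) (f : RN N → ℝ) : Prop :=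
  ∀ ψ : RN N → ℝ, IsTestFunction ψ → ∫ x, inner ℝ (D x) (gradient ψ x) = ∫ x, f x * ψ x

/-- The inequality `-div D ≥ 0` in the sense of distributions; for a weak gradient `D` of `φ` it
says that `φ` is superharmonic. -/
def IsWeaklySuperharmonic (D : RN N → RN N) : Prop :=
  ∀ ψ : RN N → ℝ, IsTestFunction ψ → (∀ x, 0 ≤ ψ x) → 0 ≤ ∫ x, inner ℝ (D x) (gradient ψ x)

lemma HasWeakNegDivergence.isWeaklySuperharmonic {f : RN N → ℝ} (h : HasWeakNegDivergence D f)
    (hf : 0 ≤ᵐ[volume] f) : IsWeaklySuperharmonic D := fun ψ hψ hψ0 => by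
  rw [h ψ hψ]
  exact integral_nonneg_of_ae (hf.mono fun x hx => mul_nonneg hx (hψ0 x))

/-- The generator `N η(w) + w·∇η(w) = div (η(w) w)` of the dilations `rescale η t`. -/
noncomputable def dilationGenerator (η : RN N → ℝ) (w : RN N) : ℝ :=
  N * η w + fderiv ℝ η w w

lemma hasDerivAt_rescale (h : Differentiable ℝ η) {t : ℝ} (ht : 0 < t) (x : RN N) :
    HasDerivAt (fun s => rescale η s x) (-(t⁻¹ * rescale (dilationGenerator η) t x)) t := by
  have hsmul : HasDerivAt (fun s : ℝ => s⁻¹ • x) (-(t ^ 2)⁻¹ • x) t :=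
    (hasDerivAt_inv ht.ne').smul_const x
  have hpow : HasDerivAt (fun s : ℝ => (s ^ N)⁻¹) (-(N * t ^ (N - 1)) / (t ^ N) ^ 2) t :=
    (hasDerivAt_pow N t).fun_inv (by positivity)
  have hN : (N : ℝ) * t ^ (N - 1) = N * (t ^ N * t⁻¹) := by
    rcases N with _ | n
    · simp
    · rw [Nat.add_sub_cancel, pow_succ, mul_assoc, mul_inv_cancel₀ ht.ne', mul_one]
  refine (hpow.mul ((h (t⁻¹ • x)).hasFDerivAt.comp_hasDerivAt t hsmul)).congr_deriv ?_
  rw [hN]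
  simp only [rescale, dilationGenerator, map_smul, smul_eq_mul, Function.comp_apply]
  field_simp
  ring

lemma continuous_dilationGenerator (h : ContDiff ℝ 1 η) : Continuous (dilationGenerator η) :=
  (continuous_const.mul h.continuous).add (continuous_fderiv_apply h continuous_id)

lemma inv_mul_abs_rescale_le {ρ : RN N → ℝ} (hρ : ∀ x, 1 ≤ ‖x‖ → ρ x = 0) {C : ℝ}
    (hC : ∀ x, |ρ x| ≤ C) {s t : ℝ} (ht : 0 < t) (hs : s ∈ Ioo (t / 2) (2 * t)) (x y : RN N) :
    s⁻¹ * |rescale ρ s (x - y)|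
      ≤ (Metric.closedBall x (2 * t)).indicator (fun _ => (t / 2)⁻¹ * (((t / 2) ^ N)⁻¹ * C)) y := by
  have ht2 : 0 < t / 2 := by positivity
  have hs0 : 0 < s := ht2.trans hs.1
  by_cases hy : y ∈ Metric.closedBall x (2 * t)
  · rw [indicator_of_mem hy, rescale, abs_mul,
      abs_of_nonneg (inv_nonneg.2 (pow_nonneg hs0.le N))]
    have := hs.1.le
    gcongr
    exact hC _
  · rw [indicator_of_notMem hy]
    rw [Metric.mem_closedBall, not_le, dist_comm, dist_eq_norm] at hy
    rw [rescale_eq_zero hρ hs0 (hs.2.le.trans hy.le), abs_zero, mul_zero]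

namespace IsMollifier

variable (hη : IsMollifier η)

include hη

lemma dilationGenerator_eq_zero {x : RN N} (hx : 1 ≤ ‖x‖) : dilationGenerator η x = 0 := by
  simp [dilationGenerator, hη.eq_zero x hx,
    fderiv_eq_zero_of_nonneg hη.nonneg (hη.eq_zero x hx)]

lemma hasDerivAt_mollify (hφ : LocallyIntegrable φ) {t : ℝ} (ht : 0 < t) (x : RN N) :
    HasDerivAt (fun s => mollify (rescale η s) φ x)
      (-(t⁻¹ * mollify (rescale (dilationGenerator η) t) φ x)) t := by
  have hη1 : ContDiff ℝ 1 η := hη.contDiff.of_le (by simp)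
  have hρ := continuous_dilationGenerator hη1
  obtain ⟨C, _, hC⟩ := exists_forall_norm_le_of_hasCompactSupport hρ
    (hasCompactSupport_of_norm_ge fun _ => hη.dilationGenerator_eq_zero)
  have hmeas : ∀ {f : RN N → ℝ}, Continuous f → ∀ s,
      AEStronglyMeasurable (fun y => φ y * rescale f s (x - y)) volume := fun {f} hf s =>
    hφ.aestronglyMeasurable.mul
      (continuous_const.mul (hf.comp (by fun_prop))).aestronglyMeasurable
  set B : ℝ := (t / 2)⁻¹ * (((t / 2) ^ N)⁻¹ * C)
  have hderiv := hasDerivAt_integral_of_dominated_loc_of_deriv_le (μ := volume)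
    (F := fun s y => φ y * rescale η s (x - y))
    (F' := fun s y => -s⁻¹ * (φ y * rescale (dilationGenerator η) s (x - y)))
    (bound := (Metric.closedBall x (2 * t)).indicator fun y => |φ y| * B)
    (Ioo_mem_nhds (a := t / 2) (b := 2 * t) (by linarith) (by linarith))
    (.of_forall fun s => hmeas hη1.continuous s) (hη.integrable_mul_rescale ht hφ x)
    ((hmeas hρ t).const_mul _) ?_ ?_ ?_
  · refine hderiv.2.congr_deriv ?_
    rw [integral_const_mul, neg_mul]
    rfl
  · refine .of_forall fun y s hs => ?_
    have hs0 : 0 < s := (half_pos ht).trans hs.1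
    have hle := inv_mul_abs_rescale_le (fun _ => hη.dilationGenerator_eq_zero) hC ht hs x y
    rw [norm_mul, norm_neg, norm_mul, norm_inv, Real.norm_of_nonneg hs0.le, Real.norm_eq_abs,
      Real.norm_eq_abs, mul_left_comm, indicator_mul_right _ (fun y => |φ y|)]
    exact mul_le_mul_of_nonneg_left hle (abs_nonneg _)
  · exact (integrable_indicator_iff measurableSet_closedBall).2
      ((hφ.integrableOn_isCompact (isCompact_closedBall _ _)).abs.mul_const B)
  · refine .of_forall fun y s hs => ?_
    exact ((hasDerivAt_rescale (hη1.differentiable one_ne_zero) ((half_pos ht).trans hs.1)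
      (x - y)).const_mul (φ y)).congr_deriv (by ring)

lemma tendsto_mollify_atTop (hN : 0 < N) (hφ : MemLp φ 2 volume) (x : RN N) :
    Tendsto (fun t => mollify (rescale η t) φ x) atTop (𝓝 0) := by
  have hsq : ∀ t : ℝ, 0 < t →
      ∫ y, rescale η t (x - y) ^ 2 = (t ^ N)⁻¹ * ∫ z, η z ^ 2 := fun t ht => by
    rw [integral_sub_left_eq_self (fun z => rescale η t z ^ 2),
      ← integral_rescale (fun z => η z ^ 2) ht, ← integral_const_mul]
    simp_rw [rescale]
    ring_nf
  have hbound : ∀ᶠ t in atTop, ‖mollify (rescale η t) φ x‖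
      ≤ √(∫ y, φ y ^ 2) * √((t ^ N)⁻¹ * ∫ z, η z ^ 2) := by
    filter_upwards [eventually_gt_atTop 0] with t ht
    rw [← hsq t ht]
    have hκ := (hη.isTestFunction_rescale ht).comp_const_sub x
    exact abs_integral_mul_le_of_memLp_two hφ
      (hκ.1.continuous.memLp_of_hasCompactSupport hκ.2)
  have hpow : Tendsto (fun t : ℝ => (t ^ N)⁻¹) atTop (𝓝 0) :=
    tendsto_inv_atTop_zero.comp (tendsto_pow_atTop hN.ne')
  refine squeeze_zero_norm' hbound ?_
  simpa using ((hpow.mul_const (∫ z, η z ^ 2)).sqrt).const_mul √(∫ y, φ y ^ 2)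

end IsMollifier

namespace IsWeaklySuperharmonic

variable (hs : IsWeaklySuperharmonic D) (h : IsWeakGradient φ D) (hη : IsMollifier η)

include hs h hη

lemma mollify_dilationGenerator_nonneg (hζ : IsRadialPotential ζ η) {t : ℝ} (ht : 0 < t)
    (x : RN N) : 0 ≤ mollify (rescale (dilationGenerator η) t) φ x := by
  have hκ := (hη.isTestFunction_rescale ht).comp_const_sub x
  have hψ : IsTestFunction fun y => ζ (t⁻¹ • (x - y)) :=
    IsTestFunction.comp_const_sub (κ := fun z => ζ (t⁻¹ • z))
      ⟨hζ.contDiff.comp (contDiff_const_smul _), hasCompactSupport_comp_smul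
        (hasCompactSupport_of_norm_ge hζ.eq_zero) (inv_ne_zero ht.ne')⟩ x
  have hdiv : ∀ y, divergence (fun y => rescale η t (x - y) • (x - y)) y
      = -rescale (dilationGenerator η) t (x - y) := fun y => by
    have hid : divergence (fun z : RN N => z) y = N := by simp [divergence]
    rw [divergence_smul (hκ.1.differentiable (by simp) y) (by fun_prop), fderiv_comp_const_sub,
      fderiv_rescale, divergence_const_sub x fun z => z, hid]
    simp only [rescale, dilationGenerator, map_smul, smul_eq_mul, neg_apply, smul_apply]
    ring
  have hgrad : ∀ y, inner ℝ (D y) (rescale η t (x - y) • (x - y))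
      = ((t ^ N)⁻¹ * t ^ 2) * inner ℝ (D y) (gradient (fun y => ζ (t⁻¹ • (x - y))) y) := fun y => by
    rw [inner_gradient_right_real, fderiv_comp_const_sub (fun z => ζ (t⁻¹ • z)), fderiv_comp_smul,
      neg_apply, smul_apply, hζ.fderiv_eq, real_inner_smul_left, real_inner_smul_right, rescale,
      real_inner_comm, smul_eq_mul]
    field_simp
  have hparts := h.integral_mul_divergence (V := fun y => rescale η t (x - y) • (x - y))
    (hκ.1.smul (contDiff_const.sub contDiff_id)) hκ.2.smul_right
  simp_rw [hdiv, hgrad, mul_neg, integral_neg, neg_inj, integral_const_mul] at hparts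
  rw [mollify, hparts]
  exact mul_nonneg (by positivity) (hs _ hψ fun y => hζ.nonneg _)

variable (hζ : IsRadialPotential ζ η)

include hζ

lemma antitoneOn_mollify (x : RN N) : AntitoneOn (fun t => mollify (rescale η t) φ x) (Ioi 0) := by
  have hderiv := fun t (ht : 0 < t) => hη.hasDerivAt_mollify h.locallyIntegrable_fun ht x
  refine antitoneOn_of_deriv_nonpos (convex_Ioi 0)
    (fun t ht => (hderiv t ht).continuousAt.continuousWithinAt) ?_ ?_
  · rw [interior_Ioi]
    exact fun t ht => (hderiv t ht).differentiableAt.differentiableWithinAt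
  · rw [interior_Ioi]
    intro t ht
    rw [(hderiv t ht).deriv, neg_nonpos]
    exact mul_nonneg (inv_nonneg.2 (le_of_lt ht))
      (hs.mollify_dilationGenerator_nonneg h hη hζ ht x)

lemma mollify_le (hφ : MemLp φ 2 volume) :
    ∀ᵐ x, ∀ t, 0 < t → mollify (rescale η t) φ x ≤ φ x := by
  obtain ⟨t, ht0, ht, hae⟩ := hη.exists_seq_tendsto_ae hφ
  filter_upwards [hae] with x hx s hs0
  refine ge_of_tendsto hx ?_
  filter_upwards [(tendsto_nhdsWithin_iff.1 ht).1.eventually (gt_mem_nhds hs0)] with n hn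
  exact hs.antitoneOn_mollify h hη hζ x (ht0 n) hs0 hn.le

lemma mollify_nonneg (hN : 0 < N) (hφ : MemLp φ 2 volume) {t : ℝ} (ht : 0 < t) (x : RN N) :
    0 ≤ mollify (rescale η t) φ x := by
  refine le_of_tendsto (hη.tendsto_mollify_atTop hN hφ x) ?_
  filter_upwards [eventually_ge_atTop t] with s hts
  exact hs.antitoneOn_mollify h hη hζ x ht (ht.trans_le hts) hts

end IsWeaklySuperharmonic

lemma IsCutoff.memLp_fderiv_comp_smul_apply {θ : RN N → ℝ} (hθ : IsCutoff θ)
    (hD : MemLp D 2 volume) {l : ℝ} (hl : 0 ≤ l) :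
    MemLp (fun x => fderiv ℝ (fun y => θ (l • y)) x (D x)) 2 volume := by
  obtain ⟨C, _, hC⟩ := hθ.exists_abs_fderiv_comp_smul_le
  have hχ : ContDiff ℝ ∞ fun x => θ (l • x) := hθ.contDiff.comp (contDiff_const_smul _)
  refine ((hD.norm.const_mul C).const_mul l).mono ?_
    (.of_forall fun x => (hC l hl x (D x)).trans (le_abs_self _))
  exact (isBoundedBilinearMap_apply (𝕜 := ℝ)).continuous.comp_aestronglyMeasurable
    ((hχ.continuous_fderiv (by simp)).aestronglyMeasurable.prodMk hD.aestronglyMeasurable)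

lemma IsCutoff.tendsto_integral_fderiv_comp_smul_mul {θ : RN N → ℝ} (hθ : IsCutoff θ)
    (hD : MemLp D 2 volume) {l : ℕ → ℝ} (hl0 : ∀ n, 0 ≤ l n) (hl1 : ∀ n, l n ≤ 1)
    (hl : Tendsto l atTop (𝓝 0)) {g : ℕ → RN N → ℝ} (hφ : MemLp φ 2 volume)
    (hg : ∀ n, MemLp (g n) 2 volume)
    (hlim : Tendsto (fun n => ∫ x, (g n x - φ x) ^ 2) atTop (𝓝 0)) :
    Tendsto (fun n => ∫ x, fderiv ℝ (fun y => θ (l n • y)) x (D x) * g n x) atTop (𝓝 0) := by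
  obtain ⟨C, hC0, hC⟩ := hθ.exists_abs_fderiv_comp_smul_le
  have hzero := tendsto_integral_mul_of_dominated (d := 0) (hD.norm.const_mul C) hφ hg
    (fun n => (hθ.memLp_fderiv_comp_smul_apply hD (hl0 n)).aestronglyMeasurable)
    (fun n => .of_forall fun x => (hC _ (hl0 n) x (D x)).trans
      (mul_le_of_le_one_left (by positivity) (hl1 n)))
    (.of_forall fun x => squeeze_zero_norm (fun n => hC _ (hl0 n) x (D x))
      (by simpa using hl.mul_const (C * ‖D x‖))) hlim
  simpa using hzero

lemma IsWeakGradient.tendsto_integral_inner_gradient_cutoff_mul_mollify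
    (h : IsWeakGradient φ D) (hφ : MemLp φ 2 volume) (hD : MemLp D 2 volume)
    (hη : IsMollifier η) {θ : RN N → ℝ} (hθ : IsCutoff θ) {l t : ℕ → ℝ} (hl0 : ∀ n, 0 ≤ l n)
    (hl1 : ∀ n, l n ≤ 1) (hl : Tendsto l atTop (𝓝 0)) (ht0 : ∀ n, 0 < t n)
    (ht : Tendsto t atTop (𝓝[>] 0)) :
    Tendsto (fun n => ∫ x, inner ℝ (D x)
        (gradient (fun y => θ (l n • y) * mollify (rescale η (t n)) φ y) x)) atTop
      (𝓝 (∫ x, ‖D x‖ ^ 2)) := by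
  have hχ : ∀ n, ContDiff ℝ ∞ fun x => θ (l n • x) := fun n =>
    hθ.contDiff.comp (contDiff_const_smul _)
  have hχD : ∀ n, AEStronglyMeasurable (fun x => θ (l n • x) • D x) volume := fun n =>
    (hχ n).continuous.aestronglyMeasurable.smul hD.aestronglyMeasurable
  have hχD_le : ∀ n x, ‖θ (l n • x) • D x‖ ≤ ‖D x‖ := fun n x => by
    rw [norm_smul, Real.norm_of_nonneg (hθ.nonneg _)]
    exact mul_le_of_le_one_left (norm_nonneg _) (hθ.le_one _)
  have hmain := h.tendsto_integral_fderiv_mollify_apply hD hη ht0 ht (W := D) hD.norm hχD hχD_le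
    (.of_forall fun x => by simpa using (hθ.tendsto_comp_smul hl x).smul_const (D x))
  have hφn := fun n => hη.memLp_mollify (ht0 n) hφ
  have herr := hθ.tendsto_integral_fderiv_comp_smul_mul hD hl0 hl1 hl hφ hφn
    ((hη.tendsto_integral_sq_mollify_sub hφ).comp ht)
  simp_rw [← real_inner_self_eq_norm_sq]
  rw [← add_zero (∫ x, inner ℝ (D x) (D x))]
  refine (hmain.add herr).congr fun n => ?_
  refine (integral_add (h.integral_fderiv_mollify_apply hD hη (ht0 n) (hD.norm.mono (hχD n)
      (.of_forall fun x => by simpa using hχD_le n x))).1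
    ((hθ.memLp_fderiv_comp_smul_apply hD (hl0 n)).integrable_mul (hφn n))).symm.trans ?_
  refine integral_congr_ae (.of_forall fun x => ?_)
  have hφ_diff := (hη.contDiff_mollify h.locallyIntegrable_fun (ht0 n)).differentiable (by simp)
  simp only [inner_gradient_right_real, fderiv_fun_mul ((hχ n).differentiable (by simp) x)
    (hφ_diff x), add_apply, smul_apply, smul_eq_mul, map_smul, Pi.mul_apply]
  ring

/-- Testing `-div D = f` with `φ`: since `-div D ≥ 0`, the mollifications satisfy `0 ≤ φ_t ≤ φ`,
which makes `φ f` integrable by Fatou's lemma. -/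
lemma IsWeakGradient.integral_mul_eq_integral_norm_sq (hN : 0 < N) (h : IsWeakGradient φ D)
    (hφ : MemLp φ 2 volume) (hD : MemLp D 2 volume) {f : RN N → ℝ} (hf : LocallyIntegrable f)
    (hf0 : 0 ≤ᵐ[volume] f) (heq : HasWeakNegDivergence D f) :
    Integrable (fun x => φ x * f x) ∧ ∫ x, φ x * f x = ∫ x, ‖D x‖ ^ 2 := by
  obtain ⟨η, ζ, hη, hζ⟩ := exists_isMollifier_isRadialPotential N
  obtain ⟨θ, hθ⟩ := exists_isCutoff N
  obtain ⟨t, ht0, ht, hae⟩ := hη.exists_seq_tendsto_ae hφ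
  have hs := heq.isWeaklySuperharmonic hf0
  have hle := hs.mollify_le h hη hζ hφ
  have hpos := fun n => hs.mollify_nonneg h hη hζ hN hφ (ht0 n)
  set l : ℕ → ℝ := fun n => 1 / ((n : ℝ) + 1)
  have hl0 : ∀ n, 0 < l n := fun n => Nat.one_div_pos_of_nat
  have hl : Tendsto l atTop (𝓝 0) := tendsto_one_div_add_atTop_nhds_zero_nat
  have hl1 : ∀ n, l n ≤ 1 := fun n => div_le_one_of_le₀ (by simp) (by positivity)
  have hψ : ∀ n, IsTestFunction fun x => θ (l n • x) * mollify (rescale η (t n)) φ x := fun n =>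
    hθ.isTestFunction_comp_smul_mul (hl0 n).ne'
      (hη.contDiff_mollify h.locallyIntegrable_fun (ht0 n))
  have hφ0 : ∀ᵐ x, 0 ≤ φ x := by
    filter_upwards [hle] with x hx using (hpos 0 x).trans (hx _ (ht0 0))
  refine integrable_mul_of_tendsto_of_isQuasiIntegrable (A := φ)
    (v := fun n x => θ (l n • x) * mollify (rescale η (t n)) φ x)
    (fun n => .of_forall fun x => mul_nonneg (hθ.nonneg _) (hpos n x)) (fun n => ?_)
    (.of_forall fun _ => le_rfl) (fun n => ?_) ?_ ?_ (.inr ?_)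
  · filter_upwards [hle] with x hx
    exact (mul_le_of_le_one_left (hpos n x) (hθ.le_one _)).trans (hx _ (ht0 n))
  · exact hf.integrable_smul_left_of_hasCompactSupport (hψ n).1.continuous (hψ n).2
  · filter_upwards [hae] with x hx using by simpa using (hθ.tendsto_comp_smul hl x).mul hx
  · simp_rw [mul_comm _ (f _), ← heq _ (hψ _)]
    exact h.tendsto_integral_inner_gradient_cutoff_mul_mollify hφ hD hη hθ
      (fun n => (hl0 n).le) hl1 hl ht0 ht
  · refine (integrable_zero (RN N) ℝ volume).congr ?_
    filter_upwards [hφ0, hf0] with x hx hfx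
    exact (max_eq_right (neg_nonpos.2 (mul_nonneg hx hfx))).symm

end Superharmonic

/-! ### The Hardy–Littlewood–Sobolev inequality -/

section HardyLittlewoodSobolev

variable {N : ℕ} {α r : ℝ}

/-- The integrable majorant `|w|^(-l)` for `|w| < 1`, `|w|^(-2N)` for `|w| ≥ 1`, by which the
kernel `|w|^(-l)` is replaced once its tail has been split off by Young's inequality. -/
noncomputable def hlsProfile (l : ℝ) (w : RN N) : ℝ :=
  if ‖w‖ < 1 then ‖w‖ ^ (-l) else ‖w‖ ^ (-(2 * N : ℝ))

lemma hlsProfile_nonneg (l : ℝ) (w : RN N) : 0 ≤ hlsProfile l w := by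
  unfold hlsProfile
  split_ifs <;> positivity

lemma measurable_hlsProfile (l : ℝ) : Measurable (hlsProfile (N := N) l) :=
  Measurable.ite (measurableSet_lt measurable_norm measurable_const)
    (measurable_norm.pow_const _) (measurable_norm.pow_const _)

lemma rpow_neg_le_two_rpow_mul_one_add_rpow_neg {a s : ℝ} (ha : 0 ≤ a) (hs : 1 ≤ s) :
    s ^ (-a) ≤ 2 ^ a * (1 + s) ^ (-a) := by
  have hs0 : 0 < s := one_pos.trans_le hs
  rw [Real.rpow_neg hs0.le, Real.rpow_neg (by positivity), ← div_eq_mul_inv,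
    ← Real.div_rpow (by positivity) (by positivity), ← Real.inv_rpow hs0.le]
  refine Real.rpow_le_rpow (by positivity) ?_ ha
  rw [inv_eq_one_div, div_le_div_iff₀ hs0 (by positivity)]
  linarith

lemma integrable_hlsProfile (hN : 0 < N) {l : ℝ} (hl : l < N) :
    Integrable (hlsProfile (N := N) l) := by
  have hmeas := (measurable_hlsProfile (N := N) l).aestronglyMeasurable (μ := volume)
  rw [← integrableOn_univ, ← union_compl_self (Metric.ball (0 : RN N) 1)]
  refine IntegrableOn.union ?_ ?_
  · refine integrableOn_ball_of_norm_le_rpow (C := 1) (α := l)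
      (by simpa using Nat.one_le_iff_ne_zero.2 hN.ne') (by simpa using hl) ?_ hmeas
    refine (ae_restrict_iff' measurableSet_ball).2 (.of_forall fun x hx => ?_)
    rw [Real.norm_of_nonneg (hlsProfile_nonneg _ _), hlsProfile, if_pos (by simpa using hx),
      one_mul]
  · have hdecay : Integrable fun x : RN N =>
        (2 : ℝ) ^ (2 * N : ℝ) * (1 + ‖x‖) ^ (-(2 * N : ℝ)) := by
      refine (integrable_one_add_norm ?_).const_mul _
      rw [finrank_euclideanSpace_fin]
      linarith [show (0 : ℝ) < N from Nat.cast_pos.2 hN]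
    refine Integrable.mono' hdecay.integrableOn hmeas.restrict ?_
    refine (ae_restrict_iff' measurableSet_ball.compl).2 (.of_forall fun x hx => ?_)
    have hx1 : 1 ≤ ‖x‖ := by simpa using hx
    rw [Real.norm_of_nonneg (hlsProfile_nonneg _ _), hlsProfile, if_neg (not_lt.2 hx1)]
    exact rpow_neg_le_two_rpow_mul_one_add_rpow_neg (by positivity) hx1

lemma integrable_rpow_mul_comp_rpow_smul_sub (hN : 0 < N) (hr : 0 < r) {H f : RN N → ℝ}
    (hHm : Measurable H) (hH0 : ∀ w, 0 ≤ H w) (hH : Integrable H)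
    (hf : AEStronglyMeasurable f volume) (hf0 : ∀ x, 0 ≤ f x) (hfr : Integrable fun x => f x ^ r) :
    Integrable (fun z : RN N × RN N => f z.1 ^ (2 * r) * H (f z.1 ^ (r / N) • (z.1 - z.2)))
      (volume.prod volume) := by
  have hfst : AEMeasurable (fun z : RN N × RN N => f z.1) (volume.prod volume) :=
    hf.comp_fst.aemeasurable
  have hmeas : AEStronglyMeasurable (fun z : RN N × RN N =>
      f z.1 ^ (2 * r) * H (f z.1 ^ (r / N) • (z.1 - z.2))) (volume.prod volume) :=
    ((hfst.pow_const _).mul (hHm.comp_aemeasurable ((hfst.pow_const _).smul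
      (measurable_fst.sub measurable_snd).aemeasurable))).aestronglyMeasurable
  have hslice : ∀ x, Integrable (fun y => f x ^ (2 * r) * H (f x ^ (r / N) • (x - y))) ∧
      ∫ y, f x ^ (2 * r) * H (f x ^ (r / N) • (x - y)) = f x ^ r * ∫ w, H w := fun x => by
    rcases (hf0 x).eq_or_lt with h0 | h0
    · simp [← h0, Real.zero_rpow hr.ne', Real.zero_rpow (by positivity : 2 * r ≠ 0)]
    have hc : f x ^ (r / N) ≠ 0 := by positivity
    refine ⟨((hH.comp_smul hc).comp_sub_left x).const_mul _, ?_⟩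
    rw [integral_const_mul, integral_sub_left_eq_self (fun z => H (f x ^ (r / N) • z)),
      Measure.integral_comp_smul, finrank_euclideanSpace_fin, smul_eq_mul, ← mul_assoc,
      abs_of_nonneg (by positivity), ← Real.rpow_natCast, ← Real.rpow_mul h0.le,
      div_mul_cancel₀ _ (Nat.cast_ne_zero.2 hN.ne'), ← Real.rpow_neg h0.le, ← Real.rpow_add h0,
      two_mul, add_neg_cancel_right]
  refine (integrable_prod_iff hmeas).2 ⟨.of_forall fun x => (hslice x).1, ?_⟩
  simp_rw [Real.norm_of_nonneg (mul_nonneg (Real.rpow_nonneg (hf0 _) _) (hH0 _)), hslice]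
  exact hfr.mul_const _

lemma rpow_mul_hlsProfile_of_lt (hN : 0 < N) (hα : 0 < α) (hr : r = 2 * N / (N + α)) {t : ℝ}
    (ht : 0 < t) {z : RN N} (hz : ‖t ^ (r / N) • z‖ < 1) :
    t ^ (2 * r) * hlsProfile (N - α) (t ^ (r / N) • z) = t * t * (‖z‖ ^ (N - α))⁻¹ := by
  have hexp : 2 * r + r / N * -(N - α) = 2 := by
    have : (0 : ℝ) < N := Nat.cast_pos.2 hN
    rw [hr]
    field_simp
    ring
  rw [hlsProfile, if_pos hz, norm_smul, Real.norm_of_nonneg (by positivity),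
    Real.mul_rpow (by positivity) (norm_nonneg z), ← Real.rpow_mul ht.le, ← mul_assoc,
    ← Real.rpow_add ht, Real.rpow_neg (norm_nonneg z), hexp, Real.rpow_two, sq]

lemma rpow_mul_hlsProfile_of_le (hN : 0 < N) {l t : ℝ} (ht : 0 < t) {z : RN N}
    (hz : 1 ≤ ‖t ^ (r / N) • z‖) :
    t ^ (2 * r) * hlsProfile l (t ^ (r / N) • z) = ‖z‖ ^ (-(2 * N : ℝ)) := by
  have hexp : 2 * r + r / N * -(2 * N : ℝ) = 0 := by
    have : (0 : ℝ) < N := Nat.cast_pos.2 hN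
    field_simp
    ring
  rw [hlsProfile, if_neg (not_lt.2 hz), norm_smul, Real.norm_of_nonneg (by positivity),
    Real.mul_rpow (by positivity) (norm_nonneg z), ← Real.rpow_mul ht.le, ← mul_assoc,
    ← Real.rpow_add ht, hexp, Real.rpow_zero, one_mul]

lemma mul_inv_rpow_le_rpow_add (hα : 0 < α) (hαN : α < N) (hr : r = 2 * N / (N + α)) {a d : ℝ}
    (ha : 0 ≤ a) (hd : 0 ≤ d) :
    a * (d ^ (N - α))⁻¹ ≤ a ^ r + d ^ (-(2 * N : ℝ)) := by
  have hN : (0 : ℝ) < N := hα.trans hαN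
  have hNα : (N : ℝ) - α ≠ 0 := (sub_pos.2 hαN).ne'
  have hr1 : 1 < r := by
    rw [hr, lt_div_iff₀ (by positivity)]
    linarith
  have hconj : r.HolderConjugate (2 * N / (N - α)) := by
    refine Real.holderConjugate_iff.2 ⟨hr1, ?_⟩
    rw [hr]
    field_simp
    ring
  have hexp : ((d ^ (N - α))⁻¹) ^ (2 * N / (N - α)) = d ^ (-(2 * N : ℝ)) := by
    rw [← Real.rpow_neg hd, ← Real.rpow_mul hd]
    congr 1
    field_simp
  have hyoung := Real.young_inequality_of_nonneg ha (b := (d ^ (N - α))⁻¹) (by positivity) hconj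
  rw [hexp] at hyoung
  exact hyoung.trans (add_le_add (div_le_self (by positivity) hr1.le)
    (div_le_self (by positivity) hconj.symm.lt.le))

lemma mul_mul_inv_rpow_le_hlsProfile (hα : 0 < α) (hαN : α < N) (hr : r = 2 * N / (N + α))
    {s t : ℝ} (hs : 0 ≤ s) (hst : s ≤ t) (z : RN N) :
    t * s * (‖z‖ ^ (N - α))⁻¹
      ≤ t ^ r * s ^ r + t ^ (2 * r) * hlsProfile (N - α) (t ^ (r / N) • z) := by
  have hN : 0 < N := Nat.cast_pos.1 (hα.trans hαN)
  have ht0 : 0 ≤ t := hs.trans hst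
  rcases ht0.eq_or_lt with rfl | ht
  · rw [zero_mul, zero_mul]
    have := hlsProfile_nonneg (N - α) ((0 : ℝ) ^ (r / N) • z)
    positivity
  by_cases hz : ‖t ^ (r / N) • z‖ < 1
  · rw [rpow_mul_hlsProfile_of_lt hN hα hr ht hz]
    exact le_add_of_nonneg_of_le (by positivity) (by gcongr)
  · rw [rpow_mul_hlsProfile_of_le hN ht (not_lt.1 hz), ← Real.mul_rpow ht0 hs]
    exact mul_inv_rpow_le_rpow_add hα hαN hr (mul_nonneg ht0 hs) (norm_nonneg z)

lemma integrable_mul_mul_inv_rpow_of_nonneg (hα : 0 < α) (hαN : α < N)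
    (hr : r = 2 * N / (N + α)) {f : RN N → ℝ} (hf : AEStronglyMeasurable f volume)
    (hf0 : ∀ x, 0 ≤ f x) (hfr : Integrable fun x => f x ^ r) :
    Integrable (fun z : RN N × RN N => f z.1 * f z.2 * (‖z.1 - z.2‖ ^ (N - α))⁻¹)
      (volume.prod volume) := by
  have hN : (0 : ℝ) < N := hα.trans hαN
  have hr0 : 0 < r := by
    rw [hr]
    positivity
  have hprofile := integrable_rpow_mul_comp_rpow_smul_sub (Nat.cast_pos.1 hN) hr0
    (measurable_hlsProfile _) (hlsProfile_nonneg (N - α))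
    (integrable_hlsProfile (Nat.cast_pos.1 hN) (sub_lt_self _ hα)) hf hf0 hfr
  refine Integrable.mono' (((hfr.mul_prod hfr).add hprofile).add hprofile.swap) ?_
    (.of_forall fun z => ?_)
  · exact (hf.comp_fst.mul hf.comp_snd).mul
      ((measurable_fst.sub measurable_snd).norm.pow_const _).inv.aestronglyMeasurable
  have h1 := hf0 z.1
  have h2 := hf0 z.2
  have hp1 := mul_nonneg (Real.rpow_nonneg h1 (2 * r))
    (hlsProfile_nonneg (N - α) (f z.1 ^ (r / N) • (z.1 - z.2)))
  have hp2 := mul_nonneg (Real.rpow_nonneg h2 (2 * r))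
    (hlsProfile_nonneg (N - α) (f z.2 ^ (r / N) • (z.2 - z.1)))
  rw [Real.norm_of_nonneg (by positivity)]
  simp only [Pi.add_apply, Function.comp_apply, Prod.fst_swap, Prod.snd_swap]
  rcases le_total (f z.2) (f z.1) with h | h
  · linarith [mul_mul_inv_rpow_le_hlsProfile hα hαN hr h2 h (z.1 - z.2)]
  · rw [norm_sub_rev z.1 z.2]
    linarith [mul_mul_inv_rpow_le_hlsProfile hα hαN hr h1 h (z.2 - z.1)]

lemma integrable_mul_mul_inv_rpow (hα : 0 < α) (hαN : α < N) (hr : r = 2 * N / (N + α))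
    {f g : RN N → ℝ} (hf : MemLp f (ENNReal.ofReal r) volume)
    (hg : MemLp g (ENNReal.ofReal r) volume) :
    Integrable (fun z : RN N × RN N => f z.1 * g z.2 * (‖z.1 - z.2‖ ^ (N - α))⁻¹)
      (volume.prod volume) := by
  have hr0 : 0 < r := by
    have : (0 : ℝ) < N := hα.trans hαN
    rw [hr]
    positivity
  have hfg : MemLp (fun x => |f x| + |g x|) (ENNReal.ofReal r) volume := hf.abs.add hg.abs
  have hfgr : Integrable fun x => (|f x| + |g x|) ^ r := by
    have h := hfg.integrable_norm_rpow (by simpa using hr0) ENNReal.ofReal_ne_top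
    simpa only [ENNReal.toReal_ofReal hr0.le, Real.norm_of_nonneg
      (add_nonneg (abs_nonneg (f _)) (abs_nonneg (g _)))] using h
  refine (integrable_mul_mul_inv_rpow_of_nonneg hα hαN hr hfg.aestronglyMeasurable
    (fun x => by positivity) hfgr).mono' ?_ (.of_forall fun z => ?_)
  · exact (hf.aestronglyMeasurable.comp_fst.mul hg.aestronglyMeasurable.comp_snd).mul
      ((measurable_fst.sub measurable_snd).norm.pow_const _).inv.aestronglyMeasurable
  rw [norm_mul, norm_mul, Real.norm_eq_abs, Real.norm_eq_abs,
    Real.norm_of_nonneg (by positivity : 0 ≤ (‖z.1 - z.2‖ ^ (N - α))⁻¹)]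
  gcongr
  · exact le_add_of_nonneg_right (abs_nonneg _)
  · exact le_add_of_nonneg_left (abs_nonneg _)

end HardyLittlewoodSobolev

/-! ### Truncated powers -/

section TruncatedPower

/-- The bounded `C¹` approximation `|s|^q / (1 + |s|^q / k)` of `|s|^q`, which increases to `|s|^q`
as `k → ∞`. -/
noncomputable def truncPow (q k s : ℝ) : ℝ := |s| ^ q / (1 + |s| ^ q / k)

variable {q k : ℝ}

lemma abs_abs_rpow_sub_two_mul (hq : 1 < q) (s : ℝ) : |(|s| ^ (q - 2) * s)| = |s| ^ (q - 1) := by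
  rw [abs_mul, abs_of_nonneg (by positivity)]
  rcases (abs_nonneg s).eq_or_lt with h | h
  · rw [← h, mul_zero, Real.zero_rpow (by linarith)]
  · rw [← Real.rpow_add_one h.ne']
    ring_nf

lemma rpow_sub_one_le_one_add_rpow (hq : 1 ≤ q) {s : ℝ} (hs : 0 ≤ s) :
    s ^ (q - 1) ≤ 1 + s ^ q := by
  rcases le_total s 1 with h | h
  · exact (Real.rpow_le_one hs h (by linarith)).trans (le_add_of_nonneg_right (by positivity))
  · exact (Real.rpow_le_rpow_of_exponent_le h (by linarith)).trans
      (le_add_of_nonneg_left zero_le_one)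

lemma continuous_abs_rpow (hq : 0 ≤ q) : Continuous fun s : ℝ => |s| ^ q :=
  continuous_abs.rpow_const fun _ => Or.inr hq

lemma continuous_abs_rpow_sub_two_mul (hq : 1 < q) :
    Continuous fun s : ℝ => |s| ^ (q - 2) * s := by
  have hderiv : (fun s : ℝ => |s| ^ (q - 2) * s) =
      fun s => q⁻¹ * deriv (fun s : ℝ => |s| ^ q) s := by
    ext s
    rw [(hasDerivAt_abs_rpow s hq).deriv, mul_assoc, inv_mul_cancel_left₀ (by linarith)]
  have hdiff : ContDiff ℝ 1 fun s : ℝ => |s| ^ q := by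
    simpa using contDiff_norm_rpow (E := ℝ) hq
  rw [hderiv]
  exact continuous_const.mul (hdiff.continuous_deriv le_rfl)

lemma one_le_truncPow_den (hk : 0 < k) (s : ℝ) : 1 ≤ 1 + |s| ^ q / k :=
  le_add_of_nonneg_right (by positivity)

lemma truncPow_nonneg (hk : 0 < k) (s : ℝ) : 0 ≤ truncPow q k s := by
  unfold truncPow
  positivity

lemma truncPow_le (hk : 0 < k) (s : ℝ) : truncPow q k s ≤ |s| ^ q :=
  div_le_self (by positivity) (one_le_truncPow_den hk s)

lemma truncPow_le_const (hk : 0 < k) (s : ℝ) : truncPow q k s ≤ k := by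
  rw [truncPow, div_le_iff₀ (by positivity), mul_add, mul_div_cancel₀ _ hk.ne']
  linarith

lemma hasDerivAt_truncPow (hq : 1 < q) (hk : 0 < k) (s : ℝ) :
    HasDerivAt (truncPow q k) (q * (|s| ^ (q - 2) * s) / (1 + |s| ^ q / k) ^ 2) s := by
  have hpow := hasDerivAt_abs_rpow s hq
  have hden : 1 + |s| ^ q / k ≠ 0 := by positivity
  refine (hpow.div ((hpow.div_const k).const_add 1) hden).congr_deriv ?_
  field_simp
  ring

lemma contDiff_truncPow (hq : 1 < q) (hk : 0 < k) : ContDiff ℝ 1 (truncPow q k) := by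
  refine contDiff_one_iff_deriv.2 ⟨fun s => (hasDerivAt_truncPow hq hk s).differentiableAt, ?_⟩
  rw [funext fun s => (hasDerivAt_truncPow hq hk s).deriv]
  exact (continuous_const.mul (continuous_abs_rpow_sub_two_mul hq)).div
    ((continuous_const.add ((continuous_abs_rpow (by linarith)).div_const k)).pow 2)
    fun s => by positivity

lemma abs_deriv_truncPow (hq : 1 < q) (hk : 0 < k) (s : ℝ) :
    |deriv (truncPow q k) s| = q * |s| ^ (q - 1) / (1 + |s| ^ q / k) ^ 2 := by
  rw [(hasDerivAt_truncPow hq hk s).deriv, abs_div, abs_mul, abs_of_pos (by linarith : 0 < q),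
    abs_abs_rpow_sub_two_mul hq, abs_of_nonneg (sq_nonneg (1 + |s| ^ q / k))]

lemma abs_deriv_truncPow_le (hq : 1 < q) (hk : 0 < k) (s : ℝ) :
    |deriv (truncPow q k) s| ≤ q * |s| ^ (q - 1) := by
  rw [abs_deriv_truncPow hq hk]
  exact div_le_self (by positivity) (one_le_pow₀ (one_le_truncPow_den hk s))

lemma abs_deriv_truncPow_le_const (hq : 1 < q) (hk : 0 < k) (s : ℝ) :
    |deriv (truncPow q k) s| ≤ q * (1 + k) := by
  have hden := one_le_truncPow_den (q := q) hk s
  have hnum : |s| ^ (q - 1) ≤ (1 + k) * (1 + |s| ^ q / k) := by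
    refine (rpow_sub_one_le_one_add_rpow hq.le (abs_nonneg s)).trans ?_
    rw [add_mul, one_mul, mul_add, mul_div_cancel₀ _ hk.ne']
    linarith
  rw [abs_deriv_truncPow hq hk, div_le_iff₀ (by positivity), mul_assoc]
  refine mul_le_mul_of_nonneg_left (hnum.trans ?_) (by linarith)
  exact mul_le_mul_of_nonneg_left (le_self_pow₀ hden two_ne_zero) (by linarith)

lemma tendsto_truncPow_den (s : ℝ) :
    Tendsto (fun k => 1 + |s| ^ q / k) atTop (𝓝 1) := by
  simpa using tendsto_const_nhds.add (tendsto_id.const_div_atTop (|s| ^ q))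

lemma tendsto_truncPow (s : ℝ) : Tendsto (fun k => truncPow q k s) atTop (𝓝 (|s| ^ q)) := by
  simpa [truncPow, Pi.div_def] using
    (tendsto_const_nhds (x := |s| ^ q)).div (tendsto_truncPow_den s) one_ne_zero

lemma tendsto_deriv_truncPow (hq : 1 < q) (s : ℝ) :
    Tendsto (fun k => deriv (truncPow q k) s) atTop (𝓝 (q * (|s| ^ (q - 2) * s))) := by
  have hlim := (tendsto_const_nhds (x := q * (|s| ^ (q - 2) * s))).div
    ((tendsto_truncPow_den (q := q) s).pow 2) (by norm_num)
  rw [one_pow, div_one] at hlim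
  refine hlim.congr' ?_
  filter_upwards [eventually_gt_atTop 0] with k hk using (hasDerivAt_truncPow hq hk s).deriv.symm

variable {X : Type*} [MeasurableSpace X] {μ : Measure X} {u g : X → ℝ}

lemma tendsto_integral_truncPow_mul (hq : 1 < q) (hu : AEStronglyMeasurable u μ)
    (hg : AEStronglyMeasurable g μ) (h : Integrable (fun x => |u x| ^ q * g x) μ) :
    Tendsto (fun k => ∫ x, truncPow q k (u x) * g x ∂μ) atTop
      (𝓝 (∫ x, |u x| ^ q * g x ∂μ)) := by
  refine tendsto_integral_filter_of_dominated_convergence _ ?_ ?_ h.norm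
    (.of_forall fun x => (tendsto_truncPow (u x)).mul_const _)
  · filter_upwards [eventually_gt_atTop 0] with k hk
    exact ((contDiff_truncPow hq hk).continuous.comp_aestronglyMeasurable hu).mul hg
  · filter_upwards [eventually_gt_atTop 0] with k hk
    refine .of_forall fun x => ?_
    rw [norm_mul, norm_mul, Real.norm_of_nonneg (truncPow_nonneg hk _),
      Real.norm_of_nonneg (by positivity : 0 ≤ |u x| ^ q)]
    exact mul_le_mul_of_nonneg_right (truncPow_le hk _) (norm_nonneg _)

lemma tendsto_integral_deriv_truncPow_mul (hq : 1 < q) (hu : AEStronglyMeasurable u μ)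
    (hg : AEStronglyMeasurable g μ)
    (h : Integrable (fun x => q * (|u x| ^ (q - 2) * u x) * g x) μ) :
    Tendsto (fun k => ∫ x, deriv (truncPow q k) (u x) * g x ∂μ) atTop
      (𝓝 (∫ x, q * (|u x| ^ (q - 2) * u x) * g x ∂μ)) := by
  refine tendsto_integral_filter_of_dominated_convergence _ ?_ ?_ h.norm
    (.of_forall fun x => (tendsto_deriv_truncPow hq (u x)).mul_const _)
  · filter_upwards [eventually_gt_atTop 0] with k hk
    exact (((contDiff_truncPow hq hk).continuous_deriv le_rfl).comp_aestronglyMeasurable hu).mul hg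
  · filter_upwards [eventually_gt_atTop 0] with k hk
    refine .of_forall fun x => ?_
    rw [norm_mul, norm_mul, norm_mul q, Real.norm_of_nonneg (by linarith : 0 ≤ q),
      Real.norm_eq_abs, Real.norm_eq_abs (_ * u x), abs_abs_rpow_sub_two_mul hq]
    exact mul_le_mul_of_nonneg_right (abs_deriv_truncPow_le hq hk _) (norm_nonneg _)

end TruncatedPower

section PowerChainRule

variable {N : ℕ} {u : RN N → ℝ} {D : RN N → RN N} {q : ℝ}

lemma IsWeakGradient.integral_deriv_truncPow_mul_inner (h : IsWeakGradient u D)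
    (hu : MemLp u 2 volume) (hD : MemLp D 2 volume) (hq : 1 < q) {k : ℝ} (hk : 0 < k)
    {Y : RN N → RN N} (hY : ContDiff ℝ 1 Y) (hc : HasCompactSupport Y) :
    ∫ x, deriv (truncPow q k) (u x) * inner ℝ (D x) (Y x)
      = -∫ x, truncPow q k (u x) * divergence Y x := by
  refine h.integral_deriv_comp_mul_inner hD hu (contDiff_truncPow hq hk)
    (C := max k (q * (1 + k))) (fun s => ?_) (fun s => ?_) hY hc
  · rw [abs_of_nonneg (truncPow_nonneg hk s)]
    exact (truncPow_le_const hk s).trans (le_max_left _ _)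
  · exact (abs_deriv_truncPow_le_const hq hk s).trans (le_max_right _ _)

lemma IsWeakGradient.integral_rpow_mul_inner (h : IsWeakGradient u D) (hu : MemLp u 2 volume)
    (hD : MemLp D 2 volume) (hq : 1 < q) {Y : RN N → RN N} (hY : ContDiff ℝ 1 Y)
    (hc : HasCompactSupport Y)
    (hint : Integrable fun x => q * (|u x| ^ (q - 2) * u x) * inner ℝ (D x) (Y x))
    (hint' : Integrable fun x => |u x| ^ q * divergence Y x) :
    ∫ x, q * (|u x| ^ (q - 2) * u x) * inner ℝ (D x) (Y x)
      = -∫ x, |u x| ^ q * divergence Y x := by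
  have hleft := tendsto_integral_deriv_truncPow_mul hq hu.aestronglyMeasurable
    (hD.aestronglyMeasurable.inner hY.continuous.aestronglyMeasurable) hint
  have hright := tendsto_integral_truncPow_mul hq hu.aestronglyMeasurable
    (continuous_divergence hY).aestronglyMeasurable hint'
  refine tendsto_nhds_unique hleft (hright.neg.congr' ?_)
  filter_upwards [eventually_gt_atTop 0] with k hk
  exact (h.integral_deriv_truncPow_mul_inner hu hD hq hk hY hc).symm

end PowerChainRule

/-! ### The Riesz form along a vector field -/

section RegKernel

variable {N : ℕ} {l ε : ℝ}

/-- The kernel `‖z‖⁻ˡ`, smoothed at the origin at scale `√ε`. -/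
noncomputable def regKernel (l ε : ℝ) (z : RN N) : ℝ := (‖z‖ ^ 2 + ε) ^ (-(l / 2))

lemma sq_rpow_neg_half {s : ℝ} (hs : 0 ≤ s) (l : ℝ) : (s ^ 2) ^ (-(l / 2)) = (s ^ l)⁻¹ := by
  rw [← Real.rpow_natCast, ← Real.rpow_mul hs, ← Real.rpow_neg hs]
  congr 1
  push_cast
  ring

lemma regKernel_pos (hε : 0 < ε) (z : RN N) : 0 < regKernel l ε z :=
  Real.rpow_pos_of_pos (by positivity) _

lemma regKernel_neg (z : RN N) : regKernel l ε (-z) = regKernel l ε z := by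
  rw [regKernel, regKernel, norm_neg]

lemma contDiff_regKernel (hε : 0 < ε) : ContDiff ℝ 1 (regKernel (N := N) l ε) :=
  ((contDiff_norm_sq ℝ).add contDiff_const).rpow_const_of_ne fun z => by positivity

lemma fderiv_regKernel (hε : 0 < ε) (z v : RN N) :
    fderiv ℝ (regKernel l ε) z v
      = -(l * ((‖z‖ ^ 2 + ε) ^ (-(l / 2) - 1) * inner ℝ z v)) := by
  have hbase : HasFDerivAt (fun x : RN N => ‖x‖ ^ 2 + ε) (2 • innerSL ℝ z) z := by
    simpa using ((hasStrictFDerivAt_norm_sq z).hasFDerivAt).add_const ε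
  have hpow : fderiv ℝ (regKernel l ε) z = _ :=
    (hbase.rpow_const (p := -(l / 2)) (Or.inl (by positivity))).fderiv
  rw [hpow]
  simp
  ring

lemma regKernel_le (hl : 0 ≤ l) (hε : 0 ≤ ε) {z : RN N} (hz : z ≠ 0) :
    regKernel l ε z ≤ (‖z‖ ^ l)⁻¹ := by
  have hz' : 0 < ‖z‖ := norm_pos_iff.2 hz
  rw [← sq_rpow_neg_half hz'.le, regKernel]
  exact Real.rpow_le_rpow_of_nonpos (by positivity) (by linarith) (by linarith)

lemma abs_fderiv_regKernel_le (hl : 0 ≤ l) (hε : 0 < ε) {z v : RN N} {L : ℝ}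
    (hL : |inner ℝ z v| ≤ L * (‖z‖ ^ 2 + ε)) :
    |fderiv ℝ (regKernel l ε) z v| ≤ l * L * regKernel l ε z := by
  have hbase : 0 < ‖z‖ ^ 2 + ε := by positivity
  have hpow := Real.rpow_nonneg hbase.le (-(l / 2) - 1)
  rw [fderiv_regKernel hε, abs_neg, abs_mul, abs_mul, abs_of_nonneg hl, abs_of_nonneg hpow,
    mul_assoc]
  refine mul_le_mul_of_nonneg_left ?_ hl
  calc (‖z‖ ^ 2 + ε) ^ (-(l / 2) - 1) * |inner ℝ z v|
      ≤ (‖z‖ ^ 2 + ε) ^ (-(l / 2) - 1) * (L * (‖z‖ ^ 2 + ε)) :=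
        mul_le_mul_of_nonneg_left hL hpow
    _ = L * ((‖z‖ ^ 2 + ε) ^ (-(l / 2) - 1) * (‖z‖ ^ 2 + ε)) := by ring
    _ = L * regKernel l ε z := by
        rw [← Real.rpow_add_one hbase.ne', regKernel, sub_add_cancel]

lemma tendsto_const_add_nhdsGT_zero (c : ℝ) : Tendsto (fun ε => c + ε) (𝓝[>] 0) (𝓝 c) := by
  simpa using (tendsto_id (x := 𝓝 (0 : ℝ))).mono_left nhdsWithin_le_nhds |>.const_add c

lemma tendsto_regKernel {z : RN N} (hz : z ≠ 0) :
    Tendsto (fun ε => regKernel l ε z) (𝓝[>] 0) (𝓝 (‖z‖ ^ l)⁻¹) := by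
  have hz' : 0 < ‖z‖ := norm_pos_iff.2 hz
  rw [← sq_rpow_neg_half hz'.le]
  exact (tendsto_const_add_nhdsGT_zero _).rpow_const (Or.inl (by positivity))

lemma tendsto_fderiv_regKernel {z : RN N} (hz : z ≠ 0) (v : RN N) :
    Tendsto (fun ε => fderiv ℝ (regKernel l ε) z v) (𝓝[>] 0)
      (𝓝 (-(l * (inner ℝ z v / ‖z‖ ^ 2)) * (‖z‖ ^ l)⁻¹)) := by
  have hz' : 0 < ‖z‖ := norm_pos_iff.2 hz
  have hvalue : -(l * (inner ℝ z v / ‖z‖ ^ 2)) * (‖z‖ ^ l)⁻¹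
      = -(l * ((‖z‖ ^ 2) ^ (-(l / 2) - 1) * inner ℝ z v)) := by
    rw [Real.rpow_sub_one (by positivity), sq_rpow_neg_half hz'.le]
    ring
  rw [hvalue]
  have hpow := (tendsto_const_add_nhdsGT_zero (‖z‖ ^ 2)).rpow_const (p := -(l / 2) - 1)
    (Or.inl (by positivity))
  refine Tendsto.congr' ?_ ((hpow.mul_const _).const_mul l).neg
  filter_upwards [self_mem_nhdsWithin] with ε hε
  rw [fderiv_regKernel hε]

lemma norm_le_mul_sq_add (hε : 0 < ε) (z : RN N) : ‖z‖ ≤ (1 + 1 / ε) * (‖z‖ ^ 2 + ε) := by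
  have hexpand : (1 + 1 / ε) * (‖z‖ ^ 2 + ε) = ‖z‖ ^ 2 + ‖z‖ ^ 2 / ε + ε + 1 := by
    field_simp
    ring
  have : 0 ≤ ‖z‖ ^ 2 / ε := by positivity
  rw [hexpand]
  nlinarith [sq_nonneg (‖z‖ - 1)]

end RegKernel

section OffDiagonal

variable {N : ℕ} {l c : ℝ} {f g : RN N → ℝ}

lemma ae_fst_ne_snd (hN : 0 < N) : ∀ᵐ z : RN N × RN N ∂(volume.prod volume), z.1 ≠ z.2 := by
  have : Nonempty (Fin N) := ⟨⟨0, hN⟩⟩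
  have : Nontrivial (RN N) := inferInstance
  suffices h : (volume.prod volume) (diagonal (RN N)) = 0 from compl_mem_ae_iff.2 h
  refine (Measure.measure_prod_null measurableSet_diagonal).2 (.of_forall fun x => ?_)
  have : Prod.mk x ⁻¹' diagonal (RN N) = {x} := by
    ext y
    simp [eq_comm]
  simp [this]

lemma norm_mul_mul_le_of_abs_le {F : RN N × RN N → ℝ} {z : RN N × RN N}
    (hF : |F z| ≤ c * (‖z.1 - z.2‖ ^ l)⁻¹) :
    ‖f z.1 * g z.2 * F z‖ ≤ c * ‖f z.1 * g z.2 * (‖z.1 - z.2‖ ^ l)⁻¹‖ := by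
  have hk : 0 ≤ (‖z.1 - z.2‖ ^ l)⁻¹ := by positivity
  rw [norm_mul, norm_mul _ (‖z.1 - z.2‖ ^ l)⁻¹, Real.norm_of_nonneg hk, mul_left_comm]
  exact mul_le_mul_of_nonneg_left hF (norm_nonneg _)

variable (hN : 0 < N) (hf : AEStronglyMeasurable f) (hg : AEStronglyMeasurable g)
  (hfg : Integrable (fun z : RN N × RN N => f z.1 * g z.2 * (‖z.1 - z.2‖ ^ l)⁻¹)
    (volume.prod volume))
include hN hf hg hfg

lemma integrable_mul_mul_of_abs_le {F : RN N × RN N → ℝ} (hF : Continuous F)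
    (hFc : ∀ z, z.1 ≠ z.2 → |F z| ≤ c * (‖z.1 - z.2‖ ^ l)⁻¹) :
    Integrable (fun z : RN N × RN N => f z.1 * g z.2 * F z) (volume.prod volume) := by
  refine (hfg.norm.const_mul c).mono' ((hf.comp_fst.mul hg.comp_snd).mul
    hF.aestronglyMeasurable) ?_
  filter_upwards [ae_fst_ne_snd hN] with z hz
  exact norm_mul_mul_le_of_abs_le (hFc z hz)

lemma tendsto_integral_mul_mul_of_abs_le {ι : Type*} {a : Filter ι} [a.IsCountablyGenerated]
    {F : ι → RN N × RN N → ℝ} {G : RN N × RN N → ℝ} (hF : ∀ᶠ i in a, Continuous (F i))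
    (hFc : ∀ᶠ i in a, ∀ z, z.1 ≠ z.2 → |F i z| ≤ c * (‖z.1 - z.2‖ ^ l)⁻¹)
    (hlim : ∀ z, z.1 ≠ z.2 → Tendsto (fun i => F i z) a (𝓝 (G z))) :
    Tendsto (fun i => ∫ z : RN N × RN N, f z.1 * g z.2 * F i z ∂(volume.prod volume)) a
      (𝓝 (∫ z : RN N × RN N, f z.1 * g z.2 * G z ∂(volume.prod volume))) := by
  refine tendsto_integral_filter_of_dominated_convergence _ ?_ ?_ (hfg.norm.const_mul c) ?_
  · filter_upwards [hF] with i hi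
    exact (hf.comp_fst.mul hg.comp_snd).mul hi.aestronglyMeasurable
  · filter_upwards [hFc] with i hi
    filter_upwards [ae_fst_ne_snd hN] with z hz
    exact norm_mul_mul_le_of_abs_le (hi z hz)
  · filter_upwards [ae_fst_ne_snd hN] with z hz
    exact (hlim z hz).const_mul _

end OffDiagonal

section WeakDerivAlong

variable {N : ℕ} {f b : RN N → ℝ} {X : RN N → RN N}

/-- `b` is the weak derivative `X · ∇f` of `f` along `X`. It is meant for compactly supported `X`,
so that the multipliers `a` need no compact support. -/
def HasWeakDerivAlong (X : RN N → RN N) (f b : RN N → ℝ) : Prop :=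
  ∀ a : RN N → ℝ, ContDiff ℝ 1 a →
    ∫ x, a x * b x = - ∫ x, f x * divergence (fun y => a y • X y) x

lemma IsWeakGradient.hasWeakDerivAlong_rpow {u : RN N → ℝ} {D : RN N → RN N} {p : ℝ}
    (h : IsWeakGradient u D) (hu : MemLp u 2 volume) (hD : MemLp D 2 volume) (hp : 1 < p)
    (hX : ContDiff ℝ 1 X) (hXc : HasCompactSupport X)
    (hf : LocallyIntegrable fun x => |u x| ^ p)
    (hb : Integrable fun x => (|u x| ^ (p - 2) * u x) * inner ℝ (D x) (X x)) :
    HasWeakDerivAlong X (fun x => |u x| ^ p)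
      (fun x => p * ((|u x| ^ (p - 2) * u x) * inner ℝ (D x) (X x))) := by
  intro a ha
  have hY : ContDiff ℝ 1 fun x => a x • X x := ha.smul hX
  have hYc : HasCompactSupport fun x => a x • X x :=
    hXc.mono fun x hx hx0 => hx (by simp [hx0])
  have hmul : ∀ x, p * (|u x| ^ (p - 2) * u x) * inner ℝ (D x) (a x • X x)
      = a x * (p * ((|u x| ^ (p - 2) * u x) * inner ℝ (D x) (X x))) := fun x => by
    rw [inner_smul_right]
    ring
  have hax : Integrable fun x => a x * (p * ((|u x| ^ (p - 2) * u x) * inner ℝ (D x) (X x))) := by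
    have hon := (hb.const_mul p).integrableOn.continuousOn_mul ha.continuous.continuousOn
      hXc.isCompact
    refine (integrableOn_iff_integrable_of_support_subset fun x hx => ?_).1 hon
    by_contra hxX
    exact hx (by simp [image_eq_zero_of_notMem_tsupport hxX])
  simpa only [hmul] using h.integral_rpow_mul_inner hu hD hp hY hYc (by simpa only [hmul] using hax)
    (hf.integrable_smul_right_of_hasCompactSupport (continuous_divergence hY)
      (hasCompactSupport_divergence hYc))

/-- Integrate by parts in `x` for fixed `y`, then symmetrise in `(x, y)`. -/
lemma HasWeakDerivAlong.integral_mul_mul_comp_sub {κ : RN N → ℝ} (h : HasWeakDerivAlong X f b)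
    (hX : ContDiff ℝ 1 X) (hκ : ContDiff ℝ 1 κ) (heven : ∀ z, κ (-z) = κ z)
    (hbf : Integrable (fun z : RN N × RN N => b z.1 * f z.2 * κ (z.1 - z.2))
      (volume.prod volume))
    (hff : Integrable (fun z : RN N × RN N => f z.1 * f z.2 *
      (fderiv ℝ κ (z.1 - z.2) (X z.1) + κ (z.1 - z.2) * divergence X z.1))
      (volume.prod volume)) :
    ∫ z : RN N × RN N, b z.1 * f z.2 * κ (z.1 - z.2) ∂(volume.prod volume)
      = -(1 / 2) * ∫ z : RN N × RN N, f z.1 * f z.2 *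
        (κ (z.1 - z.2) * (divergence X z.1 + divergence X z.2)
          + fderiv ℝ κ (z.1 - z.2) (X z.1 - X z.2)) ∂(volume.prod volume) := by
  set W : RN N × RN N → ℝ := fun z => f z.1 * f z.2 *
    (fderiv ℝ κ (z.1 - z.2) (X z.1) + κ (z.1 - z.2) * divergence X z.1) with hW
  have hdiv : ∀ x y, divergence (fun x => κ (x - y) • X x) x
      = fderiv ℝ κ (x - y) (X x) + κ (x - y) * divergence X x := fun x y => by
    have ha : DifferentiableAt ℝ (fun x => κ (x - y)) x :=
      (hκ.comp (contDiff_id.sub contDiff_const)).differentiable one_ne_zero x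
    rw [divergence_smul ha (hX.differentiable one_ne_zero x), fderiv_comp_sub]
  have hslice : ∀ y, ∫ x, b x * f y * κ (x - y) = - ∫ x, W (x, y) := fun y => by
    have hparts := h _ (hκ.comp (contDiff_id.sub (contDiff_const (c := y))))
    simp only [Function.comp_apply, id, hdiv] at hparts
    have hl : ∀ x, b x * f y * κ (x - y) = f y * (κ (x - y) * b x) := fun x => by ring
    have hr : ∀ x, W (x, y) = f y * (f x * (fderiv ℝ κ (x - y) (X x)
        + κ (x - y) * divergence X x)) := fun x => by simp only [hW]; ring
    simp_rw [hl, hr, integral_const_mul, hparts, mul_neg]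
  have hW_eq : ∫ z : RN N × RN N, b z.1 * f z.2 * κ (z.1 - z.2) ∂(volume.prod volume)
      = - ∫ z, W z ∂(volume.prod volume) := by
    rw [integral_prod_symm _ hbf, integral_prod_symm _ hff, ← integral_neg]
    exact integral_congr_ae (.of_forall hslice)
  have hsum : ∀ z, f z.1 * f z.2 * (κ (z.1 - z.2) * (divergence X z.1 + divergence X z.2)
      + fderiv ℝ κ (z.1 - z.2) (X z.1 - X z.2)) = W z + W z.swap := fun z => by
    simp only [hW, Prod.fst_swap, Prod.snd_swap]
    rw [← neg_sub z.1 z.2, heven, fderiv_neg_of_even heven, map_sub, neg_apply]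
    ring
  have hswap : ∫ z, (W z + W z.swap) ∂(volume.prod volume)
      = 2 * ∫ z, W z ∂(volume.prod volume) := by
    refine (integral_add hff hff.swap).trans ?_
    rw [Function.comp_def, integral_prod_swap, two_mul]
  simp_rw [hsum]
  rw [hW_eq, hswap]
  ring

end WeakDerivAlong

section RieszForm

variable {N : ℕ} {α r : ℝ} {f g b : RN N → ℝ} {X : RN N → RN N}

/-- The logarithmic derivative of the measure `‖x - y‖⁻ˡ dx dy` along the flow of `X`
in both variables. -/
noncomputable def rieszVirial (l : ℝ) (X : RN N → RN N) (z : RN N × RN N) : ℝ :=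
  divergence X z.1 + divergence X z.2
    - l * (inner ℝ (z.1 - z.2) (X z.1 - X z.2) / ‖z.1 - z.2‖ ^ 2)

lemma tendsto_integral_mul_mul_regKernel (hα : 0 < α) (hαN : α < N) (hr : r = 2 * N / (N + α))
    {g : RN N → ℝ} (hf : MemLp f (ENNReal.ofReal r) volume)
    (hg : MemLp g (ENNReal.ofReal r) volume) :
    Tendsto (fun ε => ∫ z : RN N × RN N,
      f z.1 * g z.2 * regKernel (N - α) ε (z.1 - z.2) ∂(volume.prod volume)) (𝓝[>] 0)
      (𝓝 (∫ z : RN N × RN N, f z.1 * g z.2 * (‖z.1 - z.2‖ ^ (N - α))⁻¹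
        ∂(volume.prod volume))) := by
  have hN : 0 < N := by exact_mod_cast hα.trans hαN
  refine tendsto_integral_mul_mul_of_abs_le (c := 1) hN hf.1 hg.1
    (integrable_mul_mul_inv_rpow hα hαN hr hf hg)
    (eventually_mem_nhdsWithin.mono fun ε hε =>
      (contDiff_regKernel hε).continuous.comp (continuous_fst.sub continuous_snd)) ?_
    fun z hz => tendsto_regKernel (sub_ne_zero.2 hz)
  filter_upwards [self_mem_nhdsWithin] with ε hε z hz
  rw [abs_of_pos (regKernel_pos hε _), one_mul]
  exact regKernel_le (sub_nonneg.2 hαN.le) (le_of_lt hε) (sub_ne_zero.2 hz)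

variable (hX : ContDiff ℝ 1 X) (hXc : HasCompactSupport X)
include hX hXc

lemma exists_abs_fderiv_regKernel_add_le {l ε : ℝ} (hl : 0 ≤ l) (hε : 0 < ε) :
    ∃ c : ℝ, ∀ z : RN N × RN N, z.1 ≠ z.2 →
      |fderiv ℝ (regKernel l ε) (z.1 - z.2) (X z.1) + regKernel l ε (z.1 - z.2) * divergence X z.1|
        ≤ c * (‖z.1 - z.2‖ ^ l)⁻¹ := by
  obtain ⟨B, hB0, hB⟩ := exists_forall_norm_le_of_hasCompactSupport hX.continuous hXc
  obtain ⟨d, hd0, hd⟩ := exists_forall_norm_le_of_hasCompactSupport (continuous_divergence hX)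
    (hasCompactSupport_divergence hXc)
  refine ⟨l * ((1 + 1 / ε) * B) + d, fun z hz => ?_⟩
  have hκ := (regKernel_pos (l := l) hε (z.1 - z.2)).le
  have hinner : |inner ℝ (z.1 - z.2) (X z.1)|
      ≤ (1 + 1 / ε) * B * (‖z.1 - z.2‖ ^ 2 + ε) := by
    refine (abs_real_inner_le_norm _ _).trans ?_
    rw [mul_right_comm]
    exact mul_le_mul (norm_le_mul_sq_add hε _) (hB _) (norm_nonneg _) (by positivity)
  calc _ ≤ l * ((1 + 1 / ε) * B) * regKernel l ε (z.1 - z.2)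
        + d * regKernel l ε (z.1 - z.2) := by
        refine (abs_add_le _ _).trans (add_le_add (abs_fderiv_regKernel_le hl hε hinner) ?_)
        rw [abs_mul, abs_of_nonneg hκ, mul_comm]
        exact mul_le_mul_of_nonneg_right (hd _) hκ
    _ = (l * ((1 + 1 / ε) * B) + d) * regKernel l ε (z.1 - z.2) := by ring
    _ ≤ _ := mul_le_mul_of_nonneg_left (regKernel_le hl hε.le (sub_ne_zero.2 hz)) (by positivity)

lemma exists_abs_regKernel_virial_le {l : ℝ} (hl : 0 ≤ l) :
    ∃ c : ℝ, ∀ ε > 0, ∀ z : RN N × RN N, z.1 ≠ z.2 →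
      |regKernel l ε (z.1 - z.2) * (divergence X z.1 + divergence X z.2)
        + fderiv ℝ (regKernel l ε) (z.1 - z.2) (X z.1 - X z.2)| ≤ c * (‖z.1 - z.2‖ ^ l)⁻¹ := by
  obtain ⟨d, hd0, hd⟩ := exists_forall_norm_le_of_hasCompactSupport (continuous_divergence hX)
    (hasCompactSupport_divergence hXc)
  obtain ⟨L, hL0, hL⟩ := exists_forall_norm_sub_le hX hXc
  refine ⟨(d + d) + l * L, fun ε hε z hz => ?_⟩
  have hκ := (regKernel_pos (l := l) hε (z.1 - z.2)).le
  have hinner : |inner ℝ (z.1 - z.2) (X z.1 - X z.2)| ≤ L * (‖z.1 - z.2‖ ^ 2 + ε) := by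
    refine (abs_real_inner_le_norm _ _).trans ?_
    have := mul_le_mul_of_nonneg_left (hL z.1 z.2) (norm_nonneg (z.1 - z.2))
    have := mul_nonneg hL0 hε.le
    nlinarith
  calc _ ≤ (d + d) * regKernel l ε (z.1 - z.2) + l * L * regKernel l ε (z.1 - z.2) := by
        refine (abs_add_le _ _).trans (add_le_add ?_ (abs_fderiv_regKernel_le hl hε hinner))
        rw [abs_mul, abs_of_nonneg hκ, mul_comm]
        exact mul_le_mul_of_nonneg_right
          ((abs_add_le _ _).trans (add_le_add (hd _) (hd _))) hκ
    _ = (d + d + l * L) * regKernel l ε (z.1 - z.2) := by ring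
    _ ≤ _ := mul_le_mul_of_nonneg_left (regKernel_le hl hε.le (sub_ne_zero.2 hz)) (by positivity)

variable (h : HasWeakDerivAlong X f b) (hα : 0 < α) (hαN : α < N) (hr : r = 2 * N / (N + α))
  (hf : MemLp f (ENNReal.ofReal r) volume) (hb : MemLp b (ENNReal.ofReal r) volume)
include h hα hαN hr hf hb

lemma HasWeakDerivAlong.integral_mul_mul_regKernel {ε : ℝ} (hε : 0 < ε) :
    ∫ z : RN N × RN N, b z.1 * f z.2 * regKernel (N - α) ε (z.1 - z.2) ∂(volume.prod volume)
      = -(1 / 2) * ∫ z : RN N × RN N, f z.1 * f z.2 *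
        (regKernel (N - α) ε (z.1 - z.2) * (divergence X z.1 + divergence X z.2)
          + fderiv ℝ (regKernel (N - α) ε) (z.1 - z.2) (X z.1 - X z.2))
          ∂(volume.prod volume) := by
  have hN : 0 < N := by exact_mod_cast hα.trans hαN
  have hl : 0 ≤ (N : ℝ) - α := by linarith
  have hκ := contDiff_regKernel (N := N) (l := N - α) hε
  have hκ' := hκ.continuous_fderiv one_ne_zero
  have hdiv := continuous_divergence hX
  have hX0 := hX.continuous
  obtain ⟨c, hc⟩ := exists_abs_fderiv_regKernel_add_le hX hXc hl hε
  refine h.integral_mul_mul_comp_sub hX hκ regKernel_neg ?_ ?_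
  · refine integrable_mul_mul_of_abs_le (c := 1) hN hb.1 hf.1
      (integrable_mul_mul_inv_rpow hα hαN hr hb hf)
      (hκ.continuous.comp (continuous_fst.sub continuous_snd)) fun z hz => ?_
    rw [abs_of_pos (regKernel_pos hε _), one_mul]
    exact regKernel_le hl hε.le (sub_ne_zero.2 hz)
  · refine integrable_mul_mul_of_abs_le hN hf.1 hf.1 (integrable_mul_mul_inv_rpow hα hαN hr hf hf)
      ?_ hc
    exact ((hκ'.comp (continuous_fst.sub continuous_snd)).clm_apply
      (hX0.comp continuous_fst)).add ((hκ.continuous.comp (continuous_fst.sub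
      continuous_snd)).mul (hdiv.comp continuous_fst))

lemma HasWeakDerivAlong.integral_mul_mul_inv_rpow :
    ∫ z : RN N × RN N, b z.1 * f z.2 * (‖z.1 - z.2‖ ^ (N - α))⁻¹ ∂(volume.prod volume)
      = -(1 / 2) * ∫ z : RN N × RN N, f z.1 * f z.2 *
        ((‖z.1 - z.2‖ ^ (N - α))⁻¹ * rieszVirial (N - α) X z) ∂(volume.prod volume) := by
  have hN : 0 < N := by exact_mod_cast hα.trans hαN
  have hl : 0 ≤ (N : ℝ) - α := by linarith
  have hsub : Continuous fun z : RN N × RN N => z.1 - z.2 := continuous_fst.sub continuous_snd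
  have hleft := tendsto_integral_mul_mul_regKernel hα hαN hr hb hf
  have hright : Tendsto (fun ε => ∫ z : RN N × RN N, f z.1 * f z.2 *
      (regKernel (N - α) ε (z.1 - z.2) * (divergence X z.1 + divergence X z.2)
        + fderiv ℝ (regKernel (N - α) ε) (z.1 - z.2) (X z.1 - X z.2))
        ∂(volume.prod volume)) (𝓝[>] 0)
      (𝓝 (∫ z : RN N × RN N, f z.1 * f z.2 *
        ((‖z.1 - z.2‖ ^ (N - α))⁻¹ * rieszVirial (N - α) X z) ∂(volume.prod volume))) := by
    obtain ⟨c, hc⟩ := exists_abs_regKernel_virial_le hX hXc hl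
    have hdiv := continuous_divergence hX
    have hX0 := hX.continuous
    refine tendsto_integral_mul_mul_of_abs_le hN hf.1 hf.1
      (integrable_mul_mul_inv_rpow hα hαN hr hf hf) (eventually_mem_nhdsWithin.mono fun ε hε => ?_)
      (eventually_mem_nhdsWithin.mono hc) fun z hz => ?_
    · have hκ := contDiff_regKernel (N := N) (l := N - α) hε
      exact ((hκ.continuous.comp hsub).mul ((hdiv.comp continuous_fst).add
        (hdiv.comp continuous_snd))).add (((hκ.continuous_fderiv one_ne_zero).comp hsub).clm_apply
        ((hX0.comp continuous_fst).sub (hX0.comp continuous_snd)))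
    · rw [show (‖z.1 - z.2‖ ^ (N - α))⁻¹ * rieszVirial (N - α) X z = (‖z.1 - z.2‖ ^ (N - α))⁻¹ *
        (divergence X z.1 + divergence X z.2) + -((N - α) * (inner ℝ (z.1 - z.2) (X z.1 - X z.2)
          / ‖z.1 - z.2‖ ^ 2)) * (‖z.1 - z.2‖ ^ (N - α))⁻¹ by rw [rieszVirial]; ring]
      exact ((tendsto_regKernel (sub_ne_zero.2 hz)).mul_const _).add
        (tendsto_fderiv_regKernel (sub_ne_zero.2 hz) _)
  refine tendsto_nhds_unique hleft ((hright.const_mul _).congr' ?_)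
  filter_upwards [self_mem_nhdsWithin] with ε hε
  exact (h.integral_mul_mul_regKernel hX hXc hα hαN hr hf hb hε).symm

end RieszForm

section RieszPotential

variable {N : ℕ} {α r : ℝ} {f g : RN N → ℝ}

lemma integrable_mul_rieszPotential (hα : 0 < α) (hαN : α < N) (hr : r = 2 * N / (N + α))
    (hg : MemLp g (ENNReal.ofReal r) volume) (hf : MemLp f (ENNReal.ofReal r) volume) :
    Integrable (fun x => g x * rieszPotential α f x) ∧
      ∫ x, g x * rieszPotential α f x = rieszConst N α *
        ∫ z : RN N × RN N, g z.1 * f z.2 * (‖z.1 - z.2‖ ^ (N - α))⁻¹ ∂(volume.prod volume) := by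
  have hI := integrable_mul_mul_inv_rpow hα hαN hr hg hf
  have hfubini : ∀ x, g x * rieszPotential α f x
      = rieszConst N α * ∫ y, g x * f y * (‖x - y‖ ^ (N - α))⁻¹ := fun x => by
    rw [rieszPotential, ← integral_const_mul, ← integral_const_mul]
    refine integral_congr_ae (.of_forall fun y => ?_)
    simp only [rieszKernel]
    ring
  simp_rw [hfubini]
  exact ⟨hI.integral_prod_left.const_mul _, by rw [integral_const_mul, integral_prod _ hI]⟩

lemma locallyIntegrable_mul_rieszPotential (hα : 0 < α) (hαN : α < N) (hr : r = 2 * N / (N + α))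
    (hg : MemLpLoc g (ENNReal.ofReal r)) (hf : MemLp f (ENNReal.ofReal r) volume) :
    LocallyIntegrable fun x => g x * rieszPotential α f x := by
  refine locallyIntegrable_iff.2 fun S hS => ?_
  have hind := (integrable_mul_rieszPotential hα hαN hr
    ((memLp_indicator_iff_restrict hS.measurableSet).2 (hg S hS)) hf).1
  simpa only [← indicator_mul_left, integrable_indicator_iff hS.measurableSet] using hind

end RieszPotential

section Powers

variable {N : ℕ} {p r : ℝ}

lemma memLp_norm_rpow {Y F : Type*} [MeasurableSpace Y] {μ : Measure Y} [NormedAddCommGroup F]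
    {f : Y → F} (hp : 0 < p) (hf : MemLp f (ENNReal.ofReal (p * r)) μ) :
    MemLp (fun x => ‖f x‖ ^ p) (ENNReal.ofReal r) μ := by
  have := hf.norm_rpow_div (ENNReal.ofReal p)
  rwa [ENNReal.toReal_ofReal hp.le, ← ENNReal.ofReal_div_of_pos hp,
    mul_div_cancel_left₀ _ hp.ne'] at this

lemma rpow_sub_one_mul_le (hp : 1 ≤ p) {a d : ℝ} (ha : 0 ≤ a) (hd : 0 ≤ d) :
    a ^ (p - 1) * d ≤ a ^ p + d ^ p := by
  have hpow : ∀ s : ℝ, 0 ≤ s → s ^ (p - 1) * s = s ^ p := fun s hs => by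
    rw [← Real.rpow_add_one' hs (by linarith), sub_add_cancel]
  rcases le_total d a with h | h
  · have := mul_le_mul_of_nonneg_left h (Real.rpow_nonneg ha (p - 1))
    linarith [hpow a ha, Real.rpow_nonneg hd p]
  · have := mul_le_mul_of_nonneg_right (Real.rpow_le_rpow ha h (sub_nonneg.2 hp)) hd
    linarith [hpow d hd, Real.rpow_nonneg ha p]

variable {u : RN N → ℝ} (hp : 1 < p) (hu : AEStronglyMeasurable u)
  (hf : MemLp (fun x => |u x| ^ p) (ENNReal.ofReal r) volume)
include hp hu hf

lemma memLpLoc_rpow_sub_two_mul :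
    MemLpLoc (fun x => |u x| ^ (p - 2) * u x) (ENNReal.ofReal r) := fun S hS => by
  have : IsFiniteMeasure (volume.restrict S) := isFiniteMeasure_restrict.2 hS.measure_lt_top.ne
  refine ((memLp_const (1 : ℝ)).add (hf.restrict S)).mono'
    ((continuous_abs_rpow_sub_two_mul hp).comp_aestronglyMeasurable hu.restrict)
    (.of_forall fun x => ?_)
  rw [Real.norm_eq_abs, abs_abs_rpow_sub_two_mul hp]
  exact rpow_sub_one_le_one_add_rpow hp.le (abs_nonneg _)

variable {D X : RN N → RN N} (hD : AEStronglyMeasurable D)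
  (hDloc : MemLpLoc D (ENNReal.ofReal (p * r))) (hX : Continuous X) (hXc : HasCompactSupport X)
include hD hDloc hX hXc

lemma memLp_rpow_sub_two_mul_inner :
    MemLp (fun x => (|u x| ^ (p - 2) * u x) * inner ℝ (D x) (X x)) (ENNReal.ofReal r) volume := by
  obtain ⟨B, hB0, hB⟩ := exists_forall_norm_le_of_hasCompactSupport hX hXc
  have hS : IsCompact (tsupport X) := hXc
  have hbound : ∀ x, ‖(|u x| ^ (p - 2) * u x) * inner ℝ (D x) (X x)‖
      ≤ B * ‖|u x| ^ p + ‖D x‖ ^ p‖ := fun x => by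
    have hu0 := Real.rpow_nonneg (abs_nonneg (u x)) (p - 1)
    have hinner := (abs_real_inner_le_norm (D x) (X x)).trans
      (mul_le_mul_of_nonneg_left (hB x) (norm_nonneg _))
    rw [Real.norm_eq_abs, Real.norm_of_nonneg (by positivity), abs_mul,
      abs_abs_rpow_sub_two_mul hp]
    calc |u x| ^ (p - 1) * |inner ℝ (D x) (X x)|
        ≤ |u x| ^ (p - 1) * (‖D x‖ * B) := mul_le_mul_of_nonneg_left hinner hu0
      _ = B * (|u x| ^ (p - 1) * ‖D x‖) := by ring
      _ ≤ _ := mul_le_mul_of_nonneg_left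
        (rpow_sub_one_mul_le hp.le (abs_nonneg _) (norm_nonneg _)) hB0
  have hon := ((hf.restrict (tsupport X)).add
    (memLp_norm_rpow (by linarith) (hDloc _ hS))).of_le_mul (c := B)
    (((continuous_abs_rpow_sub_two_mul hp).comp_aestronglyMeasurable hu).mul
      (hD.inner hX.aestronglyMeasurable)).restrict (.of_forall hbound)
  rw [← memLp_indicator_iff_restrict hS.measurableSet, indicator_eq_self.2] at hon
  · exact hon
  · intro x hx
    by_contra hxX
    exact hx (by simp [image_eq_zero_of_notMem_tsupport hxX])

lemma integrable_rpow_sub_two_mul_inner (hr : 1 ≤ r) :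
    Integrable fun x => (|u x| ^ (p - 2) * u x) * inner ℝ (D x) (X x) := by
  have hloc := (memLp_rpow_sub_two_mul_inner hp hu hf hD hDloc hX hXc).locallyIntegrable
    (by simpa using hr)
  refine (integrableOn_iff_integrable_of_support_subset fun x hx => ?_).1
    (hloc.integrableOn_isCompact hXc.isCompact)
  by_contra hxX
  exact hx (by simp [image_eq_zero_of_notMem_tsupport hxX])

end Powers

/-! ### The elliptic identity -/

section EllipticIdentity

variable {N : ℕ} {η u f : RN N → ℝ} {D X : RN N → RN N}

lemma HasWeakNegDivergence.ae_eq_neg_sum (heq : HasWeakNegDivergence D f)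
    (hf : LocallyIntegrable f) {g : Fin N → RN N → RN N}
    (hg : ∀ i, IsWeakGradient (fun x => D x i) (g i)) :
    f =ᵐ[volume] fun x => -∑ i, g i x i := by
  have hgi : ∀ i, LocallyIntegrable fun x => g i x i := fun i =>
    locallyIntegrable_coord (hg i).locallyIntegrable_grad i
  have hsum : LocallyIntegrable fun x => ∑ i, g i x i := locallyIntegrable_iff.2 fun S hS =>
    integrable_finsetSum _ fun i _ => locallyIntegrable_iff.1 (hgi i) S hS
  have hzero : ∀ᵐ x, f x + ∑ i, g i x i = 0 := by
    refine ae_eq_zero_of_integral_contDiff_smul_eq_zero (hf.add hsum) fun ψ hψs hψc => ?_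
    have hψ : IsTestFunction ψ := ⟨hψs, hψc⟩
    have hint : ∀ {w : RN N → ℝ}, LocallyIntegrable w → Integrable fun x => w x * ψ x :=
      fun hw => hw.integrable_smul_right_of_hasCompactSupport hψs.continuous hψc
    have hDint : ∀ i, Integrable fun x => D x i * fderiv ℝ ψ x (stdVec i) := fun i =>
      (hg i).locallyIntegrable_fun.integrable_smul_right_of_hasCompactSupport
        (continuous_fderiv_apply hψ.contDiff_one continuous_const)
        (hasCompactSupport_fderiv_apply hψc _)
    have hparts : ∫ x, f x * ψ x = -∑ i, ∫ x, g i x i * ψ x := by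
      rw [← heq ψ hψ, ← Finset.sum_neg_distrib]
      simp_rw [inner_eq_sum_coord, gradient_apply]
      rw [integral_finsetSum _ fun i _ => hDint i]
      exact Finset.sum_congr rfl fun i _ => by simp_rw [(hg i).integral_mul_fderiv hψ i, mul_comm]
    calc ∫ x, ψ x • (f x + ∑ i, g i x i)
        = ∫ x, (f x * ψ x + ∑ i, g i x i * ψ x) :=
          integral_congr_ae (.of_forall fun x => by
            simp only [smul_eq_mul]
            rw [← Finset.sum_mul]
            ring)
      _ = 0 := by
          rw [integral_add (hint hf) (integrable_finsetSum _ fun i _ => hint (hgi i)),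
            integral_finsetSum _ fun i _ => hint (hgi i), hparts, neg_add_cancel]
  exact hzero.mono fun x hx => eq_neg_of_add_eq_zero_left hx

lemma HasWeakNegDivergence.memLpLoc_two (heq : HasWeakNegDivergence D f)
    (hf : LocallyIntegrable f) (hD : ∀ i, MemH1Loc fun x => D x i) : MemLpLoc f 2 := by
  choose _ g hg hg2 using hD
  intro S hS
  refine MemLp.ae_eq (ae_restrict_of_ae (heq.ae_eq_neg_sum hf hg).symm)
    (memLp_finsetSum _ fun i _ => (hg2 i S hS).eval_piLp i).neg

lemma memLp_mul_of_memLpLoc {s : ENNReal} {g : RN N → ℝ} (hf : MemLpLoc f s) (hg : Continuous g)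
    (hgc : HasCompactSupport g) : MemLp (fun x => f x * g x) s volume := by
  obtain ⟨B, -, hB⟩ := exists_forall_norm_le_of_hasCompactSupport hg hgc
  have hS : IsCompact (tsupport g) := hgc
  have hind : (tsupport g).indicator (fun x => f x * g x) = fun x => f x * g x :=
    indicator_eq_self.2 fun x hx => by_contra fun hxg =>
      hx (by simp [image_eq_zero_of_notMem_tsupport hxg])
  rw [← hind, memLp_indicator_iff_restrict hS.measurableSet]
  refine (hf _ hS).of_le_mul (c := B) ((hf _ hS).1.mul hg.aestronglyMeasurable)
    (.of_forall fun x => ?_)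
  rw [norm_mul, mul_comm]
  exact mul_le_mul_of_nonneg_right (hB x) (norm_nonneg _)

section

variable (h : IsWeakGradient u D) (hD : MemLp D 2 volume) (hf : MemLpLoc f 2)
  (hXc : HasCompactSupport X)
include hD hf hXc

lemma integrable_mul_inner_of_memLpLoc (hX : Continuous X) :
    Integrable (fun x => f x * inner ℝ (D x) (X x)) ∧
      ∫ x, f x * inner ℝ (D x) (X x) = ∑ i, ∫ x, f x * X x i * D x i := by
  have hint : ∀ i, Integrable fun x => f x * X x i * D x i := fun i =>
    (memLp_mul_of_memLpLoc hf (by fun_prop) (hasCompactSupport_coord hXc i)).integrable_mul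
      (hD.eval_piLp i)
  have hexp : ∀ x, f x * inner ℝ (D x) (X x) = ∑ i, f x * X x i * D x i := fun x => by
    rw [inner_eq_sum_coord, Finset.mul_sum]
    exact Finset.sum_congr rfl fun i _ => by ring
  simp_rw [hexp]
  exact ⟨integrable_finsetSum _ fun i _ => hint i, integral_finsetSum _ fun i _ => hint i⟩

include h in
lemma IsWeakGradient.tendsto_integral_mul_fderiv_mollify (hη : IsMollifier η) (hX : Continuous X) :
    Tendsto (fun t => ∫ x, f x * fderiv ℝ (mollify (rescale η t) u) x (X x)) (𝓝[>] 0)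
      (𝓝 (∫ x, f x * inner ℝ (D x) (X x))) := by
  have hfX : ∀ i, MemLp (fun x => f x * X x i) 2 volume := fun i =>
    memLp_mul_of_memLpLoc hf (by fun_prop) (hasCompactSupport_coord hXc i)
  have hmem : ∀ i, ∀ᶠ t in 𝓝[>] (0 : ℝ),
      MemLp (mollify (rescale η t) fun y => D y i) 2 volume := fun i =>
    eventually_mem_nhdsWithin.mono fun t ht => hη.memLp_mollify ht (hD.eval_piLp i)
  rw [(integrable_mul_inner_of_memLpLoc hD hf hXc hX).2]
  refine (tendsto_finsetSum _ fun i _ => tendsto_integral_mul_of_integral_sq (hfX i)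
    (hD.eval_piLp i) (hmem i) (hη.tendsto_integral_sq_mollify_sub (hD.eval_piLp i))).congr' ?_
  filter_upwards [eventually_all.2 hmem, self_mem_nhdsWithin] with t htmem ht
  refine (integral_finsetSum _ fun i _ => (hfX i).integrable_mul (htmem i)).symm.trans
    (integral_congr_ae (.of_forall fun x => ?_))
  simp only [h.fderiv_mollify_apply (hη.isTestFunction_rescale ht), Finset.mul_sum, Pi.mul_apply,
    mul_assoc]

end

lemma IsWeakGradient.integral_mul_inner_self (h : IsWeakGradient u D) (hu : MemLp u 2 volume)
    (hD : MemLp D 2 volume) (hX : ContDiff ℝ 1 X) (hXc : HasCompactSupport X) :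
    ∫ x, u x * inner ℝ (D x) (X x) = -(1 / 2) * ∫ x, u x ^ 2 * divergence X x := by
  obtain ⟨η, -, hη, -⟩ := exists_isMollifier_isRadialPotential N
  exact tendsto_nhds_unique
    (h.tendsto_integral_mul_fderiv_mollify hD (fun S _ => hu.restrict S) hXc hη hX.continuous)
    (hη.tendsto_integral_mul_fderiv_mollify hu hX hXc)

lemma IsWeakGradient.stressForm_eq_integral (h : IsWeakGradient u D) (hD : MemLp D 2 volume)
    (heq : HasWeakNegDivergence D f) (hf : MemLpLoc f 2) (hX : ContDiff ℝ ∞ X)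
    (hXc : HasCompactSupport X) : stressForm X D = ∫ x, f x * inner ℝ (D x) (X x) := by
  obtain ⟨η, -, hη, -⟩ := exists_isMollifier_isRadialPotential N
  refine tendsto_nhds_unique ((tendsto_integral_inner_gradient_mollify hX hXc hD h hη).congr' ?_)
    (h.tendsto_integral_mul_fderiv_mollify hD hf hXc hη hX.continuous)
  filter_upwards [self_mem_nhdsWithin] with t ht
  exact heq _ (.fderiv_apply (hη.contDiff_mollify h.locallyIntegrable_fun ht) hX hXc)

end EllipticIdentity

/-! ### The virial of the coupling -/

section Coupling

variable {N : ℕ} {q : ℝ} {K u φ : RN N → ℝ} {D Dφ X : RN N → RN N}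

lemma aestronglyMeasurable_mul_rpow_sub_two_mul_inner (hu : MemLp u 2 volume)
    (hD : MemLp D 2 volume) (hq : 1 < q) (hK : Continuous K) (hX : Continuous X) :
    AEStronglyMeasurable
      (fun x => K x * (|u x| ^ (q - 2) * u x) * inner ℝ (D x) (X x)) volume :=
  (hK.aestronglyMeasurable.mul
    ((continuous_abs_rpow_sub_two_mul hq).comp_aestronglyMeasurable hu.1)).mul
    (hD.1.inner hX.aestronglyMeasurable)

variable (h : IsWeakGradient u D)
  (hu : MemLp u 2 volume) (hD : MemLp D 2 volume) (hq : 1 < q) (hK : ContDiff ℝ 1 K)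
include h hu hD hq hK

lemma IsWeakGradient.integral_truncPow_mul_fderiv {k : ℝ} (hk : 0 < k) (hX : ContDiff ℝ 1 X)
    (hXc : HasCompactSupport X) :
    Integrable (fun x => truncPow q k (u x) * fderiv ℝ K x (X x)) ∧
      ∫ x, truncPow q k (u x) * fderiv ℝ K x (X x)
        = -(∫ x, deriv (truncPow q k) (u x) * (K x * inner ℝ (D x) (X x)))
          - ∫ x, truncPow q k (u x) * (K x * divergence X x) := by
  have hT : LocallyIntegrable fun x => truncPow q k (u x) :=
    (memLp_top_of_bound ((contDiff_truncPow hq hk).continuous.comp_aestronglyMeasurable hu.1) k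
      (.of_forall fun x => by
        rw [Real.norm_of_nonneg (truncPow_nonneg hk _)]
        exact truncPow_le_const hk _)).locallyIntegrable le_top
  have hdK : Integrable fun x => truncPow q k (u x) * fderiv ℝ K x (X x) :=
    hT.integrable_smul_right_of_hasCompactSupport (continuous_fderiv_apply hK hX.continuous)
      (hXc.mono fun x hx hx0 => hx (by simp [hx0]))
  have hdiv : Integrable fun x => truncPow q k (u x) * (K x * divergence X x) :=
    hT.integrable_smul_right_of_hasCompactSupport (hK.continuous.mul (continuous_divergence hX))
      ((hasCompactSupport_divergence hXc).mono fun x hx hx0 => hx (by simp [hx0]))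
  have hparts := h.integral_deriv_truncPow_mul_inner hu hD hq hk (hK.smul hX)
    (hXc.mono fun x hx hx0 => hx (by simp [hx0]))
  have hsplit : ∀ x, truncPow q k (u x) * divergence (fun y => K y • X y) x
      = truncPow q k (u x) * fderiv ℝ K x (X x) + truncPow q k (u x) * (K x * divergence X x) :=
    fun x => by
      rw [divergence_smul (hK.differentiable one_ne_zero x) (hX.differentiable one_ne_zero x),
        mul_add]
  change ∫ x, deriv (truncPow q k) (u x) * inner ℝ (D x) (K x • X x)
    = -∫ x, truncPow q k (u x) * divergence (fun y => K y • X y) x at hparts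
  simp_rw [hsplit, real_inner_smul_right] at hparts
  rw [integral_add hdK hdiv] at hparts
  exact ⟨hdK, by linarith⟩

lemma IsWeakGradient.integral_rpow_mul_fderiv (hX : ContDiff ℝ 1 X) (hXc : HasCompactSupport X)
    (hKu : LocallyIntegrable fun x => K x * |u x| ^ q)
    (hint : Integrable fun x => K x * (|u x| ^ (q - 2) * u x) * inner ℝ (D x) (X x))
    (hquasi : IsQuasiIntegrable (fun x => |u x| ^ q * fderiv ℝ K x (X x)) volume) :
    Integrable (fun x => |u x| ^ q * fderiv ℝ K x (X x)) ∧
      ∫ x, |u x| ^ q * fderiv ℝ K x (X x)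
        = -(q * ∫ x, K x * (|u x| ^ (q - 2) * u x) * inner ℝ (D x) (X x))
          - ∫ x, K x * |u x| ^ q * divergence X x := by
  have hk : ∀ n : ℕ, (0 : ℝ) < n + 1 := fun n => by positivity
  have hk_top : Tendsto (fun n : ℕ => (n : ℝ) + 1) atTop atTop :=
    tendsto_atTop_add_const_right _ _ tendsto_natCast_atTop_atTop
  have hgrad : Tendsto (fun k => ∫ x, deriv (truncPow q k) (u x) * (K x * inner ℝ (D x) (X x)))
      atTop (𝓝 (q * ∫ x, K x * (|u x| ^ (q - 2) * u x) * inner ℝ (D x) (X x))) := by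
    rw [← integral_const_mul]
    have hexp : ∀ x, q * (K x * (|u x| ^ (q - 2) * u x) * inner ℝ (D x) (X x))
        = q * (|u x| ^ (q - 2) * u x) * (K x * inner ℝ (D x) (X x)) := fun x => by ring
    have hint' := hint.const_mul q
    simp_rw [hexp] at hint' ⊢
    exact tendsto_integral_deriv_truncPow_mul hq hu.1
      (hK.continuous.aestronglyMeasurable.mul (hD.1.inner hX.continuous.aestronglyMeasurable)) hint'
  have hdiv : Tendsto (fun k => ∫ x, truncPow q k (u x) * (K x * divergence X x)) atTop
      (𝓝 (∫ x, K x * |u x| ^ q * divergence X x)) := by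
    have hint' : Integrable fun x => K x * |u x| ^ q * divergence X x :=
      hKu.integrable_smul_right_of_hasCompactSupport (continuous_divergence hX)
        (hasCompactSupport_divergence hXc)
    have hexp : ∀ x, K x * |u x| ^ q * divergence X x = |u x| ^ q * (K x * divergence X x) :=
      fun x => by ring
    simp_rw [hexp] at hint' ⊢
    exact tendsto_integral_truncPow_mul hq hu.1
      (hK.continuous.mul (continuous_divergence hX)).aestronglyMeasurable hint'
  refine integrable_mul_of_tendsto_of_isQuasiIntegrable (A := fun x => |u x| ^ q)
    (v := fun n x => truncPow q (n + 1) (u x))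
    (fun n => .of_forall fun x => truncPow_nonneg (hk n) _)
    (fun n => .of_forall fun x => truncPow_le (hk n) _) (.of_forall fun _ => le_rfl)
    (fun n => (h.integral_truncPow_mul_fderiv hu hD hq hK (hk n) hX hXc).1)
    (.of_forall fun x => (tendsto_truncPow _).comp hk_top) ?_ hquasi
  refine ((hgrad.neg.sub hdiv).comp hk_top).congr fun n => ?_
  exact (h.integral_truncPow_mul_fderiv hu hD hq hK (hk n) hX hXc).2.symm

variable (hX : ContDiff ℝ ∞ X) (hXc : HasCompactSupport X)
  (hKu : LocallyIntegrable fun x => K x * |u x| ^ q)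
  (heq : HasWeakNegDivergence Dφ fun x => K x * |u x| ^ q)
  (hint : Integrable fun x =>
    φ x * (K x * (|u x| ^ (q - 2) * u x) * inner ℝ (D x) (X x)))
  (hquasi : IsQuasiIntegrable (fun x => φ x * (|u x| ^ q * fderiv ℝ K x (X x))) volume)
include hX hXc hKu heq hint hquasi

lemma IsWeakGradient.integral_mul_rpow_mul_fderiv_of_le {m : RN N → ℝ} (hm : ContDiff ℝ ∞ m)
    (hm0 : ∀ x, 0 ≤ m x) (hmφ : ∀ᵐ x, m x ≤ φ x) :
    Integrable (fun x => m x * (|u x| ^ q * fderiv ℝ K x (X x))) ∧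
      ∫ x, m x * (|u x| ^ q * fderiv ℝ K x (X x))
        = -(q * ∫ x, m x * (K x * (|u x| ^ (q - 2) * u x) * inner ℝ (D x) (X x)))
          - (∫ x, inner ℝ (Dφ x) (gradient (fun y => fderiv ℝ m y (X y)) x))
          - ∫ x, m x * (K x * |u x| ^ q * divergence X x) := by
  have hm1 : ContDiff ℝ 1 m := hm.of_le (by simp)
  have hX1 : ContDiff ℝ 1 X := hX.of_le (by simp)
  have hmc := hm.continuous.aestronglyMeasurable (μ := (volume : Measure (RN N)))
  have hs : AEStronglyMeasurable (fun x => |u x| ^ q * fderiv ℝ K x (X x)) volume :=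
    ((continuous_abs_rpow (by linarith)).comp_aestronglyMeasurable hu.1).mul
      (continuous_fderiv_apply hK hX.continuous).aestronglyMeasurable
  have hg := aestronglyMeasurable_mul_rpow_sub_two_mul_inner hu hD hq hK.continuous hX.continuous
  have hquasi_m := hquasi.mul_of_le (hmc.mul hs) (.of_forall hm0) hmφ
  have hint_m := integrable_mul_of_nonneg_of_le hint (hmc.mul hg) (.of_forall hm0) hmφ
  have hdm : IsTestFunction fun x => fderiv ℝ m x (X x) := .fderiv_apply hm hX hXc
  have hdm_int := hKu.integrable_smul_right_of_hasCompactSupport hdm.1.continuous hdm.2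
  have hmdiv := hKu.integrable_smul_right_of_hasCompactSupport
    (hm.continuous.mul (continuous_divergence hX1))
    ((hasCompactSupport_divergence hXc).mono fun x hx hx0 => hx (by simp [hx0]))
  have hs_eq : ∀ x, |u x| ^ q * fderiv ℝ K x (m x • X x)
      = m x * (|u x| ^ q * fderiv ℝ K x (X x)) := fun x => by
    rw [map_smul, smul_eq_mul, mul_left_comm]
  have hg_eq : ∀ x, K x * (|u x| ^ (q - 2) * u x) * inner ℝ (D x) (m x • X x)
      = m x * (K x * (|u x| ^ (q - 2) * u x) * inner ℝ (D x) (X x)) := fun x => by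
    rw [real_inner_smul_right, mul_left_comm]
  have hdiv_eq : ∀ x, K x * |u x| ^ q * divergence (fun y => m y • X y) x
      = K x * |u x| ^ q * fderiv ℝ m x (X x) + m x * (K x * |u x| ^ q * divergence X x) :=
    fun x => by
      rw [divergence_smul (hm1.differentiable one_ne_zero x) (hX1.differentiable one_ne_zero x)]
      ring
  have hB := h.integral_rpow_mul_fderiv hu hD hq hK (X := fun x => m x • X x) (hm1.smul hX1)
    (hXc.mono fun x hx hx0 => hx (by simp [hx0])) hKu
  simp_rw [hs_eq, hg_eq, hdiv_eq] at hB
  obtain ⟨hB_int, hB_eq⟩ := hB hint_m hquasi_m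
  refine ⟨hB_int, hB_eq.trans ?_⟩
  rw [heq _ hdm, sub_sub]
  congr 1
  refine integral_add hdm_int (hmdiv.congr (.of_forall fun x => ?_))
  simp only [Pi.mul_apply, smul_eq_mul]
  ring

/-- The radial mollifications of `φ` lie between `0` and `φ`, so one-sided integrability passes from
`φ` to them, and their virials control that of `φ` in the limit. -/
lemma IsWeakGradient.integral_mul_rpow_mul_fderiv (hN : 0 < N) (hK0 : ∀ x, 0 ≤ K x)
    (hφD : IsWeakGradient φ Dφ) (hφ : MemLp φ 2 volume) (hDφ : MemLp Dφ 2 volume) :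
    Integrable (fun x => φ x * (|u x| ^ q * fderiv ℝ K x (X x))) ∧
      ∫ x, φ x * (|u x| ^ q * fderiv ℝ K x (X x))
        = -(q * ∫ x, φ x * (K x * (|u x| ^ (q - 2) * u x) * inner ℝ (D x) (X x)))
          - stressForm X Dφ - ∫ x, φ x * (K x * |u x| ^ q * divergence X x) := by
  have hf0 : 0 ≤ᵐ[volume] fun x => K x * |u x| ^ q :=
    .of_forall fun x => mul_nonneg (hK0 x) (Real.rpow_nonneg (abs_nonneg _) _)
  have hX1 : ContDiff ℝ 1 X := hX.of_le (by simp)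
  obtain ⟨η, ζ, hη, hζ⟩ := exists_isMollifier_isRadialPotential N
  obtain ⟨t, ht0, ht, hae⟩ := hη.exists_seq_tendsto_ae hφ
  have hs := heq.isWeaklySuperharmonic hf0
  have hm : ∀ n, ContDiff ℝ ∞ (mollify (rescale η (t n)) φ) := fun n =>
    hη.contDiff_mollify hφD.locallyIntegrable_fun (ht0 n)
  have hm0 : ∀ n x, 0 ≤ mollify (rescale η (t n)) φ x := fun n =>
    hs.mollify_nonneg hφD hη hζ hN hφ (ht0 n)
  have hmφ : ∀ n, ∀ᵐ x, mollify (rescale η (t n)) φ x ≤ φ x := fun n =>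
    (hs.mollify_le hφD hη hζ hφ).mono fun x hx => hx _ (ht0 n)
  have hdiv : Integrable fun x => φ x * (K x * |u x| ^ q * divergence X x) := by
    obtain ⟨C, _, hC⟩ := exists_forall_norm_le_of_hasCompactSupport (continuous_divergence hX1)
      (hasCompactSupport_divergence hXc)
    refine ((hφD.integral_mul_eq_integral_norm_sq hN hφ hDφ hKu hf0 heq).1.mul_bdd
      (continuous_divergence hX1).aestronglyMeasurable (.of_forall hC)).congr
      (.of_forall fun x => mul_assoc _ _ _)
  have hlim := fun {g : RN N → ℝ} (hg : AEStronglyMeasurable g volume)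
      (hφg : Integrable fun x => φ x * g x) =>
    tendsto_integral_mul_of_nonneg_of_le hφg
      (fun n => (hm n).continuous.aestronglyMeasurable.mul hg) (fun n => .of_forall (hm0 n)) hmφ hae
  have hstep := fun n => h.integral_mul_rpow_mul_fderiv_of_le hu hD hq hK hX hXc hKu heq hint hquasi
    (hm n) (hm0 n) (hmφ n)
  refine integrable_mul_of_tendsto_of_isQuasiIntegrable (A := φ) (fun n => .of_forall (hm0 n))
    hmφ (.of_forall fun _ => le_rfl) (fun n => (hstep n).1) hae ?_ hquasi
  simp_rw [fun n => (hstep n).2]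
  exact (((hlim (aestronglyMeasurable_mul_rpow_sub_two_mul_inner hu hD hq hK.continuous
      hX.continuous) hint).const_mul q).neg.sub
    ((tendsto_integral_inner_gradient_mollify hX hXc hDφ hφD hη).comp ht)).sub
    (hlim (hKu.aestronglyMeasurable.mul (continuous_divergence hX1).aestronglyMeasurable) hdiv)

end Coupling

/-! ### Dilated cutoffs of the position field -/

section CutoffField

variable {N : ℕ} {θ : RN N → ℝ}

/-- The position field cut off at distance of order `l⁻¹`. -/
noncomputable def cutoffField (θ : RN N → ℝ) (l : ℝ) (x : RN N) : RN N := θ (l • x) • x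

lemma cutoffField_eq_smul {l : ℝ} (hl : l ≠ 0) (x : RN N) :
    cutoffField θ l x = l⁻¹ • cutoffField θ 1 (l • x) := by
  rw [cutoffField, cutoffField, one_smul, smul_comm, smul_smul l⁻¹, inv_mul_cancel₀ hl, one_smul]

lemma eventually_norm_smul_lt_one {ι : Type*} {a : Filter ι} {l : ι → ℝ} (hl : Tendsto l a (𝓝 0))
    (x : RN N) : ∀ᶠ i in a, ‖l i • x‖ < 1 := by
  have hlim : Tendsto (fun i => ‖l i • x‖) a (𝓝 0) := by simpa using (hl.smul_const x).norm
  exact hlim.eventually_lt_const one_pos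

namespace IsCutoff

variable (hθ : IsCutoff θ)
include hθ

lemma contDiff_cutoffField (l : ℝ) : ContDiff ℝ ∞ (cutoffField θ l) :=
  (hθ.contDiff.comp (contDiff_const_smul l)).smul contDiff_id

lemma contDiff_one_cutoffField (l : ℝ) : ContDiff ℝ 1 (cutoffField θ l) :=
  (hθ.contDiff_cutoffField l).of_le (by simp)

lemma hasCompactSupport_cutoffField {l : ℝ} (hl : l ≠ 0) : HasCompactSupport (cutoffField θ l) :=
  (hasCompactSupport_comp_smul hθ.hasCompactSupport hl).smul_right

lemma fderiv_cutoffField {l : ℝ} (hl : l ≠ 0) (x : RN N) :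
    fderiv ℝ (cutoffField θ l) x = fderiv ℝ (cutoffField θ 1) (l • x) := by
  have hdiff : Differentiable ℝ (cutoffField θ 1) :=
    (hθ.contDiff_one_cutoffField 1).differentiable one_ne_zero
  have hscaled : DifferentiableAt ℝ (fun y => cutoffField θ 1 (l • y)) x :=
    hdiff.comp (differentiable_id.const_smul l) x
  rw [funext (cutoffField_eq_smul (θ := θ) hl), fderiv_fun_const_smul hscaled, fderiv_comp_smul,
    smul_smul, inv_mul_cancel₀ hl, one_smul]

lemma divergence_cutoffField {l : ℝ} (hl : l ≠ 0) (x : RN N) :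
    divergence (cutoffField θ l) x = divergence (cutoffField θ 1) (l • x) := by
  simp only [divergence, hθ.fderiv_cutoffField hl]

lemma fderiv_cutoffField_of_lt {l : ℝ} {x : RN N} (h : ‖l • x‖ < 1) :
    fderiv ℝ (cutoffField θ l) x = ContinuousLinearMap.id ℝ (RN N) := by
  have hnear : ∀ᶠ y in 𝓝 x, ‖l • y‖ < 1 :=
    (continuous_id.const_smul l).norm.continuousAt.eventually_lt continuousAt_const h
  have heq : cutoffField θ l =ᶠ[𝓝 x] id := by
    filter_upwards [hnear] with y hy
    rw [cutoffField, hθ.eq_one _ hy.le, one_smul, id]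
  rw [heq.fderiv_eq, fderiv_id]

lemma divergence_cutoffField_of_lt {l : ℝ} {x : RN N} (h : ‖l • x‖ < 1) :
    divergence (cutoffField θ l) x = N := by
  rw [divergence, hθ.fderiv_cutoffField_of_lt h]
  simp [stdVec]

lemma rieszVirial_cutoffField_of_lt {l c : ℝ} {z : RN N × RN N} (hz : z.1 ≠ z.2)
    (h₁ : ‖l • z.1‖ < 1) (h₂ : ‖l • z.2‖ < 1) :
    rieszVirial c (cutoffField θ l) z = 2 * N - c := by
  have hz' : ‖z.1 - z.2‖ ^ 2 ≠ 0 := by simpa [sub_eq_zero] using hz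
  rw [rieszVirial, hθ.divergence_cutoffField_of_lt h₁, hθ.divergence_cutoffField_of_lt h₂,
    cutoffField, cutoffField, hθ.eq_one _ h₁.le, hθ.eq_one _ h₂.le, one_smul, one_smul,
    real_inner_self_eq_norm_sq, div_self hz']
  ring

lemma exists_norm_fderiv_cutoffField_le :
    ∃ C, ∀ l ≠ 0, ∀ x, ‖fderiv ℝ (cutoffField θ l) x‖ ≤ C := by
  obtain ⟨C, _, hC⟩ := exists_forall_norm_le_of_hasCompactSupport
    ((hθ.contDiff_one_cutoffField 1).continuous_fderiv one_ne_zero)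
    ((hθ.hasCompactSupport_cutoffField one_ne_zero).fderiv ℝ)
  exact ⟨C, fun l hl x => by rw [hθ.fderiv_cutoffField hl]; exact hC _⟩

lemma exists_abs_divergence_cutoffField_le :
    ∃ C, ∀ l ≠ 0, ∀ x, |divergence (cutoffField θ l) x| ≤ C := by
  obtain ⟨C, _, hC⟩ := exists_forall_norm_le_of_hasCompactSupport
    (continuous_divergence (hθ.contDiff_one_cutoffField 1))
    (hasCompactSupport_divergence (hθ.hasCompactSupport_cutoffField one_ne_zero))
  exact ⟨C, fun l hl x => by rw [hθ.divergence_cutoffField hl]; exact hC _⟩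

lemma exists_norm_cutoffField_sub_le :
    ∃ L, ∀ l ≠ 0, ∀ x y, ‖cutoffField θ l x - cutoffField θ l y‖ ≤ L * ‖x - y‖ := by
  obtain ⟨L, _, hL⟩ := exists_forall_norm_sub_le (hθ.contDiff_one_cutoffField 1)
    (hθ.hasCompactSupport_cutoffField one_ne_zero)
  refine ⟨L, fun l hl x y => ?_⟩
  rw [cutoffField_eq_smul hl, cutoffField_eq_smul hl y, ← smul_sub, norm_smul, norm_inv,
    inv_mul_le_iff₀ (norm_pos_iff.2 hl), mul_left_comm, ← norm_smul, smul_sub]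
  exact hL _ _

lemma exists_abs_rieszVirial_cutoffField_le {c : ℝ} (hc : 0 ≤ c) :
    ∃ C, ∀ l ≠ 0, ∀ z : RN N × RN N, z.1 ≠ z.2 → |rieszVirial c (cutoffField θ l) z| ≤ C := by
  obtain ⟨d, hd⟩ := hθ.exists_abs_divergence_cutoffField_le
  obtain ⟨L, hL⟩ := hθ.exists_norm_cutoffField_sub_le
  refine ⟨d + d + c * L, fun l hl z hz => ?_⟩
  have hz' : 0 < ‖z.1 - z.2‖ := norm_pos_iff.2 (sub_ne_zero.2 hz)
  have hinner : |inner ℝ (z.1 - z.2) (cutoffField θ l z.1 - cutoffField θ l z.2)|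
      ≤ L * ‖z.1 - z.2‖ ^ 2 :=
    calc _ ≤ ‖z.1 - z.2‖ * (L * ‖z.1 - z.2‖) := (abs_real_inner_le_norm _ _).trans <|
          mul_le_mul_of_nonneg_left (hL l hl _ _) hz'.le
      _ = _ := by ring
  refine (abs_sub _ _).trans (add_le_add
    ((abs_add_le _ _).trans (add_le_add (hd l hl _) (hd l hl _))) ?_)
  rw [abs_mul, abs_of_nonneg hc, abs_div, abs_of_nonneg (sq_nonneg ‖z.1 - z.2‖)]
  exact mul_le_mul_of_nonneg_left ((div_le_iff₀ (by positivity)).2 hinner) hc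

section Limits

variable {ι : Type*} {a : Filter ι} [a.IsCountablyGenerated] {l : ι → ℝ} (hl0 : ∀ i, l i ≠ 0)
  (hl : Tendsto l a (𝓝 0))
include hl0 hl

lemma tendsto_integral_mul_divergence {w : RN N → ℝ} (hw : Integrable w) :
    Tendsto (fun i => ∫ x, w x * divergence (cutoffField θ (l i)) x) a (𝓝 (N * ∫ x, w x)) := by
  obtain ⟨d, hd⟩ := hθ.exists_abs_divergence_cutoffField_le
  simp_rw [mul_comm (N : ℝ), ← integral_mul_const]
  refine tendsto_integral_filter_of_dominated_convergence (fun x => ‖w x‖ * d)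
    (.of_forall fun i => hw.1.mul
      (continuous_divergence (hθ.contDiff_one_cutoffField _)).aestronglyMeasurable)
    (.of_forall fun i => .of_forall fun x => ?_) (hw.norm.mul_const d) (.of_forall fun x => ?_)
  · exact (norm_mul _ _).trans_le (mul_le_mul_of_nonneg_left (hd _ (hl0 i) x) (norm_nonneg _))
  · refine tendsto_const_nhds.congr' ?_
    filter_upwards [eventually_norm_smul_lt_one hl x] with i hi
    rw [hθ.divergence_cutoffField_of_lt hi]

lemma tendsto_integral_inner_fderiv {D : RN N → RN N} (hD : MemLp D 2 volume) :
    Tendsto (fun i => ∫ x, inner ℝ (D x) (fderiv ℝ (cutoffField θ (l i)) x (D x))) a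
      (𝓝 (∫ x, ‖D x‖ ^ 2)) := by
  obtain ⟨C, hC⟩ := hθ.exists_norm_fderiv_cutoffField_le
  refine tendsto_integral_filter_of_dominated_convergence (fun x => C * ‖D x‖ ^ 2)
    (.of_forall fun i => hD.1.inner (memLp_fderiv_apply_of_hasCompactSupport
      (hθ.contDiff_cutoffField _) (hθ.hasCompactSupport_cutoffField (hl0 i)) hD).1)
    (.of_forall fun i => .of_forall fun x => ?_)
    ((hD.integrable_norm_pow two_ne_zero).const_mul C) (.of_forall fun x => ?_)
  · calc |inner ℝ (D x) (fderiv ℝ (cutoffField θ (l i)) x (D x))|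
        ≤ ‖D x‖ * (C * ‖D x‖) := (abs_real_inner_le_norm _ _).trans <|
          mul_le_mul_of_nonneg_left
            (ContinuousLinearMap.le_of_opNorm_le _ (hC _ (hl0 i) x) _) (norm_nonneg _)
      _ = C * ‖D x‖ ^ 2 := by ring
  · refine tendsto_const_nhds.congr' ?_
    filter_upwards [eventually_norm_smul_lt_one hl x] with i hi
    rw [hθ.fderiv_cutoffField_of_lt hi, ContinuousLinearMap.id_apply, real_inner_self_eq_norm_sq]

lemma tendsto_stressForm {D : RN N → RN N} (hD : MemLp D 2 volume) :
    Tendsto (fun i => stressForm (cutoffField θ (l i)) D) a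
      (𝓝 (-(((N : ℝ) - 2) / 2) * ∫ x, ‖D x‖ ^ 2)) := by
  have hD2 : Integrable fun x => ‖D x‖ ^ 2 := hD.integrable_norm_pow two_ne_zero
  have hsplit : ∀ i, stressForm (cutoffField θ (l i)) D
      = (∫ x, inner ℝ (D x) (fderiv ℝ (cutoffField θ (l i)) x (D x)))
        - 1 / 2 * ∫ x, ‖D x‖ ^ 2 * divergence (cutoffField θ (l i)) x := fun i =>
    stressForm_eq_sub (hθ.contDiff_cutoffField _)
      (hθ.hasCompactSupport_cutoffField (hl0 i)) hD
  simp_rw [hsplit]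
  convert (hθ.tendsto_integral_inner_fderiv hl0 hl hD).sub
    ((hθ.tendsto_integral_mul_divergence hl0 hl hD2).const_mul (1 / 2)) using 2
  ring

lemma tendsto_integral_mul_rieszVirial (hN : 0 < N) {c : ℝ} (hc : 0 ≤ c) {F : RN N × RN N → ℝ}
    (hF : Integrable F (volume.prod volume)) :
    Tendsto (fun i => ∫ z, F z * rieszVirial c (cutoffField θ (l i)) z ∂(volume.prod volume)) a
      (𝓝 ((2 * N - c) * ∫ z, F z ∂(volume.prod volume))) := by
  obtain ⟨C, hC⟩ := hθ.exists_abs_rieszVirial_cutoffField_le hc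
  simp_rw [mul_comm (2 * (N : ℝ) - c), ← integral_mul_const]
  refine tendsto_integral_filter_of_dominated_convergence (fun z => ‖F z‖ * C)
    (.of_forall fun i => hF.1.mul (Measurable.aestronglyMeasurable ?_)) (.of_forall fun i => ?_)
    (hF.norm.mul_const C) ?_
  · have hdiv := (continuous_divergence (hθ.contDiff_one_cutoffField (l i))).measurable
    have hX := (hθ.contDiff_one_cutoffField (l i)).continuous.measurable
    unfold rieszVirial
    fun_prop
  · filter_upwards [ae_fst_ne_snd hN] with z hz
    exact (norm_mul _ _).trans_le (mul_le_mul_of_nonneg_left (hC _ (hl0 i) z hz) (norm_nonneg _))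
  · filter_upwards [ae_fst_ne_snd hN] with z hz
    refine tendsto_const_nhds.congr' ?_
    filter_upwards [eventually_norm_smul_lt_one hl z.1, eventually_norm_smul_lt_one hl z.2]
      with i h₁ h₂
    rw [hθ.rieszVirial_cutoffField_of_lt hz h₁ h₂]

end Limits

end IsCutoff

end CutoffField

/-! ### Solutions -/

section ChoquardTerm

variable {N : ℕ} {α p : ℝ} {u : RN N → ℝ} {D X : RN N → RN N}

lemma IsWeakGradient.integral_inner_mul_rieszPotential_rpow (h : IsWeakGradient u D)
    (hu : MemLp u 2 volume) (hD : MemLp D 2 volume) (hp : 1 < p) (hα : 0 < α) (hαN : α < N)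
    (hup : MemLp (fun x => |u x| ^ p) (ENNReal.ofReal (2 * N / (N + α))) volume)
    (hDloc : MemLpLoc D (ENNReal.ofReal (p * (2 * N / (N + α)))))
    (hX : ContDiff ℝ 1 X) (hXc : HasCompactSupport X) :
    Integrable (fun x => (|u x| ^ (p - 2) * u x) * inner ℝ (D x) (X x)
        * rieszPotential α (fun y => |u y| ^ p) x) ∧
      ∫ x, (|u x| ^ (p - 2) * u x) * inner ℝ (D x) (X x)
          * rieszPotential α (fun y => |u y| ^ p) x
        = -(rieszConst N α / (2 * p)) * ∫ z : RN N × RN N, |u z.1| ^ p * |u z.2| ^ p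
            * ((‖z.1 - z.2‖ ^ ((N : ℝ) - α))⁻¹ * rieszVirial ((N : ℝ) - α) X z)
            ∂(volume.prod volume) := by
  have hr : 1 ≤ 2 * N / (N + α) := by rw [le_div_iff₀ (by linarith)]; linarith
  have hb := memLp_rpow_sub_two_mul_inner hp hu.1 hup hD.1 hDloc hX.continuous hXc
  have hderiv := h.hasWeakDerivAlong_rpow hu hD hp hX hXc
    (hup.locallyIntegrable (ENNReal.one_le_ofReal.2 hr))
    (integrable_rpow_sub_two_mul_inner hp hu.1 hup hD.1 hDloc hX.continuous hXc hr)
  have hvir := hderiv.integral_mul_mul_inv_rpow hX hXc hα hαN rfl hup (hb.const_mul p)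
  simp_rw [mul_assoc p, integral_const_mul] at hvir
  obtain ⟨hint, heq⟩ := integrable_mul_rieszPotential hα hαN rfl hb hup
  refine ⟨hint, ?_⟩
  have hp0 : p ≠ 0 := by linarith
  rw [heq, eq_div_of_mul_eq hp0 ((mul_comm _ _).trans hvir)]
  ring

end ChoquardTerm

/-- The regularity class of `HasSolutionRegularity` with `K |u|^q ∈ L^1_loc` in place of
`K |u|^q ∈ L^(2N/(N+2))`; it is meaningful in every dimension. -/
structure HasLocalSolutionRegularity {N : ℕ} (α p q : ℝ) (K u φ : RN N → ℝ)
    (Du Dφ : RN N → RN N) : Prop where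
  u_L2 : MemLp u 2 volume
  Du_L2 : MemLp Du 2 volume
  u_Ls : MemLp u (ENNReal.ofReal (2 * N * p / (N + α))) volume
  φ_L2 : MemLp φ 2 volume
  Dφ_L2 : MemLp Dφ 2 volume
  source_loc : LocallyIntegrable (fun x => K x * |u x| ^ q) volume
  Du_H1loc : ∀ i : Fin N, MemH1Loc (fun x => Du x i)
  Du_Lsloc : MemLpLoc Du (ENNReal.ofReal (2 * N * p / (N + α)))

section Solution

variable {N : ℕ} {α p q : ℝ} {K u φ : RN N → ℝ} {Du Dφ : RN N → RN N}

lemma HasSolutionRegularity.toLocal (hreg : HasSolutionRegularity α p q K u φ Du Dφ)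
    (hN : 2 ≤ N) : HasLocalSolutionRegularity α p q K u φ Du Dφ where
  u_L2 := hreg.u_L2
  Du_L2 := hreg.Du_L2
  u_Ls := hreg.u_Ls
  φ_L2 := hreg.φ_L2
  Dφ_L2 := hreg.Dφ_L2
  source_loc := hreg.source_Lr.locallyIntegrable <| ENNReal.one_le_ofReal.2 <| by
    have hN' : (2 : ℝ) ≤ N := by exact_mod_cast hN
    rw [le_div_iff₀ (by positivity)]
    linarith
  Du_H1loc := hreg.Du_H1loc
  Du_Lsloc := hreg.Du_Lsloc

namespace HasLocalSolutionRegularity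

variable (hreg : HasLocalSolutionRegularity α p q K u φ Du Dφ)
include hreg

lemma memLp_rpow (hp : 0 < p) :
    MemLp (fun x => |u x| ^ p) (ENNReal.ofReal (2 * N / (N + α))) volume := by
  refine memLp_norm_rpow (f := u) hp ?_
  rw [show p * (2 * N / (N + α)) = 2 * N * p / (N + α) by ring]
  exact hreg.u_Ls

lemma memLpLoc_grad : MemLpLoc Du (ENNReal.ofReal (p * (2 * N / (N + α)))) := by
  rw [show p * (2 * N / (N + α)) = 2 * N * p / (N + α) by ring]
  exact hreg.Du_Lsloc

lemma locallyIntegrable_choquard (hα : 0 < α) (hαN : α < N) (hp : 1 < p) :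
    LocallyIntegrable fun x =>
      (|u x| ^ (p - 2) * u x) * rieszPotential α (fun y => |u y| ^ p) x :=
  have hup := hreg.memLp_rpow (one_pos.trans hp)
  locallyIntegrable_mul_rieszPotential hα hαN rfl
    (memLpLoc_rpow_sub_two_mul hp hreg.u_L2.1 hup) hup

end HasLocalSolutionRegularity

/-- The function `f` for which the first equation of the system reads `-Δu = f`. -/
noncomputable def solutionForce (α p q : ℝ) (K u φ : RN N → ℝ) (x : RN N) : ℝ :=
  (|u x| ^ (p - 2) * u x) * rieszPotential α (fun y => |u y| ^ p) x
    - φ x * (K x * (|u x| ^ (q - 2) * u x)) - u x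

namespace IsWeakSolution

variable (hsol : IsWeakSolution α p q K u φ Du Dφ)
  (hreg : HasLocalSolutionRegularity α p q K u φ Du Dφ) (hN : 0 < N) (hK0 : ∀ x, 0 ≤ K x)
include hsol hreg hN hK0

lemma integral_mul_source :
    Integrable (fun x => φ x * (K x * |u x| ^ q)) ∧
      ∫ x, φ x * (K x * |u x| ^ q) = ∫ x, ‖Dφ x‖ ^ 2 :=
  hsol.grad_φ.integral_mul_eq_integral_norm_sq hN hreg.φ_L2 hreg.Dφ_L2 hreg.source_loc
    (.of_forall fun x => mul_nonneg (hK0 x) (by positivity)) hsol.eq_φ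

variable (hK : ContDiff ℝ 1 K) (hq : 1 < q)
include hK hq

lemma locallyIntegrable_coupling :
    LocallyIntegrable fun x => φ x * (K x * (|u x| ^ (q - 2) * u x)) := by
  have hφK : LocallyIntegrable fun x => φ x * K x := locallyIntegrableOn_univ.1 <|
    ((locallyIntegrable_of_memLp_two hreg.φ_L2).locallyIntegrableOn univ).mul_continuousOn
      hK.continuous.continuousOn isOpen_univ.isLocallyClosed
  have hsource := (hsol.integral_mul_source hreg hN hK0).1.locallyIntegrable
  have hdom : LocallyIntegrable fun x => ‖φ x * K x‖ + ‖φ x * (K x * |u x| ^ q)‖ :=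
    fun x => (hφK x).norm.add (hsource x).norm
  refine hdom.mono (hreg.φ_L2.1.mul <|
    hK.continuous.aestronglyMeasurable.mul <|
      (continuous_abs_rpow_sub_two_mul hq).comp_aestronglyMeasurable hreg.u_L2.1)
    (.of_forall fun x => ?_)
  calc ‖φ x * (K x * (|u x| ^ (q - 2) * u x))‖ = |φ x| * |K x| * |u x| ^ (q - 1) := by
        rw [Real.norm_eq_abs, abs_mul, abs_mul, abs_abs_rpow_sub_two_mul hq, mul_assoc]
    _ ≤ |φ x| * |K x| * (1 + |u x| ^ q) := by
        gcongr
        exact rpow_sub_one_le_one_add_rpow hq.le (abs_nonneg _)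
    _ = ‖φ x * K x‖ + ‖φ x * (K x * |u x| ^ q)‖ := by
        simp only [Real.norm_eq_abs, abs_mul, Real.abs_rpow_of_nonneg (abs_nonneg (u x)), abs_abs]
        ring
    _ ≤ _ := le_abs_self _

variable (hα : 0 < α) (hαN : α < N) (hp : 1 < p)
include hα hαN hp

lemma locallyIntegrable_solutionForce : LocallyIntegrable (solutionForce α p q K u φ) :=
  ((hreg.locallyIntegrable_choquard hα hαN hp).sub
    (hsol.locallyIntegrable_coupling hreg hN hK0 hK hq)).sub
      (locallyIntegrable_of_memLp_two hreg.u_L2)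

lemma hasWeakNegDivergence_solutionForce :
    HasWeakNegDivergence Du (solutionForce α p q K u φ) := fun ψ hψ => by
  have htest : ∀ {f : RN N → ℝ}, LocallyIntegrable f → Integrable fun x => f x * ψ x := fun hf =>
    hf.integrable_smul_right_of_hasCompactSupport hψ.1.continuous hψ.2
  have hR := htest (hreg.locallyIntegrable_choquard hα hαN hp)
  have hQ := htest (hsol.locallyIntegrable_coupling hreg hN hK0 hK hq)
  have hu := htest (locallyIntegrable_of_memLp_two hreg.u_L2)
  have heq := hsol.eq_u ψ hψ
  simp_rw [mul_comm (rieszPotential _ _ _), mul_comm (K _) (φ _), mul_assoc (φ _) (K _)] at heq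
  simp_rw [solutionForce, sub_mul]
  rw [integral_sub (hR.sub' hQ) hu, integral_sub hR hQ, ← heq]
  ring

section StressIdentity

variable {X : RN N → RN N} (hX : ContDiff ℝ ∞ X) (hXc : HasCompactSupport X)
include hX hXc

lemma stressForm_grad :
    Integrable (fun x => φ x * (K x * (|u x| ^ (q - 2) * u x) * inner ℝ (Du x) (X x))) ∧
      stressForm X Du
        = -(rieszConst N α / (2 * p)) * (∫ z : RN N × RN N, |u z.1| ^ p * |u z.2| ^ p
            * ((‖z.1 - z.2‖ ^ ((N : ℝ) - α))⁻¹ * rieszVirial ((N : ℝ) - α) X z)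
            ∂(volume.prod volume))
          - (∫ x, φ x * (K x * (|u x| ^ (q - 2) * u x) * inner ℝ (Du x) (X x)))
          + 1 / 2 * ∫ x, u x ^ 2 * divergence X x := by
  have hX1 : ContDiff ℝ 1 X := hX.of_le (by simp)
  have hforce := hsol.hasWeakNegDivergence_solutionForce hreg hN hK0 hK hq hα hαN hp
  have hforce2 := hforce.memLpLoc_two
    (hsol.locallyIntegrable_solutionForce hreg hN hK0 hK hq hα hαN hp) hreg.Du_H1loc
  obtain ⟨hR, hR_eq⟩ := hsol.grad_u.integral_inner_mul_rieszPotential_rpow hreg.u_L2 hreg.Du_L2 hp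
    hα hαN (hreg.memLp_rpow (one_pos.trans hp)) hreg.memLpLoc_grad hX1 hXc
  have hF := (integrable_mul_inner_of_memLpLoc hreg.Du_L2 hforce2 hXc hX.continuous).1
  have hu := (integrable_mul_inner_of_memLpLoc hreg.Du_L2 (fun _ _ => hreg.u_L2.restrict _) hXc
    hX.continuous).1
  have hexp : ∀ x, φ x * (K x * (|u x| ^ (q - 2) * u x) * inner ℝ (Du x) (X x))
      = (|u x| ^ (p - 2) * u x) * inner ℝ (Du x) (X x) * rieszPotential α (fun y => |u y| ^ p) x
        - solutionForce α p q K u φ x * inner ℝ (Du x) (X x) - u x * inner ℝ (Du x) (X x) :=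
    fun x => by rw [solutionForce]; ring
  simp_rw [hexp]
  refine ⟨(hR.sub' hF).sub' hu, ?_⟩
  rw [integral_sub (hR.sub' hF) hu, integral_sub hR hF, hR_eq,
    hsol.grad_u.integral_mul_inner_self hreg.u_L2 hreg.Du_L2 hX1 hXc,
    hsol.grad_u.stressForm_eq_integral hreg.Du_L2 hforce hforce2 hX hXc]
  ring

end StressIdentity

variable (hquasi : IsQuasiIntegrable (virialDensity q K u φ) volume)
include hquasi

lemma integral_cutoff_mul_virialDensity {θ : RN N → ℝ} (hθ : IsCutoff θ) {l : ℝ} (hl : l ≠ 0) :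
    Integrable (fun x => θ (l • x) * virialDensity q K u φ x) ∧
      ∫ x, θ (l • x) * virialDensity q K u φ x
        = q * (stressForm (cutoffField θ l) Du
            + rieszConst N α / (2 * p) * (∫ z : RN N × RN N, |u z.1| ^ p * |u z.2| ^ p
              * (‖z.1 - z.2‖ ^ ((N : ℝ) - α))⁻¹
              * rieszVirial ((N : ℝ) - α) (cutoffField θ l) z ∂(volume.prod volume))
            - 1 / 2 * ∫ x, u x ^ 2 * divergence (cutoffField θ l) x)
          - stressForm (cutoffField θ l) Dφ
          - ∫ x, φ x * (K x * |u x| ^ q) * divergence (cutoffField θ l) x := by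
  have hX := hθ.contDiff_cutoffField l
  have hXc := hθ.hasCompactSupport_cutoffField hl
  have hdensity : ∀ x, φ x * (|u x| ^ q * fderiv ℝ K x (cutoffField θ l x))
      = θ (l • x) * virialDensity q K u φ x := fun x => by
    rw [virialDensity, inner_gradient_right_real, cutoffField, map_smul, smul_eq_mul]
    ring
  have hmeas : AEStronglyMeasurable (fun x => θ (l • x) * virialDensity q K u φ x) volume :=
    (hθ.contDiff.continuous.comp (continuous_const_smul l)).aestronglyMeasurable.mul <|
      (hreg.φ_L2.1.mul ((continuous_abs_rpow (by linarith)).comp_aestronglyMeasurable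
        hreg.u_L2.1)).mul (continuous_id.inner (continuous_gradient hK)).aestronglyMeasurable
  have hquasi' : IsQuasiIntegrable (fun x => θ (l • x) * virialDensity q K u φ x) volume :=
    IsQuasiIntegrable.mul_of_le (A := fun _ => 1) (by simpa only [one_mul] using hquasi) hmeas
      (.of_forall fun x => hθ.nonneg _) (.of_forall fun x => hθ.le_one _)
  obtain ⟨hcoupling, hstress⟩ := hsol.stressForm_grad hreg hN hK0 hK hq hα hαN hp hX hXc
  simp_rw [← hdensity] at hquasi' ⊢
  obtain ⟨hint, heq⟩ := hsol.grad_u.integral_mul_rpow_mul_fderiv hreg.u_L2 hreg.Du_L2 hq hK hX hXc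
    hreg.source_loc hsol.eq_φ hcoupling hquasi' hN hK0 hsol.grad_φ hreg.φ_L2 hreg.Dφ_L2
  refine ⟨hint, ?_⟩
  rw [heq, hstress]
  simp only [mul_assoc]
  ring

lemma integral_virialDensity :
    Integrable (virialDensity q K u φ) ∧
      ∫ x, virialDensity q K u φ x
        = -(q * (((N : ℝ) - 2) / 2)) * (∫ x, ‖Du x‖ ^ 2) - q * (N / 2) * (∫ x, u x ^ 2)
          - (N + 2) / 2 * (∫ x, φ x * (K x * |u x| ^ q))
          + q * ((N + α) / (2 * p)) * ∫ x, |u x| ^ p * rieszPotential α (fun y => |u y| ^ p) x := by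
  obtain ⟨θ, hθ⟩ := exists_isCutoff N
  obtain ⟨l, hl0, hl⟩ : ∃ l : ℕ → ℝ, (∀ n, l n ≠ 0) ∧ Tendsto l atTop (𝓝 0) :=
    ⟨fun n => 1 / ((n : ℝ) + 1), fun n => by positivity, tendsto_one_div_add_atTop_nhds_zero_nat⟩
  have hup := hreg.memLp_rpow (one_pos.trans hp)
  obtain ⟨hsource, henergy⟩ := hsol.integral_mul_source hreg hN hK0
  have hcut := fun n => hsol.integral_cutoff_mul_virialDensity hreg hN hK0 hK hq hα hαN hp hquasi
    hθ (hl0 n)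
  have hlim := ((((hθ.tendsto_stressForm hl0 hl hreg.Du_L2).add
    ((hθ.tendsto_integral_mul_rieszVirial hl0 hl hN (sub_nonneg.2 hαN.le)
      (integrable_mul_mul_inv_rpow hα hαN rfl hup hup)).const_mul (rieszConst N α / (2 * p)))).sub
    ((hθ.tendsto_integral_mul_divergence hl0 hl hreg.u_L2.integrable_sq).const_mul
      (1 / 2))).const_mul q |>.sub (hθ.tendsto_stressForm hl0 hl hreg.Dφ_L2)).sub
    (hθ.tendsto_integral_mul_divergence hl0 hl hsource)
  obtain ⟨hint, heq⟩ := integrable_mul_of_tendsto_of_isQuasiIntegrable (w := fun _ => 1)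
    (A := fun _ => 1) (fun n => .of_forall fun x => hθ.nonneg (l n • x))
    (fun n => .of_forall fun x => hθ.le_one _) (.of_forall fun _ => le_rfl)
    (fun n => (hcut n).1) (.of_forall fun x => hθ.tendsto_comp_smul hl x)
    (hlim.congr fun n => (hcut n).2.symm) (by simpa only [one_mul] using hquasi)
  simp only [one_mul] at hint heq
  refine ⟨hint, ?_⟩
  rw [heq, (integrable_mul_rieszPotential hα hαN rfl hup hup).2, henergy]
  ring

end IsWeakSolution

end Solution

theorem proposition4p1_general (N : ℕ) (α p q : ℝ) (hα : 0 < α) (hαN : α < N)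
    (hp : 1 < p) (hq : 1 < q)
    (K : RN N → ℝ) (hK : ContDiff ℝ 1 K) (hK0 : ∀ x, 0 ≤ K x)
    (u φ : RN N → ℝ) (Du Dφ : RN N → RN N)
    (hsol : IsWeakSolution α p q K u φ Du Dφ)
    (hreg : HasLocalSolutionRegularity α p q K u φ Du Dφ) :
    Integrable (fun x => ‖Du x‖ ^ 2) volume ∧
    Integrable (fun x => |u x| ^ 2) volume ∧
    Integrable (fun x => K x * φ x * |u x| ^ q) volume ∧
    Integrable (fun x => rieszPotential α (fun y => |u y| ^ p) x * |u x| ^ p) volume ∧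
    ((Integrable (fun x => max (virialDensity q K u φ x) 0) volume ∨
        Integrable (fun x => max (-virialDensity q K u φ x) 0) volume) →
      Integrable (virialDensity q K u φ) volume ∧
      (∫ x, (((N : ℝ) - 2) / 2 * ‖Du x‖ ^ 2 + (N : ℝ) / 2 * |u x| ^ 2))
          + ((N : ℝ) + 2) / (2 * q) * (∫ x, K x * φ x * |u x| ^ q)
          + 1 / q * (∫ x, virialDensity q K u φ x)
        = ((N : ℝ) + α) / (2 * p)
            * ∫ x, rieszPotential α (fun y => |u y| ^ p) x * |u x| ^ p) := by
  have hN : 0 < N := by exact_mod_cast hα.trans hαN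
  have hDu2 : Integrable fun x => ‖Du x‖ ^ 2 := hreg.Du_L2.integrable_norm_pow two_ne_zero
  have hu2 : Integrable fun x => u x ^ 2 := hreg.u_L2.integrable_sq
  have hup := hreg.memLp_rpow (one_pos.trans hp)
  have hcoupling := (hsol.integral_mul_source hreg hN hK0).1
  have hchoquard := (integrable_mul_rieszPotential hα hαN rfl hup hup).1
  simp_rw [sq_abs, mul_comm (K _) (φ _), mul_assoc (φ _), mul_comm (rieszPotential _ _ _)]
  refine ⟨hDu2, hu2, hcoupling, hchoquard, fun hquasi => ?_⟩
  obtain ⟨hvirial, hvirial_eq⟩ :=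
    hsol.integral_virialDensity hreg hN hK0 hK hq hα hαN hp hquasi
  refine ⟨hvirial, ?_⟩
  have hq0 : q ≠ 0 := by linarith
  rw [integral_add (hDu2.const_mul _) (hu2.const_mul _), integral_const_mul, integral_const_mul,
    hvirial_eq]
  field_simp
  ring

theorem proposition4p1 (N : ℕ) (hN : 3 ≤ N) (α p q : ℝ) (hα : 0 < α) (hαN : α < N)
    (hp : 1 < p) (hq : 1 < q)
    (K : RN N → ℝ) (hK : ContDiff ℝ 1 K) (hK0 : ∀ x, 0 ≤ K x)
    (u φ : RN N → ℝ) (Du Dφ : RN N → RN N)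
    (hsol : IsWeakSolution α p q K u φ Du Dφ)
    (hreg : HasSolutionRegularity α p q K u φ Du Dφ) :
    Integrable (fun x => ‖Du x‖ ^ 2) volume ∧
    Integrable (fun x => |u x| ^ 2) volume ∧
    Integrable (fun x => K x * φ x * |u x| ^ q) volume ∧
    Integrable (fun x => rieszPotential α (fun y => |u y| ^ p) x * |u x| ^ p) volume ∧
    -- the remaining integral is only required to exist in the extended sense
    ((Integrable (fun x => max (virialDensity q K u φ x) 0) volume ∨
        Integrable (fun x => max (-virialDensity q K u φ x) 0) volume) →
      Integrable (virialDensity q K u φ) volume ∧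
      (∫ x, (((N : ℝ) - 2) / 2 * ‖Du x‖ ^ 2 + (N : ℝ) / 2 * |u x| ^ 2))
          + ((N : ℝ) + 2) / (2 * q) * (∫ x, K x * φ x * |u x| ^ q)
          + 1 / q * (∫ x, virialDensity q K u φ x)
        = ((N : ℝ) + α) / (2 * p)
            * ∫ x, rieszPotential α (fun y => |u y| ^ p) x * |u x| ^ p) :=
  proposition4p1_general N α p q hα hαN hp hq K hK hK0 u φ Du Dφ hsol
    (hreg.toLocal (by omega))
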